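/- Let $M$ be a smooth (Hausdorff, second countable) manifold of dimension $m$. All manifolds below are smooth, Hausdorff and second countable; they need not be connected, and, apart from $M$, their connected components may have different dimensions. **Singular foliations.** A *singular foliation* $\mathcal F$ on $M$ is a subsheaf of $C^\infty_M$-modules of the sheaf of smooth vector fields on $M$ that is stable under the Lie bracket and locally finitely generated. Vector fields $X_1,\dots,X_n\in\mathcal F(U)$ are *generators* of $\mathcal F$ on the open set $U$ if, for every open $V\subseteq U$, every element of $\mathcal F(V)$ is a combination $\sum_i f_iX_i|_V$ with $f_i\in C^\infty(V)$. For $x\in M$ let $\mathrm{rk}_x(\mathcal F)$ be the smallest $n$ such that $\mathcal F$ has $n$ generators on some open neighbourhood of $x$, and let $\mathrm{rk}(\mathcal F)=\sup_{x\in M}\mathrm{rk}_x(\mathcal F)\in\mathbb N\cup\{\infty\}$; $\mathcal F$ has *finite rank* if $\mathrm{rk}(\mathcal F)<\infty$. We call $\mathcal F$ *coherent* if every point of $M$ has an open neighbourhood $U$ on which $\mathcal F$ has generators $X_1,\dots,X_n$ whose sheaf of relations $V\mapsto\{(f_1,\dots,f_n)\in C^\infty(V)^n:\sum_i f_iX_i|_V=0\}$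 is locally finitely generated. **Bi-submersions.** For a submersion $p\colon W\to M$, let $p^{-1}\mathcal F$ be the sheaf on $W$ of the smooth vector fields $Z$ for which $Tp(Z)$ is, locally, a finite combination $\sum_i f_i\,(X_i\circ p)$ with $f_i$ smooth on $W$ and $X_i$ in $\mathcal F$. A *bi-submersion* over $\mathcal F$ is a manifold $W$ with two submersions $p,q\colon W\to M$ such that, as sheaves of vector fields on $W$, $$p^{-1}\mathcal F=q^{-1}\mathcal F=\Gamma(\ker Tp)+\Gamma(\ker Tq).$$ The *inverse* of $(W,p,q)$ is $W^{-1}=(W,q,p)$. The *composition* of $(V,p_V,q_V)$ and $(W,p_W,q_W)$ is $V*W=V\times_{q_V,M,p_W}W$ with the two maps $(v,w)\mapsto p_V(v)$ and $(v,w)\mapsto q_W(w)$. Two bi-submersions $(W,p,q)$ and $(W',p',q')$ are *equivalent* if there are a manifold $V$ and surjective submersions $\delta\colon V\to W$, $\eta\colon V\to W'$ with $p\circ\delta=p'\circ\eta$ and $q\circ\delta=q'\circ\eta$. An *atlas* of $\mathcal F$ is a bi-submersion $A$ over $\mathcal F$ such that $A*A$ is equivalent to $A$ and $A$ is equivalent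 to $A^{-1}$. **Path holonomy.** Let $X_1,\dots,X_n$ be generators of $\mathcal F$ on an open neighbourhood $U$ of a point $x_0\in M$. A *path holonomy bi-submersion* is a bi-submersion $(W,p,q)$ over $\mathcal F$ where $W$ is an open neighbourhood of $(x_0,0)$ in $M\times\mathbb R^n$ such that, for all $(x,t)\in W$, the integral curve of $\sum_i t_iX_i$ in $U$ starting at $x$ is defined on $[0,1]$, and where $p(x,t)=x$ and $q(x,t)=\exp\bigl(\sum_i t_iX_i\bigr)(x)$ is the value of this curve at time $1$. A *path holonomy atlas* is the disjoint union $$\coprod_{k\ge 1}\ \coprod_{i_1,\dots,i_k}\ \coprod_{\epsilon_1,\dots,\epsilon_k\in\{1,-1\}}W_{i_1}^{\epsilon_1}*\cdots*W_{i_k}^{\epsilon_k}$$ for a countable family $(W_i,p_i,q_i)$ of path holonomy bi-submersions with $\bigcup_i p_i(W_i)=M$. A *holonomy atlas* of $\mathcal F$ is an atlas of $\mathcal F$ that is equivalent to a path holonomy atlas and all of whose connected components have the same dimension. **Statement.** Let $\mathcal F$ be a coherent singular foliation of finite rank on $M$. Then $\mathcal F$ admits a holonomy atlas $A$ all of whose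 connected components have dimension $\mathrm{rk}(\mathcal F)+\dim M$. In particular a path holonomy atlas of $\mathcal F$ exists, and $A$ is equivalent to every path holonomy atlas of $\mathcal F$. -/

import Mathlib

open scoped Manifold ContDiff Topology
open TopologicalSpace (Opens)
universe u

noncomputable section

/-- `f` is a submersion: a smooth map whose differential is surjective at every point. -/
def IsSmoothSubmersion (E E' : Type) [NormedAddCommGroup E] [NormedSpace ℝ E]
    [NormedAddCommGroup E'] [NormedSpace ℝ E'] {V W : Type u}
    [TopologicalSpace V] [ChartedSpace E V] [TopologicalSpace W] [ChartedSpace E' W]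
    (f : V → W) : Prop :=
  ContMDiff 𝓘(ℝ, E) 𝓘(ℝ, E') ∞ f ∧
    ∀ x, Function.Surjective (mfderiv 𝓘(ℝ, E) 𝓘(ℝ, E') f x)

section
variable {E E' : Type} [NormedAddCommGroup E] [NormedSpace ℝ E] [FiniteDimensional ℝ E]
  [NormedAddCommGroup E'] [NormedSpace ℝ E']

theorem exists_smooth_local_inverse {g : E → E'} {S : Set E} (hS : IsOpen S)
    (hg : ContDiffOn ℝ ∞ g S) {a : E} (ha : a ∈ S) (e : E ≃L[ℝ] E')
    (he : HasFDerivAt g (e : E →L[ℝ] E') a) :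
    ∃ Φ : OpenPartialHomeomorph E E', a ∈ Φ.source ∧ Φ.source ⊆ S ∧ (∀ x, Φ x = g x) ∧
      ContDiffOn ℝ ∞ Φ.symm Φ.target := by
  have : CompleteSpace E := FiniteDimensional.complete ℝ E
  have hga : ContDiffAt ℝ ∞ g a := hg.contDiffAt (hS.mem_nhds ha)
  let Φ₀ := hga.toOpenPartialHomeomorph g he (by simp)
  have hcont : ContinuousOn (fderiv ℝ g) S :=
    hg.continuousOn_fderiv_of_isOpen hS (by simp)
  let T : Set E := S ∩ fderiv ℝ g ⁻¹' (Set.range ((↑) : (E ≃L[ℝ] E') → E →L[ℝ] E'))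
  have hT : IsOpen T := hcont.isOpen_inter_preimage hS (ContinuousLinearEquiv.isOpen)
  have haT : a ∈ T := ⟨ha, e, he.fderiv.symm⟩
  refine ⟨Φ₀.restrOpen T hT, ?_, ?_, fun x => rfl, ?_⟩
  · exact ⟨hga.mem_toOpenPartialHomeomorph_source he (by simp), haT⟩
  · exact fun x hx => hx.2.1
  · intro y hy
    have hx := (Φ₀.restrOpen T hT).map_target hy
    obtain ⟨e', he'⟩ := hx.2.2
    have hxS := hx.2.1
    refine (OpenPartialHomeomorph.contDiffAt_symm (n := ∞) (f₀' := e') _ hy ?_ ?_).contDiffWithinAt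
    · rw [he']
      exact ((hg.contDiffAt (hS.mem_nhds hxS)).differentiableAt (by simp)).hasFDerivAt
    · exact hg.contDiffAt (hS.mem_nhds hxS)

variable [FiniteDimensional ℝ E']

theorem exists_complement_map (D : E →L[ℝ] E') (hD : Function.Surjective D) :
    ∃ (π : E →L[ℝ] EuclideanSpace ℝ (Fin (Module.finrank ℝ E - Module.finrank ℝ E')))
      (e : E ≃L[ℝ] E' × EuclideanSpace ℝ (Fin (Module.finrank ℝ E - Module.finrank ℝ E'))),
      (e : E →L[ℝ] _) = D.prod π := by
  obtain ⟨C, hC⟩ := Submodule.exists_isCompl (LinearMap.ker (D : E →ₗ[ℝ] E'))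
  have hrk := LinearMap.finrank_range_add_finrank_ker (D : E →ₗ[ℝ] E')
  rw [LinearMap.range_eq_top.2 hD, finrank_top] at hrk
  have hK : Module.finrank ℝ (LinearMap.ker (D : E →ₗ[ℝ] E')) =
      Module.finrank ℝ (EuclideanSpace ℝ
        (Fin (Module.finrank ℝ E - Module.finrank ℝ E'))) := by
    rw [finrank_euclideanSpace_fin]; omega
  let κ := LinearEquiv.ofFinrankEq _ _ hK
  let pr := Submodule.projectionOnto _ _ hC
  let π : E →L[ℝ] EuclideanSpace ℝ (Fin (Module.finrank ℝ E - Module.finrank ℝ E')) :=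
    LinearMap.toContinuousLinearMap (κ.toLinearMap ∘ₗ pr)
  have hinj : Function.Injective (D.prod π) := by
    rw [← ContinuousLinearMap.coe_coe, ← LinearMap.ker_eq_bot, LinearMap.ker_eq_bot']
    intro x hx
    have h1 : D x = 0 := congrArg Prod.fst hx
    have h2 : κ (pr x) = 0 := congrArg Prod.snd hx
    have h3 : pr x = 0 := by simpa using h2
    have h4 : pr x = ⟨x, h1⟩ :=
      Submodule.projectionOnto_apply_left hC ⟨x, h1⟩
    rw [h3] at h4
    exact (congrArg Subtype.val h4).symm
  have hdim : Module.finrank ℝ E = Module.finrank ℝ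
      (E' × EuclideanSpace ℝ (Fin (Module.finrank ℝ E - Module.finrank ℝ E'))) := by
    rw [Module.finrank_prod, finrank_euclideanSpace_fin]; omega
  refine ⟨π, (LinearEquiv.ofInjectiveOfFinrankEq (D.prod π : E →ₗ[ℝ] _) hinj hdim).toContinuousLinearEquiv, ?_⟩
  ext x <;> rfl

variable {W M : Type u} [TopologicalSpace W] [ChartedSpace E W] [IsManifold 𝓘(ℝ, E) ∞ W]
  [TopologicalSpace M] [ChartedSpace E' M] [IsManifold 𝓘(ℝ, E') ∞ M]

theorem IsSmoothSubmersion.exists_normalForm {r : W → M}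
    (hr : IsSmoothSubmersion E E' r) (w₀ : W) :
    ∃ Θ : OpenPartialHomeomorph W
        (M × EuclideanSpace ℝ (Fin (Module.finrank ℝ E - Module.finrank ℝ E'))),
      w₀ ∈ Θ.source ∧ (∀ w ∈ Θ.source, (Θ w).1 = r w) ∧
      ContMDiffOn 𝓘(ℝ, E) 𝓘(ℝ, EuclideanSpace ℝ (Fin (Module.finrank ℝ E - Module.finrank ℝ E')))
        ∞ (fun w => (Θ w).2) Θ.source ∧
      ContMDiffOn (𝓘(ℝ, E').prod
        𝓘(ℝ, EuclideanSpace ℝ (Fin (Module.finrank ℝ E - Module.finrank ℝ E'))))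
        𝓘(ℝ, E) ∞ Θ.symm Θ.target := by
  let D : E →L[ℝ] E' := mfderiv 𝓘(ℝ, E) 𝓘(ℝ, E') r w₀
  obtain ⟨π, e, he⟩ := exists_complement_map D (hr.2 w₀)
  let ψ := chartAt E w₀
  let φ := chartAt E' (r w₀)
  have hψ : ContMDiffOn 𝓘(ℝ, E) 𝓘(ℝ, E) ∞ ψ ψ.source := contMDiffOn_chart
  have hψs : ContMDiffOn 𝓘(ℝ, E) 𝓘(ℝ, E) ∞ ψ.symm ψ.target := contMDiffOn_chart_symm
  have hφ : ContMDiffOn 𝓘(ℝ, E') 𝓘(ℝ, E') ∞ φ φ.source := contMDiffOn_chart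
  have hφs : ContMDiffOn 𝓘(ℝ, E') 𝓘(ℝ, E') ∞ φ.symm φ.target := contMDiffOn_chart_symm
  let R : E → E' := fun x => φ (r (ψ.symm x))
  let S : Set E := ψ.target ∩ ψ.symm ⁻¹' (r ⁻¹' φ.source)
  have hS : IsOpen S := ψ.symm.isOpen_inter_preimage (φ.open_source.preimage hr.1.continuous)
  have hR : ContDiffOn ℝ ∞ R S := by
    rw [← contMDiffOn_iff_contDiffOn]
    exact hφ.comp (hr.1.comp_contMDiffOn (hψs.mono Set.inter_subset_left)) fun x hx => hx.2
  have ha : ψ w₀ ∈ S := by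
    refine ⟨mem_chart_target E w₀, ?_⟩
    simp [ψ, φ]
  have hRa : HasFDerivAt R D (ψ w₀) := by
    have h1 := ((hr.1 w₀).mdifferentiableAt (by simp)).hasMFDerivAt.2
    simp only [writtenInExtChartAt, mfld_simps] at h1
    exact hasFDerivWithinAt_univ.1 h1
  have hg : HasFDerivAt (fun x => (R x, π x)) (e : E →L[ℝ] _) (ψ w₀) := by
    rw [he]
    exact hRa.prodMk π.hasFDerivAt
  obtain ⟨Φ, hΦa, hΦS, hΦ, hΦs⟩ := exists_smooth_local_inverse hS
    (hR.prodMk π.contDiff.contDiffOn) ha e hg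
  refine ⟨(ψ.trans Φ).trans (φ.prod (OpenPartialHomeomorph.refl _)).symm, ?_, ?_, ?_, ?_⟩
  · have h1 : φ (r (ψ.symm (ψ w₀))) ∈ φ.target := φ.map_source ha.2
    simp only [OpenPartialHomeomorph.trans_source, Set.mem_inter_iff, Set.mem_preimage,
      OpenPartialHomeomorph.coe_trans, Function.comp_apply, hΦ]
    refine ⟨⟨mem_chart_source E w₀, hΦa⟩, ?_⟩
    simpa [R] using h1
  · intro w hw
    have hw1 : w ∈ ψ.source := hw.1.1
    have hw2 : ψ w ∈ Φ.source := hw.1.2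
    have hw3 := (hΦS hw2).2
    change φ.symm (Φ (ψ w)).1 = r w
    rw [hΦ]
    change φ.symm (φ (r (ψ.symm (ψ w)))) = r w
    rw [φ.left_inv hw3, ψ.left_inv hw1]
  · have h1 : ContMDiffOn 𝓘(ℝ, E) 𝓘(ℝ, EuclideanSpace ℝ
        (Fin (Module.finrank ℝ E - Module.finrank ℝ E'))) ∞ (fun w => π (ψ w)) ψ.source :=
      π.contMDiff.comp_contMDiffOn hψ
    refine (h1.mono fun w hw => hw.1.1).congr fun w hw => ?_
    change (Φ (ψ w)).2 = _
    rw [hΦ]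
  · have h0 : ContMDiffOn (𝓘(ℝ, E').prod
        𝓘(ℝ, EuclideanSpace ℝ (Fin (Module.finrank ℝ E - Module.finrank ℝ E'))))
        𝓘(ℝ, E' × EuclideanSpace ℝ (Fin (Module.finrank ℝ E - Module.finrank ℝ E'))) ∞
        (fun y : M × EuclideanSpace ℝ (Fin (Module.finrank ℝ E - Module.finrank ℝ E')) =>
          (φ y.1, y.2)) (φ.source ×ˢ Set.univ) := by
      rw [modelWithCornersSelf_prod, ← chartedSpaceSelf_prod]
      exact (hφ.comp contMDiffOn_fst fun y hy => hy.1).prodMk contMDiffOn_snd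
    refine ((hψs.comp ((contMDiffOn_iff_contDiffOn.2 hΦs).comp (h0.mono ?_) ?_) ?_)).congr ?_
    · exact fun y hy => ⟨hy.1.1, trivial⟩
    · exact fun y hy => hy.2.1
    · exact fun y hy => hy.2.2
    · exact fun y hy => rfl

end

theorem mfderiv_surjective_of_section {G T : Type*} [NormedAddCommGroup G] [NormedSpace ℝ G]
    [TopologicalSpace T] [ChartedSpace G T] {G' T' : Type*} [NormedAddCommGroup G']
    [NormedSpace ℝ G'] [TopologicalSpace T'] [ChartedSpace G' T'] {f : T → T'} {σ : T' → T}
    {y : T'} (hf : MDifferentiableAt 𝓘(ℝ, G) 𝓘(ℝ, G') f (σ y))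
    (hσ : MDifferentiableAt 𝓘(ℝ, G') 𝓘(ℝ, G) σ y) (h : ∀ᶠ y' in 𝓝 y, f (σ y') = y') :
    Function.Surjective (mfderiv 𝓘(ℝ, G) 𝓘(ℝ, G') f (σ y)) := by
  intro v
  have h1 := mfderiv_comp y hf hσ
  have h2 : mfderiv 𝓘(ℝ, G') 𝓘(ℝ, G') (f ∘ σ) y = mfderiv 𝓘(ℝ, G') 𝓘(ℝ, G') id y :=
    Filter.EventuallyEq.mfderiv_eq h
  rw [mfderiv_id] at h2
  refine ⟨mfderiv 𝓘(ℝ, G') 𝓘(ℝ, G) σ y v, ?_⟩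
  have h3 := (h1.symm.trans h2)
  exact congrArg (fun L => L v) h3

theorem IsSmoothSubmersion.comp {E E' E'' : Type} [NormedAddCommGroup E] [NormedSpace ℝ E]
    [NormedAddCommGroup E'] [NormedSpace ℝ E'] [NormedAddCommGroup E''] [NormedSpace ℝ E'']
    {V W M : Type u} [TopologicalSpace V] [ChartedSpace E V] [TopologicalSpace W]
    [ChartedSpace E' W] [TopologicalSpace M] [ChartedSpace E'' M] {g : W → M} {f : V → W}
    (hg : IsSmoothSubmersion E' E'' g) (hf : IsSmoothSubmersion E E' f) :
    IsSmoothSubmersion E E'' (g ∘ f) := by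
  refine ⟨hg.1.comp hf.1, fun x => ?_⟩
  rw [mfderiv_comp x ((hg.1 _).mdifferentiableAt (by simp)) ((hf.1 _).mdifferentiableAt (by simp))]
  exact (hg.2 _).comp (hf.2 x)

/-- The fibre product `V ×_{q, M, r} W` of two maps `q : V → M` and `r : W → M`. -/
@[ext]
structure FiberProduct {V W M : Type u} (q : V → M) (r : W → M) : Type u where
  fst : V
  snd : W
  w : q fst = r snd

namespace FiberProduct

variable {V W M : Type u} {q : V → M} {r : W → M}

theorem pair_eq {A : Type*} {Θ : W → M × A} {z : FiberProduct q r}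
    (hz : (Θ z.snd).1 = r z.snd) : (q z.fst, (Θ z.snd).2) = Θ z.snd :=
  Prod.ext (by rw [hz, z.w]) rfl

def toProd (z : FiberProduct q r) : V × W := (z.fst, z.snd)

variable [TopologicalSpace V] [TopologicalSpace W]

/-- The subspace topology of `V × W`. -/
instance : TopologicalSpace (FiberProduct q r) := .induced toProd inferInstance

theorem isEmbedding_toProd : Topology.IsEmbedding (toProd : FiberProduct q r → V × W) :=
  ⟨⟨rfl⟩, fun _ _ h => FiberProduct.ext (congrArg Prod.fst h) (congrArg Prod.snd h)⟩

instance [T2Space V] [T2Space W] : T2Space (FiberProduct q r) := isEmbedding_toProd.t2Space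

instance [SecondCountableTopology V] [SecondCountableTopology W] :
    SecondCountableTopology (FiberProduct q r) :=
  isEmbedding_toProd.secondCountableTopology

theorem continuous_fst : Continuous (fst : FiberProduct q r → V) :=
  _root_.continuous_fst.comp isEmbedding_toProd.continuous

theorem continuous_snd : Continuous (snd : FiberProduct q r → W) :=
  _root_.continuous_snd.comp isEmbedding_toProd.continuous

variable {E E' F : Type} [NormedAddCommGroup E] [NormedSpace ℝ E]
  [NormedAddCommGroup E'] [NormedSpace ℝ E'] [NormedAddCommGroup F]

variable (E E' F) in
/-- The model space of the fibre product, of dimension `dim V + dim W - dim M`. -/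
abbrev Model : Type :=
  F × EuclideanSpace ℝ (Fin (Module.finrank ℝ E - Module.finrank ℝ E'))

variable [TopologicalSpace M]

open Classical in
/-- The inverse of `chart` below, extended by the constant `z₀`. -/
def chartInv (z₀ : FiberProduct q r) (ψ : OpenPartialHomeomorph V F)
    (Θ : OpenPartialHomeomorph W
      (M × EuclideanSpace ℝ (Fin (Module.finrank ℝ E - Module.finrank ℝ E'))))
    (hΘ : ∀ w ∈ Θ.source, (Θ w).1 = r w) (y : Model E E' F) : FiberProduct q r :=
  if h : (q (ψ.symm y.1), y.2) ∈ Θ.target then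
    { fst := ψ.symm y.1
      snd := Θ.symm (q (ψ.symm y.1), y.2)
      w := by rw [← hΘ _ (Θ.map_target h), Θ.right_inv h] }
  else z₀

section

variable (z₀ : FiberProduct q r) (ψ : OpenPartialHomeomorph V F)
  (Θ : OpenPartialHomeomorph W
    (M × EuclideanSpace ℝ (Fin (Module.finrank ℝ E - Module.finrank ℝ E'))))
  (hΘ : ∀ w ∈ Θ.source, (Θ w).1 = r w)

theorem chartInv_fst {y : Model E E' F} (h : (q (ψ.symm y.1), y.2) ∈ Θ.target) :
    (chartInv z₀ ψ Θ hΘ y).fst = ψ.symm y.1 := by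
  rw [chartInv, dif_pos h]

theorem chartInv_snd {y : Model E E' F} (h : (q (ψ.symm y.1), y.2) ∈ Θ.target) :
    (chartInv z₀ ψ Θ hΘ y).snd = Θ.symm (q (ψ.symm y.1), y.2) := by
  rw [chartInv, dif_pos h]

/-- Given a straightening `Θ` of `r`, i.e. a local diffeomorphism of `W` to `M × ℝᵏ` over `M`,
and a chart `ψ` of `V`, the chart `(v, w) ↦ (ψ v, (Θ w).2)` of the fibre product. -/
def chart (hq : Continuous q) : OpenPartialHomeomorph (FiberProduct q r) (Model E E' F) where
  toFun z := (ψ z.fst, (Θ z.snd).2)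
  invFun := chartInv z₀ ψ Θ hΘ
  source := {z | z.fst ∈ ψ.source ∧ z.snd ∈ Θ.source}
  target := {y | y.1 ∈ ψ.target ∧ (q (ψ.symm y.1), y.2) ∈ Θ.target}
  map_source' z hz := by
    refine ⟨ψ.map_source hz.1, ?_⟩
    change (q (ψ.symm (ψ z.fst)), (Θ z.snd).2) ∈ Θ.target
    rw [ψ.left_inv hz.1, pair_eq (hΘ _ hz.2)]
    exact Θ.map_source hz.2
  map_target' y hy := by
    refine ⟨?_, ?_⟩
    · rw [chartInv_fst z₀ ψ Θ hΘ hy.2]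
      exact ψ.map_target hy.1
    · rw [chartInv_snd z₀ ψ Θ hΘ hy.2]
      exact Θ.map_target hy.2
  left_inv' z hz := by
    have h1 : ψ.symm (ψ z.fst) = z.fst := ψ.left_inv hz.1
    have h2 : (q (ψ.symm (ψ z.fst)), (Θ z.snd).2) ∈ Θ.target := by
      rw [h1, pair_eq (hΘ _ hz.2)]
      exact Θ.map_source hz.2
    refine FiberProduct.ext ?_ ?_
    · rw [chartInv_fst z₀ ψ Θ hΘ h2]
      exact h1
    · rw [chartInv_snd z₀ ψ Θ hΘ h2]
      change Θ.symm (q (ψ.symm (ψ z.fst)), (Θ z.snd).2) = z.snd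
      rw [h1, pair_eq (hΘ _ hz.2), Θ.left_inv hz.2]
  right_inv' y hy := by
    refine Prod.ext ?_ ?_
    · change ψ (chartInv z₀ ψ Θ hΘ y).fst = y.1
      rw [chartInv_fst z₀ ψ Θ hΘ hy.2, ψ.right_inv hy.1]
    · change (Θ (chartInv z₀ ψ Θ hΘ y).snd).2 = y.2
      rw [chartInv_snd z₀ ψ Θ hΘ hy.2, Θ.right_inv hy.2]
  open_source :=
    (ψ.open_source.preimage continuous_fst).inter (Θ.open_source.preimage continuous_snd)
  open_target := by
    have h1 : ContinuousOn (fun y : Model E E' F => (q (ψ.symm y.1), y.2))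
        (Prod.fst ⁻¹' ψ.target) :=
      (hq.comp_continuousOn (ψ.continuousOn_symm.comp _root_.continuous_fst.continuousOn
        fun y hy => hy)).prodMk _root_.continuous_snd.continuousOn
    exact h1.isOpen_inter_preimage (ψ.open_target.preimage _root_.continuous_fst) Θ.open_target
  continuousOn_toFun :=
    (ψ.continuousOn.comp continuous_fst.continuousOn fun z hz => hz.1).prodMk
      (_root_.continuous_snd.comp_continuousOn
        (Θ.continuousOn.comp continuous_snd.continuousOn fun z hz => hz.2))
  continuousOn_invFun := by
    have h1 : ContinuousOn (fun y : Model E E' F => (q (ψ.symm y.1), y.2))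
        {y | y.1 ∈ ψ.target ∧ (q (ψ.symm y.1), y.2) ∈ Θ.target} :=
      (hq.comp_continuousOn (ψ.continuousOn_symm.comp _root_.continuous_fst.continuousOn
        fun y hy => hy.1)).prodMk _root_.continuous_snd.continuousOn
    have h2 : ContinuousOn (fun y : Model E E' F =>
        (ψ.symm y.1, Θ.symm (q (ψ.symm y.1), y.2)))
        {y | y.1 ∈ ψ.target ∧ (q (ψ.symm y.1), y.2) ∈ Θ.target} :=
      (ψ.continuousOn_symm.comp _root_.continuous_fst.continuousOn fun y hy => hy.1).prodMk
        (Θ.continuousOn_symm.comp h1 fun y hy => hy.2)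
    rw [isEmbedding_toProd.isInducing.continuousOn_iff]
    exact h2.congr fun y hy => Prod.ext (chartInv_fst z₀ ψ Θ hΘ hy.2)
      (chartInv_snd z₀ ψ Θ hΘ hy.2)

end

variable [FiniteDimensional ℝ E] [FiniteDimensional ℝ E'] [NormedSpace ℝ F]
  [ChartedSpace F V] [ChartedSpace E W] [IsManifold 𝓘(ℝ, E) ∞ W]
  [ChartedSpace E' M] [IsManifold 𝓘(ℝ, E') ∞ M]

/-- The straightening of the submersion `r` near `w₀` that is used in the charts. -/
def straightening (hr : IsSmoothSubmersion E E' r) (w₀ : W) : OpenPartialHomeomorph W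
    (M × EuclideanSpace ℝ (Fin (Module.finrank ℝ E - Module.finrank ℝ E'))) :=
  (hr.exists_normalForm w₀).choose

theorem mem_straightening_source (hr : IsSmoothSubmersion E E' r) (w₀ : W) :
    w₀ ∈ (straightening hr w₀).source :=
  (hr.exists_normalForm w₀).choose_spec.1

theorem straightening_fst (hr : IsSmoothSubmersion E E' r) (w₀ : W) :
    ∀ w ∈ (straightening hr w₀).source, (straightening hr w₀ w).1 = r w :=
  (hr.exists_normalForm w₀).choose_spec.2.1

theorem contMDiffOn_straightening (hr : IsSmoothSubmersion E E' r) (w₀ : W) :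
    ContMDiffOn 𝓘(ℝ, E) 𝓘(ℝ, EuclideanSpace ℝ (Fin (Module.finrank ℝ E - Module.finrank ℝ E')))
      ∞ (fun w => (straightening hr w₀ w).2) (straightening hr w₀).source :=
  (hr.exists_normalForm w₀).choose_spec.2.2.1

theorem contMDiffOn_straightening_symm (hr : IsSmoothSubmersion E E' r) (w₀ : W) :
    ContMDiffOn (𝓘(ℝ, E').prod
      𝓘(ℝ, EuclideanSpace ℝ (Fin (Module.finrank ℝ E - Module.finrank ℝ E'))))
      𝓘(ℝ, E) ∞ (straightening hr w₀).symm (straightening hr w₀).target :=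
  (hr.exists_normalForm w₀).choose_spec.2.2.2

/-- The chart of the fibre product centred at `z₀`. -/
def chartAround (hq : Continuous q) (hr : IsSmoothSubmersion E E' r) (z₀ : FiberProduct q r) :
    OpenPartialHomeomorph (FiberProduct q r) (Model E E' F) :=
  chart z₀ (chartAt F z₀.fst) (straightening hr z₀.snd) (straightening_fst hr z₀.snd) hq

/-- The manifold structure on the fibre product of a smooth map `q` and a submersion `r`. -/
@[reducible]
def chartedSpace (hq : Continuous q) (hr : IsSmoothSubmersion E E' r) :
    ChartedSpace (Model E E' F) (FiberProduct q r) where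
  atlas := Set.range (chartAround hq hr)
  chartAt := chartAround hq hr
  mem_chart_source z := ⟨mem_chart_source F z.fst, mem_straightening_source hr z.snd⟩
  chart_mem_atlas z := ⟨z, rfl⟩

section smooth

variable [IsManifold 𝓘(ℝ, F) ∞ V] (hq : ContMDiff 𝓘(ℝ, F) 𝓘(ℝ, E') ∞ q) (hr : IsSmoothSubmersion E E' r)

theorem contMDiffOn_fst_chart_symm (z₀ : FiberProduct q r) :
    ContMDiffOn 𝓘(ℝ, Model E E' F) 𝓘(ℝ, F) ∞
      (fun y => ((chartAround hq.continuous hr z₀).symm y).fst)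
      (chartAround (F := F) hq.continuous hr z₀).target := by
  have h1 : ContMDiffOn 𝓘(ℝ, F) 𝓘(ℝ, F) ∞ (chartAt F z₀.fst).symm (chartAt F z₀.fst).target :=
    contMDiffOn_chart_symm
  refine (h1.comp (contDiff_fst.contMDiff.contMDiffOn) fun y hy => hy.1).congr fun y hy => ?_
  exact chartInv_fst z₀ _ _ (straightening_fst hr z₀.snd) hy.2

theorem contMDiffOn_snd_chart_symm (z₀ : FiberProduct q r) :
    ContMDiffOn 𝓘(ℝ, Model E E' F) 𝓘(ℝ, E) ∞
      (fun y => ((chartAround hq.continuous hr z₀).symm y).snd)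
      (chartAround (F := F) hq.continuous hr z₀).target := by
  have h1 : ContMDiffOn 𝓘(ℝ, F) 𝓘(ℝ, F) ∞ (chartAt F z₀.fst).symm (chartAt F z₀.fst).target :=
    contMDiffOn_chart_symm
  have h2 := contMDiffOn_straightening_symm hr z₀.snd
  refine (h2.comp ((hq.comp_contMDiffOn
    (h1.comp (contDiff_fst.contMDiff.contMDiffOn) fun y hy => hy.1)).prodMk
      contDiff_snd.contMDiff.contMDiffOn) fun y hy => hy.2).congr fun y hy => ?_
  exact chartInv_snd z₀ _ _ (straightening_fst hr z₀.snd) hy.2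

/-- A map into a chart domain of the fibre product is smooth in the chart if both of its
components are smooth. -/
theorem contMDiffWithinAt_chart_comp {G T : Type*} [NormedAddCommGroup G] [NormedSpace ℝ G]
    [TopologicalSpace T] [ChartedSpace G T] (z₀ : FiberProduct q r) {f : T → FiberProduct q r}
    {s : Set T} {t : T} (hf : f t ∈ (chartAround (F := F) hq.continuous hr z₀).source)
    (h1 : ContMDiffWithinAt 𝓘(ℝ, G) 𝓘(ℝ, F) ∞ (fun t => (f t).fst) s t)
    (h2 : ContMDiffWithinAt 𝓘(ℝ, G) 𝓘(ℝ, E) ∞ (fun t => (f t).snd) s t) :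
    ContMDiffWithinAt 𝓘(ℝ, G) 𝓘(ℝ, Model E E' F) ∞
      (fun t => chartAround (F := F) hq.continuous hr z₀ (f t)) s t := by
  have k1 : ContMDiffAt 𝓘(ℝ, F) 𝓘(ℝ, F) ∞ (chartAt F z₀.fst) (f t).fst :=
    (contMDiffOn_chart (I := 𝓘(ℝ, F)) (n := ∞) (x := z₀.fst)).contMDiffAt ((chartAt F z₀.fst).open_source.mem_nhds hf.1)
  have k2 := (contMDiffOn_straightening hr z₀.snd).contMDiffAt
    ((straightening hr z₀.snd).open_source.mem_nhds hf.2)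
  exact (k1.comp_contMDiffWithinAt t h1).prodMk_space
    (ContMDiffAt.comp_contMDiffWithinAt (g := fun w => (straightening hr z₀.snd w).2) t k2 h2)

theorem isManifold :
    letI := chartedSpace (F := F) hq.continuous hr
    IsManifold 𝓘(ℝ, Model E E' F) ∞ (FiberProduct q r) := by
  let _ := chartedSpace (F := F) hq.continuous hr
  refine isManifold_of_contDiffOn _ _ _ ?_
  rintro _ _ ⟨z₁, rfl⟩ ⟨z₂, rfl⟩
  rw [← contMDiffOn_iff_contDiffOn]
  intro y hy
  have hy1 : y ∈ (chartAround (F := F) hq.continuous hr z₁).target := by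
    simpa using hy.1.1
  have hy2 : (chartAround hq.continuous hr z₁).symm y ∈
      (chartAround (F := F) hq.continuous hr z₂).source := by
    simpa using hy.1.2
  refine contMDiffWithinAt_chart_comp hq hr z₂ hy2 ?_ ?_
  · exact ((contMDiffOn_fst_chart_symm hq hr z₁).contMDiffAt
      ((chartAround hq.continuous hr z₁).open_target.mem_nhds hy1)).contMDiffWithinAt
  · exact ((contMDiffOn_snd_chart_symm hq hr z₁).contMDiffAt
      ((chartAround hq.continuous hr z₁).open_target.mem_nhds hy1)).contMDiffWithinAt

theorem contMDiff_fst :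
    letI := chartedSpace (F := F) hq.continuous hr
    ContMDiff 𝓘(ℝ, Model E E' F) 𝓘(ℝ, F) ∞ (fst : FiberProduct q r → V) := by
  let _ := chartedSpace (F := F) hq.continuous hr
  have := isManifold hq hr
  intro z
  have h := (contMDiffOn_fst_chart_symm hq hr z).comp
    (contMDiffOn_chart (I := 𝓘(ℝ, Model E E' F)) (n := ∞) (x := z))
    fun y hy => (chartAround hq.continuous hr z).map_source hy
  refine (h.congr fun y hy => ?_).contMDiffAt ((chartAt _ z).open_source.mem_nhds
    (mem_chart_source _ z))
  exact congrArg fst ((chartAround hq.continuous hr z).left_inv hy).symm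

theorem contMDiff_snd :
    letI := chartedSpace (F := F) hq.continuous hr
    ContMDiff 𝓘(ℝ, Model E E' F) 𝓘(ℝ, E) ∞ (snd : FiberProduct q r → W) := by
  let _ := chartedSpace (F := F) hq.continuous hr
  have := isManifold hq hr
  intro z
  have h := (contMDiffOn_snd_chart_symm hq hr z).comp
    (contMDiffOn_chart (I := 𝓘(ℝ, Model E E' F)) (n := ∞) (x := z))
    fun y hy => (chartAround hq.continuous hr z).map_source hy
  refine (h.congr fun y hy => ?_).contMDiffAt ((chartAt _ z).open_source.mem_nhds
    (mem_chart_source _ z))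
  exact congrArg snd ((chartAround hq.continuous hr z).left_inv hy).symm

/-- A map into the fibre product is smooth if both of its components are smooth. -/
theorem contMDiffAt_of_components {G T : Type*} [NormedAddCommGroup G] [NormedSpace ℝ G]
    [TopologicalSpace T] [ChartedSpace G T] {f : T → FiberProduct q r} {t : T}
    (h1 : ContMDiffAt 𝓘(ℝ, G) 𝓘(ℝ, F) ∞ (fun t => (f t).fst) t)
    (h2 : ContMDiffAt 𝓘(ℝ, G) 𝓘(ℝ, E) ∞ (fun t => (f t).snd) t) :
    letI := chartedSpace (F := F) hq.continuous hr
    ContMDiffAt 𝓘(ℝ, G) 𝓘(ℝ, Model E E' F) ∞ f t := by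
  let _ := chartedSpace (F := F) hq.continuous hr
  have := isManifold hq hr
  rw [contMDiffAt_iff_target]
  refine ⟨?_, ?_⟩
  · rw [isEmbedding_toProd.isInducing.continuousAt_iff]
    exact h1.continuousAt.prodMk h2.continuousAt
  · exact contMDiffWithinAt_chart_comp hq hr (f t) (mem_chart_source (Model E E' F) (f t)) h1 h2

theorem isSmoothSubmersion_fst :
    letI := chartedSpace (F := F) hq.continuous hr
    IsSmoothSubmersion (Model E E' F) F (fst : FiberProduct q r → V) := by
  let _ := chartedSpace (F := F) hq.continuous hr
  have := isManifold hq hr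
  refine ⟨contMDiff_fst hq hr, fun z => ?_⟩
  let c := chartAround (F := F) hq.continuous hr z
  let ψ := chartAt F z.fst
  let σ : V → FiberProduct q r := fun v => c.symm (ψ v, (c z).2)
  have hz : z ∈ c.source := mem_chart_source (Model E E' F) z
  have h0 : (ψ z.fst, (c z).2) = c z := rfl
  have hσz : σ z.fst = z := by
    change c.symm (ψ z.fst, (c z).2) = z
    rw [h0, c.left_inv hz]
  have hc : ContMDiffAt 𝓘(ℝ, Model E E' F) 𝓘(ℝ, Model E E' F) ∞ c.symm (ψ z.fst, (c z).2) := by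
    rw [h0]
    exact (contMDiffOn_chart_symm (I := 𝓘(ℝ, Model E E' F)) (n := ∞) (x := z)).contMDiffAt
      (c.open_target.mem_nhds (c.map_source hz))
  have hψ : ContMDiffAt 𝓘(ℝ, F) 𝓘(ℝ, F) ∞ ψ z.fst :=
    (contMDiffOn_chart (I := 𝓘(ℝ, F)) (n := ∞) (x := z.fst)).contMDiffAt
      (ψ.open_source.mem_nhds (mem_chart_source F z.fst))
  have hψ2 : ContMDiffAt 𝓘(ℝ, F) 𝓘(ℝ, Model E E' F) ∞ (fun v => (ψ v, (c z).2)) z.fst :=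
    hψ.prodMk_space contMDiffAt_const
  have hσ : ContMDiffAt 𝓘(ℝ, F) 𝓘(ℝ, Model E E' F) ∞ σ z.fst := hc.comp z.fst hψ2
  have h1 : ∀ᶠ v in 𝓝 z.fst, (σ v).fst = v := by
    have h2 : ∀ᶠ v in 𝓝 z.fst, (ψ v, (c z).2) ∈ c.target :=
      hψ2.continuousAt.eventually (c.open_target.mem_nhds
        (by change (ψ z.fst, (c z).2) ∈ c.target; rw [h0]; exact c.map_source hz))
    filter_upwards [h2, ψ.open_source.mem_nhds (mem_chart_source F z.fst)] with v hv hv'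
    exact (chartInv_fst z _ _ (straightening_fst hr z.snd) hv.2).trans (ψ.left_inv hv')
  have h3 := mfderiv_surjective_of_section (f := (fst : FiberProduct q r → V))
    ((contMDiff_fst hq hr _).mdifferentiableAt (by simp)) (hσ.mdifferentiableAt (by simp)) h1
  rwa [hσz] at h3

end smooth

theorem isSmoothSubmersion_snd [IsManifold 𝓘(ℝ, F) ∞ V] [FiniteDimensional ℝ F]
    (hr : IsSmoothSubmersion E E' r) (hq : IsSmoothSubmersion F E' q) :
    letI := chartedSpace (F := F) hq.1.continuous hr
    IsSmoothSubmersion (Model E E' F) E (snd : FiberProduct q r → W) := by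
  classical
  let _ := chartedSpace (F := F) hq.1.continuous hr
  have := isManifold hq.1 hr
  refine ⟨contMDiff_snd hq.1 hr, fun z => ?_⟩
  obtain ⟨Θ, hzΘ, hΘ, -, hΘs⟩ := hq.exists_normalForm z.fst
  let σ : W → FiberProduct q r := fun w =>
    if h : (r w, (Θ z.fst).2) ∈ Θ.target then
      { fst := Θ.symm (r w, (Θ z.fst).2)
        snd := w
        w := by rw [← hΘ _ (Θ.map_target h), Θ.right_inv h] }
    else z
  have h0 : (r z.snd, (Θ z.fst).2) = Θ z.fst := Prod.ext (by rw [hΘ _ hzΘ, z.w]) rfl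
  have hmem : (r z.snd, (Θ z.fst).2) ∈ Θ.target := by
    rw [h0]
    exact Θ.map_source hzΘ
  have hpair : ContMDiff 𝓘(ℝ, E) (𝓘(ℝ, E').prod
      𝓘(ℝ, EuclideanSpace ℝ (Fin (Module.finrank ℝ F - Module.finrank ℝ E')))) ∞
      (fun w => (r w, (Θ z.fst).2)) := hr.1.prodMk contMDiff_const
  have hev : ∀ᶠ w in 𝓝 z.snd, (r w, (Θ z.fst).2) ∈ Θ.target :=
    hpair.continuous.continuousAt.eventually (Θ.open_target.mem_nhds hmem)
  have h1 : ∀ᶠ w in 𝓝 z.snd, (σ w).fst = Θ.symm (r w, (Θ z.fst).2) := by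
    filter_upwards [hev] with w hw
    simp only [σ, dif_pos hw]
  have h2 : ∀ᶠ w in 𝓝 z.snd, (σ w).snd = w := by
    filter_upwards [hev] with w hw
    simp only [σ, dif_pos hw]
  have hσz : σ z.snd = z := by
    refine FiberProduct.ext ?_ h2.self_of_nhds
    rw [h1.self_of_nhds, h0, Θ.left_inv hzΘ]
  have hσ : ContMDiffAt 𝓘(ℝ, E) 𝓘(ℝ, Model E E' F) ∞ σ z.snd := by
    refine contMDiffAt_of_components hq.1 hr ?_ ?_
    · exact ((hΘs.contMDiffAt (Θ.open_target.mem_nhds hmem)).comp z.snd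
        (hpair z.snd)).congr_of_eventuallyEq h1
    · exact contMDiffAt_id.congr_of_eventuallyEq h2
  have h3 := mfderiv_surjective_of_section (f := (snd : FiberProduct q r → W))
    ((contMDiff_snd hq.1 hr _).mdifferentiableAt (by simp)) (hσ.mdifferentiableAt (by simp)) h2
  rwa [hσz] at h3

end FiberProduct

section VectorFields

variable (E : Type) [NormedAddCommGroup E] [NormedSpace ℝ E]
  (V : Type u) [TopologicalSpace V] [ChartedSpace E V]

/-- Vector fields on `V`. A vector field on an open subset `U ⊆ V` is represented by one on `V`,
whose values outside of `U` are irrelevant. -/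
abbrev VField : Type u := ∀ x : V, TangentSpace 𝓘(ℝ, E) x

variable {V} [IsManifold 𝓘(ℝ, E) ∞ V]

/-- The vector field `Z` is smooth on the open subset `U`. -/
def SmoothField (U : Opens V) (Z : VField E V) : Prop :=
  ContMDiffOn 𝓘(ℝ, E) 𝓘(ℝ, E).tangent ∞ (fun x => (⟨x, Z x⟩ : TangentBundle 𝓘(ℝ, E) V)) U

/-- The function `f` is smooth on the open subset `U`. -/
def SmoothFun (U : Opens V) (f : V → ℝ) : Prop := ContMDiffOn 𝓘(ℝ, E) 𝓘(ℝ, ℝ) ∞ f U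

end VectorFields

/-- A singular foliation on the manifold `M` of dimension `m`: a subsheaf `U ↦ F.sec U` of modules
of the sheaf of smooth vector fields which is stable under the Lie bracket and
locally finitely generated. -/
structure SingularFoliation (m : ℕ) (M : Type u) [TopologicalSpace M]
    [ChartedSpace (EuclideanSpace ℝ (Fin m)) M] [IsManifold (𝓡 m) ∞ M] where
  /-- The vector fields on the open subset `U` which belong to the foliation. -/
  sec : Opens M → Set (VField (EuclideanSpace ℝ (Fin m)) M)
  smooth : ∀ U, ∀ X ∈ sec U, SmoothField (EuclideanSpace ℝ (Fin m)) U X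
  /-- Membership in `sec U` depends on the restriction to `U` only. -/
  congr : ∀ U, ∀ X ∈ sec U, ∀ Y : VField (EuclideanSpace ℝ (Fin m)) M,
    (∀ x ∈ U, X x = Y x) → Y ∈ sec U
  restrict : ∀ U V, V ≤ U → ∀ X ∈ sec U, X ∈ sec V
  glue : ∀ U, ∀ X : VField (EuclideanSpace ℝ (Fin m)) M,
    (∀ x ∈ U, ∃ V, x ∈ V ∧ V ≤ U ∧ X ∈ sec V) → X ∈ sec U
  zero_mem : ∀ U, (0 : VField (EuclideanSpace ℝ (Fin m)) M) ∈ sec U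
  add_mem : ∀ U, ∀ X ∈ sec U, ∀ Y ∈ sec U, X + Y ∈ sec U
  smul_mem : ∀ U, ∀ f : M → ℝ, SmoothFun (EuclideanSpace ℝ (Fin m)) U f →
    ∀ X ∈ sec U, (fun x => f x • X x) ∈ sec U
  lie_mem : ∀ U, ∀ X ∈ sec U, ∀ Y ∈ sec U, VectorField.mlieBracket (𝓡 m) X Y ∈ sec U
  locally_finitely_generated : ∀ x : M, ∃ U : Opens M, x ∈ U ∧
    ∃ (n : ℕ) (X : Fin n → VField (EuclideanSpace ℝ (Fin m)) M), (∀ i, X i ∈ sec U) ∧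
      ∀ V ≤ U, ∀ Y ∈ sec V, ∃ f : Fin n → M → ℝ,
        (∀ i, SmoothFun (EuclideanSpace ℝ (Fin m)) V (f i)) ∧
        ∀ y ∈ V, Y y = ∑ i, f i y • X i y

namespace SingularFoliation

variable {m : ℕ} {M : Type u} [TopologicalSpace M] [ChartedSpace (EuclideanSpace ℝ (Fin m)) M]
  [IsManifold (𝓡 m) ∞ M]
  (F : SingularFoliation m M)

/-- The vector fields `X i` are generators of the foliation on `U`. -/
def Generates (U : Opens M) {n : ℕ} (X : Fin n → VField (EuclideanSpace ℝ (Fin m)) M) : Prop :=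
  (∀ i, X i ∈ F.sec U) ∧
    ∀ V ≤ U, ∀ Y ∈ F.sec V, ∃ f : Fin n → M → ℝ,
      (∀ i, SmoothFun (EuclideanSpace ℝ (Fin m)) V (f i)) ∧ ∀ y ∈ V, Y y = ∑ i, f i y • X i y

/-- The rank of `F` at `x`: the minimal number of generators of `F` near `x`. -/
def rankAt (x : M) : ℕ :=
  sInf {n | ∃ (U : Opens M) (X : Fin n → VField (EuclideanSpace ℝ (Fin m)) M),
    x ∈ U ∧ F.Generates U X}

/-- The rank of `F`: the maximum of the pointwise ranks, `⊤` if they are not bounded. -/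
def rank : ℕ∞ := ⨆ x, (F.rankAt x : ℕ∞)

/-- `f` is a relation between the vector fields `X i` on `U`. -/
def IsRelation (U : Opens M) {n : ℕ} (X : Fin n → VField (EuclideanSpace ℝ (Fin m)) M)
    (f : Fin n → M → ℝ) : Prop :=
  (∀ i, SmoothFun (EuclideanSpace ℝ (Fin m)) U (f i)) ∧ ∀ y ∈ U, ∑ i, f i y • X i y = 0

/-- The sheaf of relations between the vector fields `X i` on `U` is locally finitely generated. -/
def RelationsLocallyFG (U : Opens M) {n : ℕ}
    (X : Fin n → VField (EuclideanSpace ℝ (Fin m)) M) : Prop :=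
  ∀ x ∈ U, ∃ V : Opens M, x ∈ V ∧ V ≤ U ∧
    ∃ (k : ℕ) (g : Fin k → Fin n → M → ℝ), (∀ j, IsRelation V X (g j)) ∧
      ∀ V' ≤ V, ∀ f : Fin n → M → ℝ, IsRelation V' X f →
        ∃ c : Fin k → M → ℝ, (∀ j, SmoothFun (EuclideanSpace ℝ (Fin m)) V' (c j)) ∧
          ∀ i, ∀ y ∈ V', f i y = ∑ j, c j y * g j i y

/-- `F` is coherent: near every point it has finitely many generators whose sheaf of relations is
locally finitely generated. -/
def IsCoherent : Prop :=
  ∀ x : M, ∃ (U : Opens M) (n : ℕ) (X : Fin n → VField (EuclideanSpace ℝ (Fin m)) M),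
    x ∈ U ∧ F.Generates U X ∧ RelationsLocallyFG U X

variable (E : Type) [NormedAddCommGroup E] [NormedSpace ℝ E]
  {W : Type u} [TopologicalSpace W] [ChartedSpace E W] [IsManifold 𝓘(ℝ, E) ∞ W]

/-- The sections over `U` of the pull-back `φ⁻¹(F)`: the vector fields `Z` on `U` such that `Tφ(Z)`
is, locally, a combination with smooth coefficients of sections `X ∘ φ` with `X` in `F`. -/
def pullback (φ : W → M) (U : Opens W) : Set (VField E W) :=
  {Z | SmoothField E U Z ∧ ∀ w ∈ U, ∃ (U' : Opens W) (O : Opens M),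
    w ∈ U' ∧ U' ≤ U ∧ (∀ y ∈ U', φ y ∈ O) ∧
    ∃ (n : ℕ) (X : Fin n → VField (EuclideanSpace ℝ (Fin m)) M) (f : Fin n → W → ℝ),
      (∀ i, X i ∈ F.sec O) ∧ (∀ i, SmoothFun E U' (f i)) ∧
      ∀ y ∈ U', mfderiv 𝓘(ℝ, E) (𝓡 m) φ y (Z y) = ∑ i, f i y • X i (φ y)}

end SingularFoliation

section Kernels

variable (E : Type) [NormedAddCommGroup E] [NormedSpace ℝ E]
  {W : Type u} [TopologicalSpace W] [ChartedSpace E W] [IsManifold 𝓘(ℝ, E) ∞ W]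
  {m : ℕ} {M : Type u} [TopologicalSpace M] [ChartedSpace (EuclideanSpace ℝ (Fin m)) M]

/-- The sections over `U` of `ker Tφ`. -/
def kerSec (φ : W → M) (U : Opens W) : Set (VField E W) :=
  {Z | SmoothField E U Z ∧ ∀ w ∈ U, mfderiv 𝓘(ℝ, E) (𝓡 m) φ w (Z w) = 0}

/-- The sections over `U` of the sum `Γ(ker Tp) + Γ(ker Tq)` of sheaves of vector fields. -/
def kerSumSec (p q : W → M) (U : Opens W) : Set (VField E W) :=
  {Z | ∀ w ∈ U, ∃ U' : Opens W, w ∈ U' ∧ U' ≤ U ∧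
    ∃ ξ ∈ kerSec (m := m) E p U', ∃ ζ ∈ kerSec (m := m) E q U', ∀ y ∈ U', Z y = ξ y + ζ y}

end Kernels

/-- A smooth manifold (Hausdorff, second countable, without boundary) all of whose connected
components have the dimension of the model space `model`; the empty manifold is allowed. -/
structure PureManifold : Type (u + 1) where
  model : Type
  [normed : NormedAddCommGroup model]
  [space : NormedSpace ℝ model]
  [finite : FiniteDimensional ℝ model]
  carrier : Type u
  [top : TopologicalSpace carrier]
  [charted : ChartedSpace model carrier]
  [manifold : IsManifold 𝓘(ℝ, model) ∞ carrier]
  [t2 : T2Space carrier]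
  [secondCountable : SecondCountableTopology carrier]

namespace PureManifold

attribute [instance] normed space finite top charted manifold t2 secondCountable

/-- The dimension. -/
def dim (W : PureManifold.{u}) : ℕ := Module.finrank ℝ W.model

end PureManifold

/-- A manifold `W` of pure dimension with two submersions `p` and `q` to `M`. -/
structure Span (m : ℕ) (M : Type u) [TopologicalSpace M]
    [ChartedSpace (EuclideanSpace ℝ (Fin m)) M] extends PureManifold.{u} where
  p : carrier → M
  q : carrier → M
  submersion_p : IsSmoothSubmersion model (EuclideanSpace ℝ (Fin m)) p
  submersion_q : IsSmoothSubmersion model (EuclideanSpace ℝ (Fin m)) q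

namespace Span

variable {m : ℕ} {M : Type u} [TopologicalSpace M] [ChartedSpace (EuclideanSpace ℝ (Fin m)) M]
  [IsManifold (𝓡 m) ∞ M]

/-- `W` is a bi-submersion over `F`, that is,
`p⁻¹(F) = q⁻¹(F)` and `p⁻¹(F) = Γ(ker Tp) + Γ(ker Tq)` as sheaves on `W`. -/
def IsBiSubmersion (F : SingularFoliation m M) (W : Span m M) : Prop :=
  ∀ U : Opens W.carrier, F.pullback W.model W.p U = F.pullback W.model W.q U ∧
    F.pullback W.model W.p U = kerSumSec (m := m) W.model W.p W.q U

/-- The inverse `W⁻¹`. -/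
def inv (W : Span m M) : Span m M where
  toPureManifold := W.toPureManifold
  p := W.q
  q := W.p
  submersion_p := W.submersion_q
  submersion_q := W.submersion_p

/-- The composition `V * W`: the fibre product `V ×_{q, M, p} W`, with the maps `p` of `V` and `q`
of `W`. -/
def comp (V W : Span m M) : Span m M :=
  letI := FiberProduct.chartedSpace (F := V.model) V.submersion_q.1.continuous W.submersion_p
  { model := FiberProduct.Model W.model (EuclideanSpace ℝ (Fin m)) V.model
    carrier := FiberProduct V.q W.p
    manifold := FiberProduct.isManifold V.submersion_q.1 W.submersion_p
    p := V.p ∘ FiberProduct.fst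
    q := W.q ∘ FiberProduct.snd
    submersion_p := V.submersion_p.comp
      (FiberProduct.isSmoothSubmersion_fst V.submersion_q.1 W.submersion_p)
    submersion_q := W.submersion_q.comp
      (FiberProduct.isSmoothSubmersion_snd W.submersion_p V.submersion_q) }

end Span

/-- A manifold `W` with two submersions `p` and `q` to `M`, where the connected components of `W`
may have different dimensions: `W` is the disjoint union of the countable family `piece`. -/
structure SpanFamily (m : ℕ) (M : Type u) [TopologicalSpace M]
    [ChartedSpace (EuclideanSpace ℝ (Fin m)) M] [IsManifold (𝓡 m) ∞ M] where
  ι : Type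
  [countable : Countable ι]
  piece : ι → Span m M

namespace SpanFamily

attribute [instance] countable

variable {m : ℕ} {M : Type u} [TopologicalSpace M] [ChartedSpace (EuclideanSpace ℝ (Fin m)) M]
  [IsManifold (𝓡 m) ∞ M]

/-- The disjoint union `W` is a bi-submersion over `F`. -/
def IsBiSubmersion (F : SingularFoliation m M) (W : SpanFamily m M) : Prop :=
  ∀ i, (W.piece i).IsBiSubmersion F

/-- The inverse `W⁻¹`. -/
def inv (W : SpanFamily m M) : SpanFamily m M where
  ι := W.ι
  piece i := (W.piece i).inv

/-- The composition `V * W`, whose pieces are the compositions of a piece of `V` and one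
of `W`. -/
def comp (V W : SpanFamily m M) : SpanFamily m M where
  ι := V.ι × W.ι
  piece i := (V.piece i.1).comp (W.piece i.2)

/-- `W` and `W'` are equivalent: there are a manifold `V` and surjective submersions `δ : V → W`
and `η : V → W'` with `p ∘ δ = p' ∘ η` and `q ∘ δ = q' ∘ η`. Here `V` is written as a countable
disjoint union of manifolds of pure dimension (the components may have different dimensions), each
of which is mapped to a single piece of `W` and to a single piece of `W'`. -/
def Equivalent (W W' : SpanFamily m M) : Prop :=
  ∃ (κ : Type) (_ : Countable κ) (V : κ → PureManifold.{u}) (i : κ → W.ι) (j : κ → W'.ι)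
    (δ : ∀ k, (V k).carrier → (W.piece (i k)).carrier)
    (η : ∀ k, (V k).carrier → (W'.piece (j k)).carrier),
    (∀ k, IsSmoothSubmersion (V k).model (W.piece (i k)).model (δ k)) ∧
    (∀ k, IsSmoothSubmersion (V k).model (W'.piece (j k)).model (η k)) ∧
    (∀ (a : W.ι) (w : (W.piece a).carrier), ∃ (k : κ) (v : (V k).carrier),
      (⟨i k, δ k v⟩ : Σ a, (W.piece a).carrier) = ⟨a, w⟩) ∧
    (∀ (b : W'.ι) (w : (W'.piece b).carrier), ∃ (k : κ) (v : (V k).carrier),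
      (⟨j k, η k v⟩ : Σ b, (W'.piece b).carrier) = ⟨b, w⟩) ∧
    ∀ (k : κ) (v : (V k).carrier),
      (W.piece (i k)).p (δ k v) = (W'.piece (j k)).p (η k v) ∧
      (W.piece (i k)).q (δ k v) = (W'.piece (j k)).q (η k v)

/-- `A` is an atlas of `F`: a bi-submersion over `F` such that `A * A` is equivalent to `A`
and `A` is equivalent to `A⁻¹`. -/
def IsAtlas (F : SingularFoliation m M) (A : SpanFamily m M) : Prop :=
  A.IsBiSubmersion F ∧ (A.comp A).Equivalent A ∧ A.Equivalent A.inv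

end SpanFamily

section PathHolonomy

variable {m : ℕ} {M : Type u} [TopologicalSpace M] [ChartedSpace (EuclideanSpace ℝ (Fin m)) M]
  {n : ℕ}

/-- The manifold structure of the product `M × ℝⁿ`. -/
@[reducible]
def chartedSpaceProd : ChartedSpace (EuclideanSpace ℝ (Fin m) × EuclideanSpace ℝ (Fin n))
    (M × EuclideanSpace ℝ (Fin n)) :=
  prodChartedSpace (EuclideanSpace ℝ (Fin m)) M (EuclideanSpace ℝ (Fin n))
    (EuclideanSpace ℝ (Fin n))

/-- The manifold structure of an open subset of `M × ℝⁿ`. -/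
@[reducible]
def chartedSpaceOpens (W : Opens (M × EuclideanSpace ℝ (Fin n))) :
    ChartedSpace (EuclideanSpace ℝ (Fin m) × EuclideanSpace ℝ (Fin n)) W :=
  letI := chartedSpaceProd (m := m) (M := M) (n := n)
  inferInstance

attribute [local instance] chartedSpaceProd chartedSpaceOpens

theorem isSmoothSubmersion_fst_opens (W : Opens (M × EuclideanSpace ℝ (Fin n))) :
    IsSmoothSubmersion (EuclideanSpace ℝ (Fin m) × EuclideanSpace ℝ (Fin n))
      (EuclideanSpace ℝ (Fin m)) (fun z : W => z.1.1) := by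
  classical
  have h1 : ContMDiff 𝓘(ℝ, EuclideanSpace ℝ (Fin m) × EuclideanSpace ℝ (Fin n)) (𝓡 m) ∞
      (Prod.fst : M × EuclideanSpace ℝ (Fin n) → M) := by
    rw [modelWithCornersSelf_prod]
    exact contMDiff_fst (I := 𝓡 m) (J := 𝓡 n)
  have h2 : ContMDiff 𝓘(ℝ, EuclideanSpace ℝ (Fin m) × EuclideanSpace ℝ (Fin n)) (𝓡 m) ∞
      (fun z : W => z.1.1) := h1.comp contMDiff_subtype_val
  refine ⟨h2, fun z => ?_⟩
  let f : M × EuclideanSpace ℝ (Fin n) → W := fun y => if h : y ∈ W then ⟨y, h⟩ else z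
  have hf : ∀ w : W, f w = w := fun w => by simp [f]
  have h3 : ContMDiffAt 𝓘(ℝ, EuclideanSpace ℝ (Fin m) × EuclideanSpace ℝ (Fin n))
      𝓘(ℝ, EuclideanSpace ℝ (Fin m) × EuclideanSpace ℝ (Fin n)) ∞ f z.1 := by
    rw [← contMDiffAt_subtype_iff]
    simp only [hf]
    exact contMDiffAt_id
  have h4 : ContMDiff (𝓡 m) 𝓘(ℝ, EuclideanSpace ℝ (Fin m) × EuclideanSpace ℝ (Fin n)) ∞
      (fun x : M => (x, z.1.2)) := by
    rw [modelWithCornersSelf_prod]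
    exact contMDiff_id.prodMk contMDiff_const
  have h5 : ContMDiffAt (𝓡 m) 𝓘(ℝ, EuclideanSpace ℝ (Fin m) × EuclideanSpace ℝ (Fin n)) ∞
      (fun x : M => f (x, z.1.2)) z.1.1 :=
    ContMDiffAt.comp (g := f) z.1.1 h3 (h4 z.1.1)
  have h6 : ∀ᶠ x in 𝓝 z.1.1, (f (x, z.1.2)).1.1 = x := by
    have h7 : ∀ᶠ x in 𝓝 z.1.1, (x, z.1.2) ∈ W :=
      h4.continuous.continuousAt.eventually (W.isOpen.mem_nhds z.2)
    filter_upwards [h7] with x hx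
    simp [f, hx]
  have h8 := mfderiv_surjective_of_section (f := fun z : W => z.1.1)
    ((h2 _).mdifferentiableAt (by simp)) (h5.mdifferentiableAt (by simp)) h6
  rwa [show f (z.1.1, z.1.2) = z from hf z] at h8

variable [IsManifold (𝓡 m) ∞ M]

theorem isManifold_prod :
    IsManifold 𝓘(ℝ, EuclideanSpace ℝ (Fin m) × EuclideanSpace ℝ (Fin n)) ∞
      (M × EuclideanSpace ℝ (Fin n)) := by
  rw [modelWithCornersSelf_prod]
  exact IsManifold.prod (n := ∞) (I := 𝓡 m) (I' := 𝓡 n) M (EuclideanSpace ℝ (Fin n))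

theorem isManifold_opens (W : Opens (M × EuclideanSpace ℝ (Fin n))) :
    IsManifold 𝓘(ℝ, EuclideanSpace ℝ (Fin m) × EuclideanSpace ℝ (Fin n)) ∞ W := by
  have := isManifold_prod (m := m) (M := M) (n := n)
  infer_instance

variable [T2Space M] [SecondCountableTopology M]

/-- The data of a path holonomy bi-submersion of `F` near `base`: on an open neighbourhood `dom` of
`base` there are generators `X₁, …, Xₙ` of `F`, and on an open neighbourhood `W` of `(base, 0)`
in `M × ℝⁿ` the map `q (x, t) = exp (∑ tᵢ Xᵢ) x` is defined. -/
structure PathHolonomyData (F : SingularFoliation m M) where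
  base : M
  dom : Opens M
  base_mem_dom : base ∈ dom
  n : ℕ
  X : Fin n → VField (EuclideanSpace ℝ (Fin m)) M
  generates : F.Generates dom X
  W : Opens (M × EuclideanSpace ℝ (Fin n))
  base_mem : (base, 0) ∈ W
  q : W → M
  /-- `q (x, t)` is the value at time one of the integral curve of `∑ tᵢ Xᵢ` starting at `x`. -/
  flow : ∀ z : W, ∃ γ : ℝ → M, γ 0 = z.1.1 ∧ γ 1 = q z ∧ (∀ s ∈ Set.Icc (0 : ℝ) 1, γ s ∈ dom) ∧
    IsMIntegralCurveOn (I := 𝓡 m) γ (fun x => ∑ i, z.1.2 i • X i x) (Set.Icc 0 1)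
  submersion_q : IsSmoothSubmersion (EuclideanSpace ℝ (Fin m) × EuclideanSpace ℝ (Fin n))
    (EuclideanSpace ℝ (Fin m)) q

/-- The manifold `W` with the submersions `p (x, t) = x` and `q (x, t) = exp (∑ tᵢ Xᵢ) x`. -/
def PathHolonomyData.toSpan {F : SingularFoliation m M} (D : PathHolonomyData F) : Span m M where
  model := EuclideanSpace ℝ (Fin m) × EuclideanSpace ℝ (Fin D.n)
  carrier := D.W
  manifold := isManifold_opens D.W
  p := fun z => z.1.1
  q := D.q
  submersion_p := isSmoothSubmersion_fst_opens D.W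
  submersion_q := D.submersion_q

/-- A path holonomy bi-submersion of `F`. -/
structure PathHolonomy (F : SingularFoliation m M) extends PathHolonomyData F where
  isBiSubmersion : toPathHolonomyData.toSpan.IsBiSubmersion F

/-- A countable family of path holonomy bi-submersions `(Wᵢ, pᵢ, qᵢ)` with `⋃ pᵢ(Wᵢ) = M`. -/
structure PathHolonomyFamily (F : SingularFoliation m M) where
  I : Type
  [countable : Countable I]
  piece : I → PathHolonomy F
  cover : ∀ x : M, ∃ i, ∃ z ∈ (piece i).W, z.1 = x

namespace PathHolonomyFamily

attribute [instance] countable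

variable {F : SingularFoliation m M} (P : PathHolonomyFamily F)

/-- `Wᵢ` and `Wᵢ⁻¹`. -/
def letter : P.I × Bool → Span m M
  | (i, true) => (P.piece i).toSpan
  | (i, false) => (P.piece i).toSpan.inv

/-- The composition of the letters of the non-empty word `a :: l`. -/
def word : P.I × Bool → List (P.I × Bool) → Span m M
  | a, [] => P.letter a
  | a, b :: l => (P.letter a).comp (word b l)

/-- The path holonomy atlas generated by the family: the disjoint union of the
`W_{i₁}^{±1} * ⋯ * W_{iₙ}^{±1}` for `n ≥ 1`. -/
def atlas : SpanFamily m M where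
  ι := (P.I × Bool) × List (P.I × Bool)
  piece a := P.word a.1 a.2

end PathHolonomyFamily

/-- `A` is a holonomy atlas of dimension `d` of `F`: an atlas of `F` which is equivalent to a path
holonomy atlas and all of whose components have the dimension `d`. -/
def SpanFamily.IsHolonomyAtlas (F : SingularFoliation m M) (A : SpanFamily m M) (d : ℕ) : Prop :=
  A.IsAtlas F ∧ (∃ P : PathHolonomyFamily F, A.Equivalent P.atlas) ∧ ∀ i, (A.piece i).dim = d

end PathHolonomy

end

/-! For submersions `p` and `q`, the equation `q⁻¹(F) = Γ(ker Tp) + Γ(ker Tq)` says that `Tq` maps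
the sections of `ker Tp` onto the module generated by the fields `Xᵢ ∘ q`, where the `Xᵢ` generate
`F`. In this form (`KerImage`, and `ChartKerImage` on manifolds) the condition is local, passes
along submersions (`KerImage.transfer`) and holds for fibre products (`KerImage.fiberProduct`).
Hence inverses and composites of bi-submersions are bi-submersions.

The heart is `LocEq.of_carries`: if local sections of `p` through `w` in `W` and through `w'` in
`W'` induce the same germ `φ = q ∘ σ`, then `W` and `W'` are equivalent near these points. Lift the
generators `Xᵢ` to fields `ξᵢ` on `W` tangent to the fibres of `p`, and add fields `ζⱼ` killed by
both `Tp` and `Tq` until `ker Tp` is spanned at `w`. Flowing the section `σ` along `∑ tᵢ ξᵢ + ∑ sⱼ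
ζⱼ` gives a submersion `δ` from an open subset of `M × ℝᴺ` to `W` with `p (δ (x, t, s)) = x` and `q
(δ (x, t, s)) = exp (∑ tᵢ Xᵢ) (φ x)`. The right-hand sides do not involve `W`, so one open subset of
`M × ℝᴺ` submerses to `W` and to `W'` compatibly with `p` and `q`.

The same `δ` yields the dimension. The map `q ∘ δ` ignores the coefficients of the `ζⱼ`, so they can
be dropped: near `w`, `W` is equivalent to an open subset of `M × ℝʳ` for every `r` not less than
the rank of `F` at `q w` (`Span.IsBiSubmersion.exists_locEq_dim_eq`). With `r` the rank of `F`, all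
points of a path holonomy atlas can be treated with the same `r`. Countably many of the new pieces
suffice by second countability, and families that are locally equivalent at all points are
equivalent (`SpanFamily.equivalent_of_locEq`).

Two path holonomy atlases are locally contained in each other (`PathHolonomyData.reaches`): the flow
of `∑ tᵢ Xᵢ` up to time one is a product of short flows, and a short flow is carried by every
bi-submersion that carries the identity at the relevant point. The atlas properties reduce to the
composition and the inversion of germs.

For existence, the involutivity of `F` shows that the differential of `(x, t) ↦ exp (∑ tᵢ Xᵢ) x`
expresses both the `t`-directions and the directions `Xᵢ` in `x` through the generators at the
endpoint (`exists_exp_kerImage`). Smooth dependence on initial values and parameters is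
`exists_flow`, an application of the implicit function theorem in the Banach space of continuous
curves. -/

/-! ### Smoothness of superposition operators on spaces of continuous curves. -/

section Superposition

open Set

variable {K E F : Type} [TopologicalSpace K] [CompactSpace K]
  [NormedAddCommGroup E] [NormedSpace ℝ E] [NormedAddCommGroup F] [NormedSpace ℝ F]

/-- The pointwise application of a continuous family of continuous linear maps. -/
noncomputable def pointwiseApply :
    C(K, E →L[ℝ] F) →L[ℝ] C(K, E) →L[ℝ] C(K, F) :=
  LinearMap.mkContinuous₂
    (LinearMap.mk₂ ℝ (fun (A : C(K, E →L[ℝ] F)) (h : C(K, E)) =>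
        (⟨fun s => A s (h s), by fun_prop⟩ : C(K, F)))
      (fun A B h => by ext; simp) (fun c A h => by ext; simp)
      (fun A h k => by ext; simp) (fun c A h => by ext; simp)) 1
    (fun A h => by
      rw [one_mul, ContinuousMap.norm_le _ (by positivity)]
      intro s
      exact ((A s).le_opNorm _).trans (mul_le_mul (A.norm_coe_le_norm s) (h.norm_coe_le_norm s)
        (norm_nonneg _) (by positivity)))

@[simp]
theorem pointwiseApply_apply (A : C(K, E →L[ℝ] F)) (h : C(K, E)) (s : K) :
    pointwiseApply A h s = A s (h s) := rfl

/-- The superposition operator `γ ↦ V ∘ γ`. -/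
def superposition (V : C(E, F)) (γ : C(K, E)) : C(K, F) := V.comp γ

/-- The mean value inequality at each `s` suffices once the oscillation of `V'` near `γ s` is
bounded uniformly in `s`. The uniform bound is the continuity of `γ ↦ V' ∘ γ` in the supremum norm.
-/
theorem hasFDerivAt_superposition (V : C(E, F)) (V' : C(E, E →L[ℝ] F))
    (hV : ∀ x, HasFDerivAt V (V' x) x) (γ : C(K, E)) :
    HasFDerivAt (superposition (K := K) V) (pointwiseApply (superposition V' γ)) γ := by
  rw [hasFDerivAt_iff_isLittleO, Asymptotics.isLittleO_iff]
  intro ε hε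
  have hc : ContinuousAt (superposition (K := K) V') γ :=
    (ContinuousMap.continuous_postcomp V').continuousAt
  obtain ⟨δ, hδ, hδ'⟩ := Metric.continuousAt_iff.1 hc ε hε
  filter_upwards [Metric.ball_mem_nhds γ hδ] with γ' hγ'
  rw [ContinuousMap.norm_le _ (by positivity)]
  intro s
  have hs : γ' s ∈ Metric.ball (γ s) δ :=
    lt_of_le_of_lt (ContinuousMap.dist_apply_le_dist s) hγ'
  have hb : ∀ x ∈ Metric.ball (γ s) δ, ‖V' x - V' (γ s)‖ ≤ ε := by
    intro x hx
    -- The translate of `γ` by `x - γ s` is `δ`-close to `γ` and passes through `x` at `s`, so the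
    -- estimate for curves becomes an estimate at `x`.
    have h1 : dist (γ + ContinuousMap.const K (x - γ s)) γ < δ := by
      rw [dist_eq_norm, add_sub_cancel_left]
      refine lt_of_le_of_lt ((ContinuousMap.norm_le _ (norm_nonneg (x - γ s))).2 fun _ => le_rfl) ?_
      rwa [← dist_eq_norm]
    have h2 := (ContinuousMap.dist_apply_le_dist s).trans (hδ' h1).le
    rw [dist_eq_norm] at h2
    simpa [superposition] using h2
  have h3 := (convex_ball (γ s) δ).norm_image_sub_le_of_norm_hasFDerivWithin_le'
    (f := V) (f' := V') (φ := V' (γ s)) (C := ε) (fun x _ => (hV x).hasFDerivWithinAt)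
    hb (Metric.mem_ball_self hδ) hs
  refine h3.trans ?_
  have h4 := (γ' - γ).norm_coe_le_norm s
  exact mul_le_mul_of_nonneg_left (by simpa using h4) hε.le

/-- The derivative is the superposition operator of `fderiv ℝ V` followed by the continuous bilinear
`pointwiseApply`. The induction therefore has to quantify over the target space `F`. -/
theorem contDiff_superposition_nat (n : ℕ) :
    ∀ {F : Type} [NormedAddCommGroup F] [NormedSpace ℝ F] (V : C(E, F)), ContDiff ℝ ∞ V →
      ContDiff ℝ n (superposition (K := K) V) := by
  induction n with
  | zero =>
    intro F _ _ V hV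
    exact contDiff_zero.2 (ContinuousMap.continuous_postcomp V)
  | succ n ih =>
    intro F _ _ V hV
    let V' : C(E, E →L[ℝ] F) := ⟨fderiv ℝ V, hV.continuous_fderiv (by simp)⟩
    have h := ih V' (hV.fderiv_right (m := ∞) (by simp))
    refine (contDiff_succ_iff_hasFDerivAt (n := (n : ℕ))).2
      ⟨fun γ => pointwiseApply (superposition V' γ), ?_, ?_⟩
    · exact pointwiseApply.contDiff.comp h
    · exact hasFDerivAt_superposition V V' fun x =>
        (hV.differentiable (by simp) x).hasFDerivAt

theorem contDiff_superposition (V : C(E, F)) (hV : ContDiff ℝ ∞ V) :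
    ContDiff ℝ ∞ (superposition (K := K) V) :=
  contDiff_infty.2 fun n => contDiff_superposition_nat n V hV

end Superposition

/-! ### Germs of smooth maps and the implicit function theorem. -/

/-- `f` is smooth on a neighbourhood of `x`. -/
def SmoothNear {E F : Type*} [NormedAddCommGroup E] [NormedSpace ℝ E] [NormedAddCommGroup F]
    [NormedSpace ℝ F] (f : E → F) (x : E) : Prop :=
  ∀ᶠ y in 𝓝 x, ContDiffAt ℝ ∞ f y

theorem SmoothNear.exists_global {E F : Type*} [NormedAddCommGroup E] [NormedSpace ℝ E]
    [FiniteDimensional ℝ E] [NormedAddCommGroup F] [NormedSpace ℝ F] {f : E → F} {x : E}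
    (hf : SmoothNear f x) : ∃ g : E → F, ContDiff ℝ ∞ g ∧ g =ᶠ[𝓝 x] f := by
  obtain ⟨r, hr, hr'⟩ := Metric.eventually_nhds_iff_ball.1 hf
  -- The support lies in the ball of radius `r`, where `f` is smooth, and `χ` is one near `x`.
  let χ : ContDiffBump x := ⟨r / 4, r / 2, by positivity, by linarith⟩
  refine ⟨fun y => χ y • f y, contDiff_iff_contDiffAt.2 fun y => ?_, ?_⟩
  · by_cases hy : y ∈ Metric.ball x r
    · exact χ.contDiff.contDiffAt.smul (hr' y hy)
    · have h1 : y ∉ tsupport χ := by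
        rw [χ.tsupport_eq]
        intro h2
        apply hy
        have h3 : dist y x ≤ r / 2 := h2
        have h4 : dist y x < r := by linarith
        exact h4
      have h2 : (fun y => χ y • f y) =ᶠ[𝓝 y] fun _ => 0 := by
        filter_upwards [(isClosed_tsupport χ).isOpen_compl.mem_nhds h1] with z hz
        have : χ z = 0 := image_eq_zero_of_notMem_tsupport hz
        simp [this]
      exact contDiffAt_const.congr_of_eventuallyEq h2
  · filter_upwards [χ.eventuallyEq_one] with y hy
    simp [hy]

/-- A function that is implicitly defined by a smooth equation is smooth near the base point. -/
theorem exists_implicit_smoothNear {P C : Type*} [NormedAddCommGroup P] [NormedSpace ℝ P]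
    [CompleteSpace P] [NormedAddCommGroup C] [NormedSpace ℝ C] [CompleteSpace C]
    {H : P × C → C} (hH : ContDiff ℝ ∞ H) {z₀ : P} {c₀ : C} (h0 : H (z₀, c₀) = 0)
    (hd : fderiv ℝ H (z₀, c₀) ∘L .inr ℝ P C = .id ℝ C) :
    ∃ ψ : P → C, SmoothNear ψ z₀ ∧ (∀ᶠ z in 𝓝 z₀, H (z, ψ z) = 0) ∧
      ∀ᶠ v in 𝓝 (z₀, c₀), H v = 0 → ψ v.1 = v.2 := by
  have hinv : (fderiv ℝ H (z₀, c₀) ∘L .inr ℝ P C).IsInvertible := by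
    rw [hd]
    exact ⟨.refl ℝ C, rfl⟩
  have hc : ContDiffAt ℝ ∞ H (z₀, c₀) := hH.contDiffAt
  let ψ := hc.implicitFunction (by simp) hinv
  have h1 : ∀ᶠ z in 𝓝 z₀, H (z, ψ z) = 0 := by
    filter_upwards [hc.eventually_apply_implicitFunction (by simp) hinv] with z hz
    exact hz.trans h0
  have hψ0 : ψ z₀ = c₀ := hc.implicitFunction_apply_self (by simp) hinv
  have h2 : ContDiffAt ℝ 1 ψ z₀ := (hc.contDiffAt_implicitFunction (by simp) hinv).of_le (by simp)
  -- Being `C^∞` at `z₀` gives for each finite order a neighbourhood, and these might shrink. To get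
  -- one neighbourhood, `ψ` is compared at each nearby `z` with the implicit function constructed at
  -- `(z, ψ z)`; local uniqueness makes them agree. Continuity of `ψ` near `z₀` and invertibility at
  -- `(z, ψ z)` are all this needs.
  have h3 : ∀ᶠ z in 𝓝 z₀, ContDiffAt ℝ 1 ψ z := h2.eventually (by simp)
  have h4 : Continuous fun v => fderiv ℝ H v ∘L .inr ℝ P C :=
    (hH.continuous_fderiv (by simp)).clm_comp continuous_const
  have h5 : IsOpen {L : C →L[ℝ] C | L.IsInvertible} := ContinuousLinearEquiv.isOpen
  have h6 : ∀ᶠ z in 𝓝 z₀, (fderiv ℝ H (z, ψ z) ∘L .inr ℝ P C).IsInvertible := by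
    have h7 : ContinuousAt (fun z => fderiv ℝ H (z, ψ z) ∘L .inr ℝ P C) z₀ :=
      h4.continuousAt.comp (f := fun z => (z, ψ z)) (continuousAt_id.prodMk h2.continuousAt)
    refine h7.eventually (h5.mem_nhds ?_)
    change (fderiv ℝ H (z₀, ψ z₀) ∘L .inr ℝ P C).IsInvertible
    rwa [hψ0]
  refine ⟨ψ, ?_, h1, ?_⟩
  · filter_upwards [h1.eventually_nhds, h3, h6] with z hz1 hz3 hz6
    have hc' : ContDiffAt ℝ ∞ H (z, ψ z) := hH.contDiffAt
    have h8 := hc'.contDiffAt_implicitFunction (by simp) hz6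
    refine h8.congr_of_eventuallyEq ?_
    have h9 : Filter.Tendsto (fun z => (z, ψ z)) (𝓝 z) (𝓝 (z, ψ z)) :=
      continuousAt_id.prodMk hz3.continuousAt
    filter_upwards [h9.eventually (hc'.eventually_apply_eq_iff_implicitFunction (by simp) hz6),
      hz1] with z' hz' hz1'
    exact (hz'.1 (by rw [hz1', hz1.self_of_nhds])).symm
  · filter_upwards [hc.eventually_apply_eq_iff_implicitFunction (by simp) hinv] with v hv h
    exact hv.1 (by rw [h, h0])

/-! ### Integral curves and their smooth dependence on initial values and parameters. -/

section Flow

open Set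

variable {E Λ : Type} [NormedAddCommGroup E] [NormedSpace ℝ E]
  [NormedAddCommGroup Λ] [NormedSpace ℝ Λ]

local notation "𝕀" => Icc (0 : ℝ) 1

/-- Integration from `0`. -/
noncomputable def primitive : C(𝕀, E) →L[ℝ] C(𝕀, E) :=
  LinearMap.mkContinuous
    { toFun := fun g => ⟨fun s => ∫ u in (0 : ℝ)..s, IccExtend zero_le_one g u,
        (intervalIntegral.continuous_primitive (fun _ _ =>
          (g.continuous.Icc_extend' (h := zero_le_one)).intervalIntegrable _ _) 0).comp continuous_subtype_val⟩
      map_add' := fun f g => by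
        ext s
        exact intervalIntegral.integral_add
          ((f.continuous.Icc_extend' (h := zero_le_one)).intervalIntegrable _ _)
          ((g.continuous.Icc_extend' (h := zero_le_one)).intervalIntegrable _ _)
      map_smul' := fun c g => by
        ext s
        exact intervalIntegral.integral_smul c _ } 1
    (fun g => by
      rw [one_mul, ContinuousMap.norm_le _ (by positivity)]
      intro s
      refine (intervalIntegral.norm_integral_le_of_norm_le_const (C := ‖g‖)
        fun u _ => g.norm_coe_le_norm _).trans ?_
      rw [sub_zero, abs_of_nonneg s.2.1]
      exact mul_le_of_le_one_right (by positivity) s.2.2)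

theorem primitive_apply (g : C(𝕀, E)) (s : 𝕀) :
    primitive g s = ∫ u in (0 : ℝ)..s, IccExtend zero_le_one g u := rfl

theorem hasDerivWithinAt_of_eq_primitive [CompleteSpace E] {f g : C(𝕀, E)} {y : E}
    (h : f = ContinuousMap.const _ y + primitive g) {s : ℝ} (hs : s ∈ 𝕀) :
    HasDerivWithinAt (IccExtend zero_le_one f) (g ⟨s, hs⟩) 𝕀 s := by
  have h1 : HasDerivAt (fun s => y + ∫ u in (0 : ℝ)..s, IccExtend zero_le_one g u)
      (IccExtend zero_le_one g s) s :=
    ((g.continuous.Icc_extend' (h := zero_le_one)).integral_hasStrictDerivAt 0 s).hasDerivAt.const_add y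
  rw [IccExtend_of_mem _ _ hs] at h1
  refine h1.hasDerivWithinAt.congr_of_mem (fun u hu => ?_) hs
  rw [IccExtend_of_mem _ _ hu, h]
  rfl

/-- The curve `s ↦ (γ s, lam)`. -/
noncomputable def pairConst : C(𝕀, E) × Λ →L[ℝ] C(𝕀, E × Λ) :=
  LinearMap.mkContinuous
    { toFun := fun p => ⟨fun s => (p.1 s, p.2), by fun_prop⟩
      map_add' := fun p q => by ext s <;> simp
      map_smul' := fun c p => by ext s <;> simp } 1
    (fun p => by
      rw [one_mul, ContinuousMap.norm_le _ (by positivity)]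
      intro s
      exact max_le_max (p.1.norm_coe_le_norm s) le_rfl)

@[simp]
theorem pairConst_apply (p : C(𝕀, E) × Λ) (s : 𝕀) : pairConst p s = (p.1 s, p.2) := rfl

noncomputable def constCurve : E →L[ℝ] C(𝕀, E) :=
  LinearMap.mkContinuous
    { toFun := fun y => ContinuousMap.const _ y
      map_add' := fun p q => by ext s; simp
      map_smul' := fun c p => by ext s; simp } 1
    (fun p => by
      rw [one_mul, ContinuousMap.norm_le _ (by positivity)]
      exact fun s => le_rfl)

@[simp]
theorem constCurve_apply (y : E) (s : 𝕀) : constCurve y s = y := rfl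

/-- The curve `γ` is an integral curve of `V (·, lam)` starting at `y` if and only if
`flowEquation V ((y, lam), γ) = 0`. -/
noncomputable def flowEquation (V : C(E × Λ, E)) (p : (E × Λ) × C(𝕀, E)) : C(𝕀, E) :=
  p.2 - constCurve p.1.1 - primitive (superposition V (pairConst (p.2, p.1.2)))

theorem contDiff_flowEquation (V : C(E × Λ, E)) (hV : ContDiff ℝ ∞ V) :
    ContDiff ℝ ∞ (flowEquation V) := by
  have h1 : ContDiff ℝ ∞ fun p : (E × Λ) × C(𝕀, E) => pairConst (p.2, p.1.2) :=
    (pairConst (E := E) (Λ := Λ)).contDiff.comp (contDiff_snd.prodMk (contDiff_snd.comp contDiff_fst))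
  have h2 : ContDiff ℝ ∞ fun p : (E × Λ) × C(𝕀, E) => p.2 - constCurve p.1.1 :=
    contDiff_snd.sub ((constCurve (E := E)).contDiff.comp (contDiff_fst.comp contDiff_fst))
  exact h2.sub ((primitive (E := E)).contDiff.comp ((contDiff_superposition V hV).comp h1))

theorem fderiv_flowEquation (V : C(E × Λ, E)) (hV : ContDiff ℝ ∞ V) (p : (E × Λ) × C(𝕀, E))
    (δ : (E × Λ) × C(𝕀, E)) :
    fderiv ℝ (flowEquation V) p δ = δ.2 - constCurve δ.1.1 -
      primitive (pointwiseApply (superposition ⟨fderiv ℝ V, hV.continuous_fderiv (by simp)⟩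
        (pairConst (p.2, p.1.2))) (pairConst (δ.2, δ.1.2))) := by
  have h1 := hasFDerivAt_superposition V ⟨fderiv ℝ V, hV.continuous_fderiv (by simp)⟩
    (fun x => (hV.differentiable (by simp) x).hasFDerivAt) (pairConst (p.2, p.1.2))
  have h2 : HasFDerivAt (fun p : (E × Λ) × C(𝕀, E) => pairConst (p.2, p.1.2))
      (pairConst ∘L ((ContinuousLinearMap.snd ℝ _ _).prod
        (ContinuousLinearMap.snd ℝ _ _ ∘L ContinuousLinearMap.fst ℝ _ _))) p :=
    HasFDerivAt.comp (g := pairConst (E := E) (Λ := Λ))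
      (f := fun p : (E × Λ) × C(𝕀, E) => (p.2, p.1.2)) p
      (pairConst (E := E) (Λ := Λ)).hasFDerivAt
      (hasFDerivAt_snd.prodMk (hasFDerivAt_snd.comp p hasFDerivAt_fst))
  have h3 : HasFDerivAt (fun p : (E × Λ) × C(𝕀, E) => p.2 - constCurve p.1.1)
      (ContinuousLinearMap.snd ℝ _ _ -
        constCurve ∘L ContinuousLinearMap.fst ℝ _ _ ∘L ContinuousLinearMap.fst ℝ _ _) p :=
    hasFDerivAt_snd.sub ((constCurve (E := E)).hasFDerivAt.comp p
      (hasFDerivAt_fst.comp p hasFDerivAt_fst))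
  have h4 := h3.sub (primitive.hasFDerivAt.comp p (h1.comp p h2))
  have h5 : HasFDerivAt (flowEquation V) _ p := h4
  rw [h5.fderiv]
  rfl

/-- Smooth dependence of integral curves on initial values and parameters, for a field
`V (·, lam)` that vanishes for `lam = lam₀`. -/
theorem exists_flow [FiniteDimensional ℝ E] [FiniteDimensional ℝ Λ] {V : E × Λ → E} {y₀ : E}
    {lam₀ : Λ} (hV : SmoothNear V (y₀, lam₀)) (h0 : ∀ᶠ y in 𝓝 y₀, V (y, lam₀) = 0)
    {S : Set (E × Λ)} (hS : S ∈ 𝓝 (y₀, lam₀)) :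
    ∃ Φ : ℝ → E × Λ → E,
      (∀ᶠ z in 𝓝 (y₀, lam₀), (∀ s ∈ 𝕀, ContDiffAt ℝ ∞ (Φ s) z) ∧ Φ 0 z = z.1 ∧
        (∀ δ, fderiv ℝ (Φ 0) z δ = δ.1) ∧
        (∀ s ∈ 𝕀, (Φ s z, z.2) ∈ S ∧
          HasDerivWithinAt (fun s => Φ s z) (V (Φ s z, z.2)) 𝕀 s) ∧
        ∀ δ, ∀ s ∈ 𝕀, HasDerivWithinAt (fun s => fderiv ℝ (Φ s) z δ)
          (fderiv ℝ V (Φ s z, z.2) (fderiv ℝ (Φ s) z δ, δ.2)) 𝕀 s) ∧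
      ∀ᶠ y in 𝓝 y₀, ∀ s ∈ 𝕀, Φ s (y, lam₀) = y := by
  have : CompleteSpace E := FiniteDimensional.complete ℝ E
  have : CompleteSpace Λ := FiniteDimensional.complete ℝ Λ
  -- Superposition operators need a globally smooth field. The cut-off is undone in `hS'`, since the
  -- curves in question stay near `y₀`.
  obtain ⟨V', hV', hVV'⟩ := hV.exists_global
  let VC : C(E × Λ, E) := ⟨V', hV'.continuous⟩
  let H := flowEquation VC
  have hH : ContDiff ℝ ∞ H := contDiff_flowEquation VC hV'
  have hcst : ∀ᶠ y in 𝓝 y₀, H ((y, lam₀), constCurve y) = 0 := by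
    have h1 : ∀ᶠ y in 𝓝 y₀, V' (y, lam₀) = V (y, lam₀) :=
      ((continuous_id.prodMk continuous_const).tendsto' y₀ (y₀, lam₀) rfl).eventually hVV'
    filter_upwards [h1, h0] with y hy1 hy2
    have h2 : superposition VC (pairConst (constCurve y, lam₀)) = 0 := by
      ext s
      exact hy1.trans hy2
    change constCurve y - constCurve y - primitive _ = 0
    rw [h2]
    simp
  -- Since the field vanishes for `lam₀`, so does its derivative in the space direction. The
  -- linearised equation in the curve variable is then the identity, and the implicit function
  -- theorem gives curves on all of `[0, 1]` without shrinking time.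
  have hd0 : ∀ h : E, fderiv ℝ V' (y₀, lam₀) (h, 0) = 0 := by
    intro h
    have h1 : HasFDerivAt (fun y => V' (y, lam₀))
        (fderiv ℝ V' (y₀, lam₀) ∘L ContinuousLinearMap.inl ℝ E Λ) y₀ :=
      (hV'.differentiable (by simp) _).hasFDerivAt.comp y₀ (hasFDerivAt_prodMk_left y₀ lam₀)
    have h2 : (fun y => V' (y, lam₀)) =ᶠ[𝓝 y₀] fun _ => 0 := by
      filter_upwards [h0, ((continuous_id.prodMk continuous_const).tendsto' y₀ (y₀, lam₀)
        rfl).eventually hVV'] with y hy1 hy2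
      exact hy2.trans hy1
    have h3 := h1.unique ((hasFDerivAt_const (0 : E) y₀).congr_of_eventuallyEq h2)
    exact congrArg (fun L => L h) h3
  have hd : fderiv ℝ H ((y₀, lam₀), constCurve y₀) ∘L .inr ℝ (E × Λ) C(𝕀, E) = .id ℝ _ := by
    ext h : 1
    rw [ContinuousLinearMap.comp_apply, fderiv_flowEquation VC hV']
    have h2 : pointwiseApply (superposition ⟨fderiv ℝ V', hV'.continuous_fderiv (by simp)⟩
        (pairConst ((constCurve y₀ : C(𝕀, E)), lam₀))) (pairConst (h, (0 : Λ))) = 0 := by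
      ext s
      exact hd0 (h s)
    change h - constCurve 0 - primitive (pointwiseApply (superposition
      ⟨fderiv ℝ V', hV'.continuous_fderiv (by simp)⟩
        (pairConst ((constCurve y₀ : C(𝕀, E)), lam₀))) (pairConst (h, (0 : Λ)))) = h
    rw [h2]
    simp
  obtain ⟨ψ, hψ1, hψ2, hψ3⟩ := exists_implicit_smoothNear hH hcst.self_of_nhds hd
  let Φ : ℝ → E × Λ → E := fun s z => IccExtend zero_le_one (ψ z) s
  have hΦ : ∀ s (hs : s ∈ 𝕀) z, Φ s z = ψ z ⟨s, hs⟩ := fun s hs z => IccExtend_of_mem _ _ hs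
  let ev : 𝕀 → C(𝕀, E) →L[ℝ] E := fun s => ContinuousMap.evalCLM ℝ s
  have hΦ' : ∀ s (hs : s ∈ 𝕀), Φ s = fun z => ev ⟨s, hs⟩ (ψ z) := fun s hs => funext (hΦ s hs)
  have hψc : ContinuousAt ψ (y₀, lam₀) := hψ1.self_of_nhds.continuousAt
  have hψ0 : ψ (y₀, lam₀) = constCurve y₀ := hψ3.self_of_nhds hcst.self_of_nhds
  -- For `z` near the base point, `ψ z` is uniformly close to the constant curve at `y₀`, so it
  -- remains in `S` and where `V'` agrees with `V`.
  have hS' : ∀ᶠ z in 𝓝 (y₀, lam₀), ∀ s : 𝕀, (ψ z s, z.2) ∈ S ∧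
      ∀ᶠ v in 𝓝 (ψ z s, z.2), V' v = V v := by
    obtain ⟨r, hr, hr'⟩ := Metric.eventually_nhds_iff_ball.1
      ((Filter.eventually_mem_set.2 hS).and hVV'.eventually_nhds)
    have h1 : ContinuousAt (fun z => pairConst (ψ z, z.2)) (y₀, lam₀) :=
      pairConst.continuous.continuousAt.comp (hψc.prodMk continuous_snd.continuousAt)
    filter_upwards [h1 (Metric.ball_mem_nhds _ hr)] with z hz s
    have h2 := lt_of_le_of_lt (ContinuousMap.dist_apply_le_dist s) hz
    rw [hψ0] at h2
    exact hr' _ h2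
  refine ⟨Φ, ?_, ?_⟩
  · filter_upwards [hψ1, hψ2.eventually_nhds, hS'] with z hz1 hz2 hz3
    have hfd : ∀ s (hs : s ∈ 𝕀) δ, fderiv ℝ (Φ s) z δ = fderiv ℝ ψ z δ ⟨s, hs⟩ := by
      intro s hs δ
      rw [hΦ' s hs]
      have h1 := (ev ⟨s, hs⟩).hasFDerivAt.comp z (hz1.differentiableAt (by simp)).hasFDerivAt
      rw [show (fun z => ev ⟨s, hs⟩ (ψ z)) = (ev ⟨s, hs⟩) ∘ ψ from rfl, h1.fderiv]
      rfl
    have hint : ∀ᶠ z in 𝓝 z, ψ z = constCurve z.1 +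
        primitive (superposition VC (pairConst (ψ z, z.2))) := by
      filter_upwards [hz2] with z hz
      have h1 : ψ z - constCurve z.1 - primitive (superposition VC (pairConst (ψ z, z.2))) = 0 := hz
      rw [sub_eq_zero, sub_eq_iff_eq_add'] at h1
      exact h1
    have h00 : (0 : ℝ) ∈ 𝕀 := ⟨le_rfl, zero_le_one⟩
    have hstart : Φ 0 =ᶠ[𝓝 z] Prod.fst := by
      filter_upwards [hint] with z hz
      rw [hΦ 0 h00, hz]
      simp [primitive_apply]
    -- Differentiating `H (z, ψ z) = 0` in `z` gives the variational equation in integrated form.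
    have hvar : ∀ δ, fderiv ℝ ψ z δ = ContinuousMap.const _ δ.1 +
        primitive (pointwiseApply (superposition ⟨fderiv ℝ V', hV'.continuous_fderiv (by simp)⟩
          (pairConst (ψ z, z.2))) (pairConst (fderiv ℝ ψ z δ, δ.2))) := by
      intro δ
      have h1 : HasFDerivAt (fun z => H (z, ψ z)) _ z :=
        HasFDerivAt.comp (g := H) (f := fun z => (z, ψ z)) z
          (hH.differentiable (by simp) (z, ψ z)).hasFDerivAt
        ((hasFDerivAt_id z).prodMk (hz1.differentiableAt (by simp)).hasFDerivAt)
      have h2 := h1.unique ((hasFDerivAt_const (0 : C(𝕀, E)) z).congr_of_eventuallyEq hz2)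
      have h3 := congrArg (fun L => L δ) h2
      change fderiv ℝ H (z, ψ z) (δ, fderiv ℝ ψ z δ) = 0 at h3
      rw [fderiv_flowEquation VC hV', sub_eq_zero, sub_eq_iff_eq_add'] at h3
      exact h3
    refine ⟨fun s hs => ?_, hstart.self_of_nhds, fun δ => ?_, fun s hs => ⟨?_, ?_⟩, fun δ s hs => ?_⟩
    · rw [hΦ' s hs]
      exact (ev ⟨s, hs⟩).contDiff.contDiffAt.comp z hz1
    · rw [hstart.fderiv_eq, fderiv_fst]
      rfl
    · rw [hΦ s hs]
      exact (hz3 ⟨s, hs⟩).1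
    · have h1 := hasDerivWithinAt_of_eq_primitive (y := z.1) hint.self_of_nhds hs
      have h2 := (hz3 ⟨s, hs⟩).2.self_of_nhds
      rw [hΦ s hs, ← h2]
      exact h1
    · have h1 := hasDerivWithinAt_of_eq_primitive (hvar δ) hs
      have h2 := Filter.EventuallyEq.fderiv_eq (𝕜 := ℝ) (hz3 ⟨s, hs⟩).2
      rw [hΦ s hs, ← h2, hfd s hs]
      refine h1.congr_of_mem (fun u hu => ?_) hs
      rw [hfd u hu, IccExtend_of_mem _ _ hu]
  · have h1 : Filter.Tendsto (fun y : E => ((y, lam₀), (constCurve y : C(𝕀, E)))) (𝓝 y₀)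
        (𝓝 ((y₀, lam₀), constCurve y₀)) :=
      ((continuous_id.prodMk continuous_const).prodMk constCurve.continuous).tendsto y₀
    filter_upwards [h1.eventually hψ3, hcst] with y hy1 hy2 s hs
    rw [hΦ s hs, hy1 hy2]
    rfl

theorem hasDerivWithinAt_Ici_of_Icc {f : ℝ → E} {f' : E} {a b s : ℝ} (hs : s ∈ Ico a b)
    (h : HasDerivWithinAt f f' (Icc a b) s) : HasDerivWithinAt f f' (Ici s) s :=
  h.mono_of_mem_nhdsWithin (Icc_mem_nhdsGE_of_mem hs)

theorem eqOn_of_lipschitzOnWith {Λ : Type} [NormedAddCommGroup Λ] {V : E × Λ → E} {K : NNReal} {S : Set (E × Λ)}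
    (hV : LipschitzOnWith K V S) {lam : Λ} {α β : ℝ → E} {a b : ℝ}
    (hα : ∀ s ∈ Icc a b, (α s, lam) ∈ S ∧ HasDerivWithinAt α (V (α s, lam)) (Icc a b) s)
    (hβ : ∀ s ∈ Icc a b, (β s, lam) ∈ S ∧ HasDerivWithinAt β (V (β s, lam)) (Icc a b) s)
    (h0 : α a = β a) : EqOn α β (Icc a b) := by
  refine ODE_solution_unique_of_mem_Icc_right (v := fun _ y => V (y, lam)) (K := K)
    (s := fun _ => {y | (y, lam) ∈ S}) (fun t _ => ?_)
    (fun s hs => (hα s hs).2.continuousWithinAt)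
    (fun s hs => hasDerivWithinAt_Ici_of_Icc hs (hα s (Ico_subset_Icc_self hs)).2)
    (fun s hs => (hα s (Ico_subset_Icc_self hs)).1)
    (fun s hs => (hβ s hs).2.continuousWithinAt)
    (fun s hs => hasDerivWithinAt_Ici_of_Icc hs (hβ s (Ico_subset_Icc_self hs)).2)
    (fun s hs => (hβ s (Ico_subset_Icc_self hs)).1) h0
  intro y hy z hz
  have h1 := hV hy hz
  rwa [show edist (y, lam) (z, lam) = edist y z by simp [Prod.edist_eq]] at h1

/-- Grönwall, with `K` a bound of the norm of `A` on the compact interval. -/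
theorem eq_zero_of_linear_ode {A : ℝ → E →L[ℝ] E} {R : ℝ → E} {a b : ℝ}
    (hA : ContinuousOn A (Icc a b))
    (hR : ∀ s ∈ Icc a b, HasDerivWithinAt R (A s (R s)) (Icc a b) s) (h0 : R a = 0) :
    ∀ s ∈ Icc a b, R s = 0 := by
  obtain ⟨K, hK⟩ := isCompact_Icc.exists_bound_of_continuousOn hA
  exact eq_zero_of_abs_deriv_le_mul_abs_self_of_eq_zero_right (K := K)
    (fun s hs => (hR s hs).continuousWithinAt)
    (fun s hs => hasDerivWithinAt_Ici_of_Icc hs (hR s (Ico_subset_Icc_self hs))) h0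
    fun s hs => ((A s).le_opNorm _).trans
      (mul_le_mul_of_nonneg_right (hK s (Ico_subset_Icc_self hs)) (norm_nonneg _))

end Flow

/-! ### Calculus of smooth germs, smooth right inverses and local sections. -/

namespace SmoothNear

variable {E F G : Type*} [NormedAddCommGroup E] [NormedSpace ℝ E] [NormedAddCommGroup F]
  [NormedSpace ℝ F] [NormedAddCommGroup G] [NormedSpace ℝ G] {f g : E → F} {x : E}

theorem contDiffAt (hf : SmoothNear f x) : ContDiffAt ℝ ∞ f x := hf.self_of_nhds

theorem continuousAt (hf : SmoothNear f x) : ContinuousAt f x := hf.contDiffAt.continuousAt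

theorem eventually_differentiableAt (hf : SmoothNear f x) : ∀ᶠ y in 𝓝 x, DifferentiableAt ℝ f y :=
  hf.mono fun _ h => h.differentiableAt (by simp)

theorem eventually_smoothNear (hf : SmoothNear f x) : ∀ᶠ y in 𝓝 x, SmoothNear f y :=
  hf.eventually_nhds

theorem congr (hf : SmoothNear f x) (h : g =ᶠ[𝓝 x] f) : SmoothNear g x := by
  filter_upwards [hf, h.eventually_nhds] with y hy hy'
  exact hy.congr_of_eventuallyEq hy'

theorem _root_.ContDiff.smoothNear (hf : ContDiff ℝ ∞ f) : SmoothNear f x :=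
  Filter.Eventually.of_forall fun _ => hf.contDiffAt

theorem const (c : F) : SmoothNear (fun _ : E => c) x := contDiff_const.smoothNear

theorem id : SmoothNear (fun y : E => y) x := contDiff_id.smoothNear

theorem comp {h : F → G} (hh : SmoothNear h (f x)) (hf : SmoothNear f x) :
    SmoothNear (fun y => h (f y)) x := by
  filter_upwards [hf, hf.continuousAt.eventually hh] with y hy hy'
  exact hy'.comp y hy

theorem comp_of_eq {h : F → G} {y : F} (hh : SmoothNear h y) (hf : SmoothNear f x) (hy : f x = y) :
    SmoothNear (fun y => h (f y)) x := by
  subst hy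
  exact hh.comp hf

theorem clm (L : F →L[ℝ] G) (hf : SmoothNear f x) : SmoothNear (fun y => L (f y)) x :=
  (L.contDiff.smoothNear).comp hf

theorem add (hf : SmoothNear f x) (hg : SmoothNear g x) : SmoothNear (fun y => f y + g y) x := by
  filter_upwards [hf, hg] with y h1 h2 using h1.add h2

theorem sub (hf : SmoothNear f x) (hg : SmoothNear g x) : SmoothNear (fun y => f y - g y) x := by
  filter_upwards [hf, hg] with y h1 h2 using h1.sub h2

theorem neg (hf : SmoothNear f x) : SmoothNear (fun y => -f y) x := by
  filter_upwards [hf] with y h1 using h1.neg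

theorem mul {f g : E → ℝ} (hf : SmoothNear f x) (hg : SmoothNear g x) :
    SmoothNear (fun y => f y * g y) x := by
  filter_upwards [hf, hg] with y h1 h2 using h1.mul h2

theorem smul {c : E → ℝ} (hc : SmoothNear c x) (hf : SmoothNear f x) :
    SmoothNear (fun y => c y • f y) x := by
  filter_upwards [hf, hc] with y h1 h2 using h2.smul h1

theorem sum {ι : Type*} (s : Finset ι) {f : ι → E → F} (hf : ∀ i ∈ s, SmoothNear (f i) x) :
    SmoothNear (fun y => ∑ i ∈ s, f i y) x := by
  filter_upwards [(Filter.eventually_all_finset s).2 hf] with y hy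
  exact ContDiffAt.sum hy

theorem prodMk {h : E → G} (hf : SmoothNear f x) (hh : SmoothNear h x) :
    SmoothNear (fun y => (f y, h y)) x := by
  filter_upwards [hf, hh] with y h1 h2 using h1.prodMk h2

theorem fst {f : E → F × G} (hf : SmoothNear f x) : SmoothNear (fun y => (f y).1) x :=
  hf.clm (.fst ℝ F G)

theorem snd {f : E → F × G} (hf : SmoothNear f x) : SmoothNear (fun y => (f y).2) x :=
  hf.clm (.snd ℝ F G)

theorem pi {ι : Type*} [Fintype ι] {f : E → ι → F} (hf : ∀ i, SmoothNear (fun y => f y i) x) :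
    SmoothNear f x := by
  filter_upwards [Filter.eventually_all.2 hf] with y hy using contDiffAt_pi.2 hy

theorem fderiv (hf : SmoothNear f x) : SmoothNear (fderiv ℝ f) x := by
  filter_upwards [hf] with y hy using hy.fderiv_right (by simp)

theorem clm_apply {A : E → F →L[ℝ] G} (hA : SmoothNear A x) (hf : SmoothNear f x) :
    SmoothNear (fun y => A y (f y)) x := by
  filter_upwards [hA, hf] with y h1 h2 using h1.clm_apply h2

theorem clm_comp {H : Type*} [NormedAddCommGroup H] [NormedSpace ℝ H] {A : E → F →L[ℝ] G}
    {B : E → H →L[ℝ] F} (hA : SmoothNear A x) (hB : SmoothNear B x) :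
    SmoothNear (fun y => A y ∘L B y) x := by
  filter_upwards [hA, hB] with y h1 h2 using h1.clm_comp h2

theorem inverse [CompleteSpace F] {A : E → F →L[ℝ] G} (hA : SmoothNear A x)
    (h : (A x).IsInvertible) :
    SmoothNear (fun y => (A y).inverse) x ∧ ∀ᶠ y in 𝓝 x, (A y).IsInvertible := by
  have h1 : ∀ᶠ y in 𝓝 x, (A y).IsInvertible :=
    hA.continuousAt.eventually (ContinuousLinearEquiv.isOpen.mem_nhds h)
  refine ⟨?_, h1⟩
  filter_upwards [hA, h1] with y hy hy1
  exact hy1.contDiffAt_map_inverse.comp y hy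

theorem exists_lipschitzOnWith (hf : SmoothNear f x) :
    ∃ K, ∃ S ∈ 𝓝 x, LipschitzOnWith K f S :=
  (hf.contDiffAt.of_le (by simp)).exists_lipschitzOnWith

end SmoothNear

theorem fderiv_comp_eventuallyEq {E F F' G : Type*} [NormedAddCommGroup E] [NormedSpace ℝ E]
    [NormedAddCommGroup F] [NormedSpace ℝ F] [NormedAddCommGroup F'] [NormedSpace ℝ F']
    [NormedAddCommGroup G] [NormedSpace ℝ G] {f : E → F} {g : F → G} {f' : E → F'} {g' : F' → G}
    {x : E} (hf : SmoothNear f x) (hg : SmoothNear g (f x)) (hf' : SmoothNear f' x)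
    (hg' : SmoothNear g' (f' x)) (h : ∀ᶠ y in 𝓝 x, g (f y) = g' (f' y)) :
    ∀ᶠ y in 𝓝 x, ∀ v, fderiv ℝ g (f y) (fderiv ℝ f y v) = fderiv ℝ g' (f' y) (fderiv ℝ f' y v) := by
  filter_upwards [hf.eventually_differentiableAt, hf'.eventually_differentiableAt,
    hf.continuousAt.eventually hg.eventually_differentiableAt,
    hf'.continuousAt.eventually hg'.eventually_differentiableAt, h.eventually_nhds]
    with y h1 h2 h3 h4 h5 v
  have h6 := h3.hasFDerivAt.comp y h1.hasFDerivAt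
  have h7 := h4.hasFDerivAt.comp y h2.hasFDerivAt
  exact congrArg (fun L => L v) (h6.unique (h7.congr_of_eventuallyEq h5))

theorem fderiv_comp_eventually {E F G : Type*} [NormedAddCommGroup E] [NormedSpace ℝ E]
    [NormedAddCommGroup F] [NormedSpace ℝ F] [NormedAddCommGroup G] [NormedSpace ℝ G]
    {f : E → F} {g : F → G} {x : E} (hf : SmoothNear f x) (hg : SmoothNear g (f x)) :
    ∀ᶠ y in 𝓝 x, ∀ v, fderiv ℝ (fun y => g (f y)) y v = fderiv ℝ g (f y) (fderiv ℝ f y v) := by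
  filter_upwards [hf.eventually_differentiableAt,
    hf.continuousAt.eventually hg.eventually_differentiableAt] with y h1 h2 v
  exact congrArg (fun L => L v) (h2.hasFDerivAt.comp y h1.hasFDerivAt).fderiv

section

variable {E F : Type} [NormedAddCommGroup E] [NormedSpace ℝ E]
  [NormedAddCommGroup F] [NormedSpace ℝ F] [FiniteDimensional ℝ F]

/-- If `R₁` is a right inverse of `A g`, then `A z ∘ R₁` is invertible for `z` near `g`, and `R₁ ∘
(A z ∘ R₁)⁻¹` is a right inverse depending smoothly on `z`. -/
theorem SmoothNear.exists_rightInverse {G : Type*} [NormedAddCommGroup G] [NormedSpace ℝ G]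
    {A : G → E →L[ℝ] F} {g : G} (hA : SmoothNear A g) (hs : Function.Surjective (A g)) :
    ∃ R : G → F →L[ℝ] E, SmoothNear R g ∧ ∀ᶠ z in 𝓝 g, ∀ v, A z (R z v) = v := by
  have : CompleteSpace F := FiniteDimensional.complete ℝ F
  obtain ⟨R₀, hR₀⟩ := (A g : E →ₗ[ℝ] F).exists_rightInverse_of_surjective
    (LinearMap.range_eq_top.2 hs)
  let R₁ : F →L[ℝ] E := LinearMap.toContinuousLinearMap R₀
  have h1 : A g ∘L R₁ = .id ℝ F := by
    ext v
    exact congrArg (fun L => L v) hR₀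
  have h2 : SmoothNear (fun z => A z ∘L R₁) g := hA.clm_comp (.const R₁)
  obtain ⟨h3, h4⟩ := h2.inverse (by rw [h1]; exact ⟨.refl ℝ F, rfl⟩)
  refine ⟨fun z => R₁ ∘L (A z ∘L R₁).inverse, (SmoothNear.const R₁).clm_comp h3, ?_⟩
  filter_upwards [h4] with z hz v
  exact congrArg (fun L => L v) hz.self_comp_inverse

/-- Completing `p` by a linear map `π` to a local diffeomorphism, the section is the inverse along
the slice where `π` keeps its value at `e`. -/
theorem SmoothNear.exists_section [FiniteDimensional ℝ E] {p : E → F} {e : E} (hp : SmoothNear p e)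
    (hs : Function.Surjective (_root_.fderiv ℝ p e)) :
    ∃ σ : F → E, SmoothNear σ (p e) ∧ σ (p e) = e ∧ ∀ᶠ y in 𝓝 (p e), p (σ y) = y := by
  obtain ⟨π, L, hL⟩ := exists_complement_map _ hs
  obtain ⟨S, hS, hSo, heS⟩ := mem_nhds_iff.1 hp
  have hpS : ContDiffOn ℝ ∞ p S := fun x hx => (show ContDiffAt ℝ ∞ p x from hS hx).contDiffWithinAt
  have hg : HasFDerivAt (fun x => (p x, π x)) (L : E →L[ℝ] _) e := by
    rw [hL]
    exact (hp.contDiffAt.differentiableAt (by simp)).hasFDerivAt.prodMk π.hasFDerivAt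
  obtain ⟨Φ, h1, -, h3, h4⟩ := exists_smooth_local_inverse hSo
    (hpS.prodMk π.contDiff.contDiffOn) heS L hg
  have h5 : (p e, π e) ∈ Φ.target := by
    rw [← h3]
    exact Φ.map_source h1
  have h6 : SmoothNear Φ.symm (p e, π e) := by
    filter_upwards [Φ.open_target.mem_nhds h5] with y hy
    exact h4.contDiffAt (Φ.open_target.mem_nhds hy)
  have h7 : SmoothNear (fun y => (y, π e)) (p e) := SmoothNear.id.prodMk (.const _)
  refine ⟨fun y => Φ.symm (y, π e), h6.comp (f := fun y => (y, π e)) h7, ?_, ?_⟩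
  · change Φ.symm (p e, π e) = e
    rw [← h3, Φ.left_inv h1]
  · filter_upwards [h7.continuousAt.eventually (Φ.open_target.mem_nhds h5)] with y hy
    have h8 := Φ.right_inv hy
    rw [h3] at h8
    exact congrArg Prod.fst h8

end

/-! ### The bi-submersion condition in coordinates. -/

/-- The image under `Tq` of the vector fields in the kernel of `Tp` is, near `e`, generated by
the fields `X i ∘ q`. -/
structure KerImage {E F F' : Type} [NormedAddCommGroup E] [NormedSpace ℝ E]
    [NormedAddCommGroup F] [NormedSpace ℝ F] [NormedAddCommGroup F'] [NormedSpace ℝ F']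
    {n : ℕ} (p : E → F) (q : E → F') (X : Fin n → F' → F') (e : E) : Prop where
  lift : ∀ i, ∃ ξ : E → E, SmoothNear ξ e ∧
    ∀ᶠ z in 𝓝 e, fderiv ℝ p z (ξ z) = 0 ∧ fderiv ℝ q z (ξ z) = X i (q z)
  maps : ∀ ξ : E → E, SmoothNear ξ e → (∀ᶠ z in 𝓝 e, fderiv ℝ p z (ξ z) = 0) →
    ∃ g : Fin n → E → ℝ, (∀ i, SmoothNear (g i) e) ∧
      ∀ᶠ z in 𝓝 e, fderiv ℝ q z (ξ z) = ∑ i, g i z • X i (q z)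

namespace KerImage

variable {E E' F F' G : Type} [NormedAddCommGroup E] [NormedSpace ℝ E] [FiniteDimensional ℝ E]
  [NormedAddCommGroup E'] [NormedSpace ℝ E'] [FiniteDimensional ℝ E']
  [NormedAddCommGroup F] [NormedSpace ℝ F] [FiniteDimensional ℝ F]
  [NormedAddCommGroup F'] [NormedSpace ℝ F']
  [NormedAddCommGroup G] [NormedSpace ℝ G]
  {n : ℕ} {p : E → F} {q : E → F'} {X : Fin n → F' → F'} {e : E}

/-- The fields `bⱼ - R (Tp bⱼ)`, for a basis `b` and a smooth right inverse `R` of `Tp`, are tangent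
to the fibres of `p`. A vector of `ker Tp` is their combination with its own coordinates in `b`, so
`h.maps` for these finitely many fields settles vector fields along any map `m`. -/
theorem maps_along (h : KerImage p q X e) (hp : SmoothNear p e)
    (hs : Function.Surjective (fderiv ℝ p e)) {m : G → E} {g₀ : G} (hm : SmoothNear m g₀)
    (hme : m g₀ = e) {η : G → E} (hη : SmoothNear η g₀)
    (hη0 : ∀ᶠ g in 𝓝 g₀, fderiv ℝ p (m g) (η g) = 0) :
    ∃ c : Fin n → G → ℝ, (∀ i, SmoothNear (c i) g₀) ∧
      ∀ᶠ g in 𝓝 g₀, fderiv ℝ q (m g) (η g) = ∑ i, c i g • X i (q (m g)) := by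
  obtain ⟨R, hR, hR'⟩ := hp.fderiv.exists_rightInverse hs
  let b := Module.finBasis ℝ E
  let ξ : Fin (Module.finrank ℝ E) → E → E := fun j z => b j - R z (fderiv ℝ p z (b j))
  have hξ : ∀ j, SmoothNear (ξ j) e := fun j =>
    (SmoothNear.const _).sub (hR.clm_apply (hp.fderiv.clm_apply (.const _)))
  have hξ0 : ∀ j, ∀ᶠ z in 𝓝 e, fderiv ℝ p z (ξ j z) = 0 := by
    intro j
    filter_upwards [hR'] with z hz
    simp only [ξ, map_sub, hz, sub_self]
  choose c hc hc' using fun j => h.maps (ξ j) (hξ j) (hξ0 j)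
  have hcoord : ∀ j, SmoothNear (fun g => b.coord j (η g)) g₀ := fun j =>
    hη.clm (LinearMap.toContinuousLinearMap (b.coord j))
  have hmc : Filter.Tendsto m (𝓝 g₀) (𝓝 e) := hme ▸ hm.continuousAt
  refine ⟨fun i g => ∑ j, b.coord j (η g) * c j i (m g), fun i => ?_, ?_⟩
  · exact .sum _ fun j _ => (hcoord j).mul ((hc j i).comp_of_eq hm hme)
  · filter_upwards [hη0, hmc.eventually (Filter.eventually_all.2 hc')] with g hg hg'
    have h1 : η g = ∑ j, b.coord j (η g) • ξ j (m g) := by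
      simp only [ξ, smul_sub, Finset.sum_sub_distrib]
      have h2 : ∑ j, b.coord j (η g) • b j = η g := b.sum_repr (η g)
      have h3 : ∑ j, b.coord j (η g) • R (m g) (fderiv ℝ p (m g) (b j)) = 0 := by
        simp only [← map_smul, ← map_sum]
        rw [h2, hg, map_zero]
      rw [h2, h3, sub_zero]
    rw [h1, map_sum]
    simp only [map_smul, hg', Finset.smul_sum, Finset.sum_smul, smul_smul, ← h1]
    exact Finset.sum_comm

/-- The condition is transported along two submersions. -/
theorem transfer [FiniteDimensional ℝ G] (h : KerImage p q X e) (hp : SmoothNear p e)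
    (hq : SmoothNear q e) (hs : Function.Surjective (fderiv ℝ p e)) {p' : E' → F} {q' : E' → F'}
    {δ : G → E} {η : G → E'} {g₀ : G} (hp' : SmoothNear p' (η g₀)) (hq' : SmoothNear q' (η g₀))
    (hδ : SmoothNear δ g₀) (hδe : δ g₀ = e) (hδs : Function.Surjective (fderiv ℝ δ g₀))
    (hη : SmoothNear η g₀) (hηs : Function.Surjective (fderiv ℝ η g₀))
    (hpp : ∀ᶠ g in 𝓝 g₀, p' (η g) = p (δ g)) (hqq : ∀ᶠ g in 𝓝 g₀, q' (η g) = q (δ g)) :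
    KerImage p' q' X (η g₀) := by
  subst hδe
  -- Everything is constructed along `G`, lifting through one submersion and pushing by the other.
  -- Composition with `σ` turns fields along `η` into fields on `E'`.
  obtain ⟨σ, hσ, hσ0, hσ'⟩ := hη.exists_section hηs
  have hσt : Filter.Tendsto σ (𝓝 (η g₀)) (𝓝 g₀) := by
    have h1 := hσ.continuousAt.tendsto
    rwa [hσ0] at h1
  obtain ⟨R, hR, hR'⟩ := hδ.fderiv.exists_rightInverse hδs
  obtain ⟨R₂, hR₂, hR₂'⟩ := hη.fderiv.exists_rightInverse hηs
  have hP := fderiv_comp_eventuallyEq hη hp' hδ hp hpp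
  have hQ := fderiv_comp_eventuallyEq hη hq' hδ hq hqq
  refine ⟨fun i => ?_, fun ξ hξ hξ0 => ?_⟩
  · obtain ⟨ξ, hξ, hξ'⟩ := h.lift i
    have h1 : SmoothNear (fun g => fderiv ℝ η g (R g (ξ (δ g)))) g₀ :=
      hη.fderiv.clm_apply (hR.clm_apply (hξ.comp hδ))
    refine ⟨fun y => fderiv ℝ η (σ y) (R (σ y) (ξ (δ (σ y)))), h1.comp_of_eq hσ hσ0, ?_⟩
    filter_upwards [hσ', hσt.eventually hP, hσt.eventually hQ, hσt.eventually hR',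
      hσt.eventually (hδ.continuousAt.eventually hξ'), hσt.eventually hqq] with y h1 h2 h3 h4 h5 h6
    have h7 := h2 (R (σ y) (ξ (δ (σ y))))
    have h8 := h3 (R (σ y) (ξ (δ (σ y))))
    rw [h1, h4] at h7 h8
    rw [h1] at h6
    rw [h7, h8, h5.1, h5.2, h6]
    exact ⟨rfl, rfl⟩
  · have h1 : SmoothNear (fun g => fderiv ℝ δ g (R₂ g (ξ (η g)))) g₀ :=
      hδ.fderiv.clm_apply (hR₂.clm_apply (hξ.comp hη))
    have h2 : ∀ᶠ g in 𝓝 g₀, fderiv ℝ p (δ g) (fderiv ℝ δ g (R₂ g (ξ (η g)))) = 0 := by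
      filter_upwards [hP, hR₂', hη.continuousAt.eventually hξ0] with g h3 h4 h5
      rw [← h3, h4, h5]
    obtain ⟨c, hc, hc'⟩ := h.maps_along hp hs hδ rfl h1 h2
    refine ⟨fun i y => c i (σ y), fun i => (hc i).comp_of_eq hσ hσ0, ?_⟩
    filter_upwards [hσ', hσt.eventually hQ, hσt.eventually hR₂', hσt.eventually hc',
      hσt.eventually hqq] with y h3 h4 h5 h6 h7
    rw [← h4, h5, h3] at h6
    rw [h3] at h7
    rw [h6, h7]

variable {E₁ E₂ F₀ F₁ F₂ : Type} [NormedAddCommGroup E₁] [NormedSpace ℝ E₁]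
  [FiniteDimensional ℝ E₁] [NormedAddCommGroup E₂] [NormedSpace ℝ E₂] [FiniteDimensional ℝ E₂]
  [NormedAddCommGroup F₀] [NormedSpace ℝ F₀] [FiniteDimensional ℝ F₀]
  [NormedAddCommGroup F₁] [NormedSpace ℝ F₁] [FiniteDimensional ℝ F₁]
  [NormedAddCommGroup F₂] [NormedSpace ℝ F₂]

/-- The condition for a fibre product `G` of `E₁` and `E₂`. -/
theorem fiberProduct {p₁ : E₁ → F₀} {q₁ : E₁ → F₁} {p₂ : E₂ → F₁} {q₂ : E₂ → F₂} {n₁ n₂ : ℕ}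
    {X₁ : Fin n₁ → F₁ → F₁} {X₂ : Fin n₂ → F₂ → F₂} {m₁ : G → E₁} {m₂ : G → E₂} {g₀ : G}
    (h₁ : KerImage p₁ q₁ X₁ (m₁ g₀)) (h₂ : KerImage p₂ q₂ X₂ (m₂ g₀))
    (h₂' : KerImage q₂ p₂ X₁ (m₂ g₀)) (hm₁ : SmoothNear m₁ g₀) (hm₂ : SmoothNear m₂ g₀)
    (hp₁ : SmoothNear p₁ (m₁ g₀)) (hq₁ : SmoothNear q₁ (m₁ g₀)) (hp₂ : SmoothNear p₂ (m₂ g₀))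
    (hq₂ : SmoothNear q₂ (m₂ g₀)) (hs₁ : Function.Surjective (fderiv ℝ p₁ (m₁ g₀)))
    (hs₂ : Function.Surjective (fderiv ℝ p₂ (m₂ g₀)))
    (hqp : ∀ᶠ g in 𝓝 g₀, q₁ (m₁ g) = p₂ (m₂ g))
    (hlift : ∀ (η₁ : G → E₁) (η₂ : G → E₂), SmoothNear η₁ g₀ → SmoothNear η₂ g₀ →
      (∀ᶠ g in 𝓝 g₀, fderiv ℝ q₁ (m₁ g) (η₁ g) = fderiv ℝ p₂ (m₂ g) (η₂ g)) →
      ∃ ζ : G → G, SmoothNear ζ g₀ ∧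
        ∀ᶠ g in 𝓝 g₀, fderiv ℝ m₁ g (ζ g) = η₁ g ∧ fderiv ℝ m₂ g (ζ g) = η₂ g) :
    KerImage (fun g => p₁ (m₁ g)) (fun g => q₂ (m₂ g)) X₂ g₀ := by
  have hP := fderiv_comp_eventually hm₁ hp₁
  have hQ := fderiv_comp_eventually hm₂ hq₂
  have hQP := fderiv_comp_eventuallyEq hm₁ hq₁ hm₂ hp₂ hqp
  refine ⟨fun i => ?_, fun ζ hζ hζ0 => ?_⟩
  · obtain ⟨ξ, hξ, hξ'⟩ := h₂.lift i
    -- The field `ξ` is tangent to the fibres of `p₂`, so it moves the second factor while the first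
    -- stays fixed.
    obtain ⟨ζ, hζ, hζ'⟩ := hlift (fun _ => 0) (fun g => ξ (m₂ g)) (.const 0) (hξ.comp hm₂) (by
      filter_upwards [hm₂.continuousAt.eventually hξ'] with g hg
      rw [map_zero, hg.1])
    refine ⟨ζ, hζ, ?_⟩
    filter_upwards [hP, hQ, hζ', hm₂.continuousAt.eventually hξ'] with g h3 h4 h5 h6
    rw [h3, h4, h5.1, h5.2, map_zero]
    exact ⟨rfl, h6.2⟩
  · obtain ⟨c, hc, hc'⟩ := h₁.maps_along hp₁ hs₁ hm₁ rfl (hm₁.fderiv.clm_apply hζ) (by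
      filter_upwards [hP, hζ0] with g h3 h4
      rw [← h3, h4])
    choose ξ hξ hξ' using h₂'.lift
    -- The first component of `ζ` lies in `ker Tp₁`, so the common image in `F₁` is a combination of
    -- the `X₁`. Subtracting lifts of the `X₁` tangent to the fibres of `q₂` brings the second
    -- component into `ker Tp₂` without changing its image under `Tq₂`.
    have h3 : SmoothNear (fun g => fderiv ℝ m₂ g (ζ g) - ∑ i, c i g • ξ i (m₂ g)) g₀ :=
      (hm₂.fderiv.clm_apply hζ).sub (.sum _ fun i _ => (hc i).smul ((hξ i).comp hm₂))
    have hξ'' := hm₂.continuousAt.eventually (Filter.eventually_all.2 hξ')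
    obtain ⟨d, hd, hd'⟩ := h₂.maps_along hp₂ hs₂ hm₂ rfl h3 (by
      filter_upwards [hQP, hc', hξ'', hqp] with g h4 h5 h6 h7
      rw [map_sub, ← h4, h5, map_sum, sub_eq_zero]
      simp only [map_smul, (h6 _).2, h7])
    refine ⟨d, hd, ?_⟩
    filter_upwards [hQ, hd', hξ''] with g h4 h5 h6
    rw [h4, ← h5, map_sub, map_sum]
    simp only [map_smul, (h6 _).1, smul_zero, Finset.sum_const_zero, sub_zero]

end KerImage

/-! ### The exponential of an involutive family in Euclidean coordinates. -/

section PathHolonomyEuclidean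

open Set

variable {F : Type} [NormedAddCommGroup F] [NormedSpace ℝ F]

local notation "𝕀" => Icc (0 : ℝ) 1

/-- The linear combination `∑ tᵢ Xᵢ x`. -/
def fieldComb {n : ℕ} (X : Fin n → F → F) (z : F × EuclideanSpace ℝ (Fin n)) : F :=
  ∑ i, z.2 i • X i z.1

section

variable {n : ℕ} {X : Fin n → F → F} {x₀ : F}

theorem smoothNear_coord {G : Type*} [NormedAddCommGroup G] [NormedSpace ℝ G]
    {f : G → EuclideanSpace ℝ (Fin n)} {g : G} (hf : SmoothNear f g) (i : Fin n) :
    SmoothNear (fun y => f y i) g :=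
  hf.clm (EuclideanSpace.proj i)

theorem smoothNear_fieldComb (hX : ∀ i, SmoothNear (X i) x₀) (t : EuclideanSpace ℝ (Fin n)) :
    SmoothNear (fieldComb X) (x₀, t) :=
  .sum _ fun i _ => (smoothNear_coord (SmoothNear.id.snd) i).smul
    ((hX i).comp (f := Prod.fst) (SmoothNear.id.fst))

theorem fieldComb_zero (x : F) : fieldComb X (x, 0) = 0 := by
  simp [fieldComb]

/-- `fieldComb X (x, ·)` as a linear map. -/
noncomputable def fieldCombL (X : Fin n → F → F) (x : F) : EuclideanSpace ℝ (Fin n) →L[ℝ] F :=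
  ∑ i, (EuclideanSpace.proj i : EuclideanSpace ℝ (Fin n) →L[ℝ] ℝ).smulRight (X i x)

theorem fieldCombL_apply (x : F) (t : EuclideanSpace ℝ (Fin n)) :
    fieldCombL X x t = fieldComb X (x, t) := by
  simp [fieldCombL, fieldComb]

theorem fderiv_fieldComb {x : F} (hX : ∀ i, DifferentiableAt ℝ (X i) x)
    (t : EuclideanSpace ℝ (Fin n)) (h : F) (τ : EuclideanSpace ℝ (Fin n)) :
    fderiv ℝ (fieldComb X) (x, t) (h, τ) =
      ∑ i, t i • fderiv ℝ (X i) x h + fieldComb X (x, τ) := by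
  have h1 : ∀ i, HasFDerivAt (fun z : F × EuclideanSpace ℝ (Fin n) => z.2 i • X i z.1)
      (t i • (fderiv ℝ (X i) x ∘L .fst ℝ F _) +
        ((EuclideanSpace.proj i : EuclideanSpace ℝ (Fin n) →L[ℝ] ℝ) ∘L
          .snd ℝ F _).smulRight (X i x)) (x, t) := fun i =>
    HasFDerivAt.smul (c := fun z : F × EuclideanSpace ℝ (Fin n) => z.2 i)
      (f := fun z : F × EuclideanSpace ℝ (Fin n) => X i z.1)
      ((EuclideanSpace.proj i : EuclideanSpace ℝ (Fin n) →L[ℝ] ℝ).hasFDerivAt.comp (x, t)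
        hasFDerivAt_snd)
      ((hX i).hasFDerivAt.comp (x, t) hasFDerivAt_fst)
  have h2 : HasFDerivAt (fieldComb X) _ (x, t) := HasFDerivAt.fun_sum fun i _ => h1 i
  rw [h2.fderiv]
  simp [fieldComb, Finset.sum_add_distrib]

end

/-- Here `D j` is the derivative of `X j` and `C` are the structure functions. The identity says
that, when the coefficients `r` evolve by `r' = τ - ∑ t r C`, the difference between the variation
`h` of the flow and `∑ rⱼ Xⱼ` obeys a homogeneous linear equation. -/
theorem variation_identity {n : ℕ} (D : Fin n → F →L[ℝ] F) (X : Fin n → F) (t r τ : Fin n → ℝ)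
    (C : Fin n → Fin n → Fin n → ℝ) (h : F) (hD : ∀ k j, D j (X k) = D k (X j) + ∑ l, C k j l • X l) :
    ∑ i, t i • D i h + ∑ i, τ i • X i - ∑ j, (r j • D j (∑ k, t k • X k) +
      (τ j - ∑ k, ∑ i, t k * r i * C k i j) • X j) = ∑ i, t i • D i (h - ∑ j, r j • X j) := by
  have h1 : ∑ j, r j • D j (∑ k, t k • X k) =
      ∑ k, t k • D k (∑ j, r j • X j) + ∑ j, (∑ k, ∑ i, t k * r i * C k i j) • X j := by
    simp only [map_sum, map_smul, Finset.smul_sum, Finset.sum_smul]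
    rw [Finset.sum_comm]
    rw [Finset.sum_congr rfl fun j _ => Finset.sum_congr rfl fun k _ => by rw [hD j k]]
    simp only [smul_add, Finset.smul_sum, Finset.sum_add_distrib, smul_smul, mul_comm (r _) (t _)]
    congr 1
    rw [Finset.sum_congr rfl fun k _ => Finset.sum_comm, Finset.sum_comm]
    refine Finset.sum_congr rfl fun l _ => Finset.sum_congr rfl fun k _ =>
      Finset.sum_congr rfl fun j _ => ?_
    congr 1
    ring
  simp only [Finset.sum_add_distrib, sub_smul, Finset.sum_sub_distrib, h1, map_sub, smul_sub]
  abel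

variable [FiniteDimensional ℝ F] {n : ℕ} {X : Fin n → F → F} {x₀ : F}

/-- The map `q (x, t) = exp (∑ tᵢ Xᵢ) x` is, together with `(x, t) ↦ x`, a bi-submersion for
the foliation generated by the involutive family `X`. -/
theorem exists_exp_kerImage (hX : ∀ i, SmoothNear (X i) x₀)
    {c : Fin n → Fin n → Fin n → F → ℝ} (hc : ∀ k i j, SmoothNear (c k i j) x₀)
    (hbr : ∀ᶠ x in 𝓝 x₀, ∀ k i,
      VectorField.lieBracket ℝ (X k) (X i) x = ∑ j, c k i j x • X j x)
    {S : Set F} (hS : S ∈ 𝓝 x₀) :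
    ∃ Φ : ℝ → F × EuclideanSpace ℝ (Fin n) → F, ∀ᶠ z in 𝓝 (x₀, 0),
      Φ 0 z = z.1 ∧
      (∀ s ∈ 𝕀, Φ s z ∈ S ∧ HasDerivWithinAt (fun s => Φ s z) (fieldComb X (Φ s z, z.2)) 𝕀 s) ∧
      ContDiffAt ℝ ∞ (Φ 1) z ∧ Function.Surjective (fderiv ℝ (Φ 1) z) ∧
      KerImage Prod.fst (Φ 1) X z ∧ KerImage (Φ 1) Prod.fst X z := by
  have hV := smoothNear_fieldComb hX 0
  obtain ⟨K, S₁, hS₁, hK⟩ := hV.exists_lipschitzOnWith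
  have hgood : ∀ᶠ x in 𝓝 x₀, (∀ i, ContDiffAt ℝ ∞ (X i) x) ∧ ∀ k i,
      VectorField.lieBracket ℝ (X k) (X i) x = ∑ j, c k i j x • X j x :=
    (Filter.eventually_all.2 hX).and hbr
  -- Curves confined to `S₂` stay where solutions are unique, the fields are smooth and the bracket
  -- relations hold.
  let S₂ : Set (F × EuclideanSpace ℝ (Fin n)) := S₁ ∩ Prod.fst ⁻¹' ({x | (∀ i, ContDiffAt ℝ ∞ (X i) x) ∧ ∀ k i,
      VectorField.lieBracket ℝ (X k) (X i) x = ∑ j, c k i j x • X j x} ∩ S)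
  have hS₂ : S₂ ∈ 𝓝 (x₀, (0 : EuclideanSpace ℝ (Fin n))) :=
    Filter.inter_mem hS₁ (continuous_fst.continuousAt.preimage_mem_nhds
      (Filter.inter_mem hgood hS))
  obtain ⟨Φ, hΦ, hΦ0⟩ := exists_flow hV (.of_forall fun x => fieldComb_zero x) hS₂
  -- The state is `(x, ρ)` and the parameter is `(t, τ)`. The point `x` flows along `∑ tᵢ Xᵢ`, and
  -- `ρ` holds the coefficients of the variation of the flow with initial value `∑ ρⱼ Xⱼ` and
  -- parameter direction `τ`.
  let VV : (F × EuclideanSpace ℝ (Fin n)) ×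
      (EuclideanSpace ℝ (Fin n) × EuclideanSpace ℝ (Fin n)) →
      F × EuclideanSpace ℝ (Fin n) := fun z =>
    (fieldComb X (z.1.1, z.2.1),
      z.2.2 - WithLp.toLp 2 fun l => ∑ k, ∑ j, z.2.1 k * z.1.2 j * c k j l z.1.1)
  have hVV : SmoothNear VV ((x₀, 0), (0, 0)) := by
    have h1 : SmoothNear (fun z : (F × EuclideanSpace ℝ (Fin n)) ×
      (EuclideanSpace ℝ (Fin n) × EuclideanSpace ℝ (Fin n)) => (z.1.1, z.2.1))
        ((x₀, 0), (0, 0)) := SmoothNear.id.fst.fst.prodMk SmoothNear.id.snd.fst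
    have h2 : SmoothNear (fun z : (F × EuclideanSpace ℝ (Fin n)) ×
      (EuclideanSpace ℝ (Fin n) × EuclideanSpace ℝ (Fin n)) => fun l => ∑ k, ∑ j,
        z.2.1 k * z.1.2 j * c k j l z.1.1) ((x₀, 0), (0, 0)) :=
      .pi fun l => .sum _ fun k _ => .sum _ fun j _ =>
        ((smoothNear_coord SmoothNear.id.snd.fst k).mul
          (smoothNear_coord SmoothNear.id.fst.snd j)).mul
            ((hc k j l).comp (f := fun z : (F × EuclideanSpace ℝ (Fin n)) ×
      (EuclideanSpace ℝ (Fin n) × EuclideanSpace ℝ (Fin n)) => z.1.1) SmoothNear.id.fst.fst)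
    exact (hV.comp_of_eq h1 rfl).prodMk (SmoothNear.id.snd.snd.sub
      (h2.clm (PiLp.continuousLinearEquiv 2 ℝ (fun _ : Fin n => ℝ)).symm.toContinuousLinearMap))
  have hVV0 : ∀ y : F × EuclideanSpace ℝ (Fin n), VV (y, (0, 0)) = 0 := by
    intro y
    refine Prod.ext (fieldComb_zero _) ?_
    ext l
    simp [VV]
  have hSS : {w : (F × EuclideanSpace ℝ (Fin n)) ×
      (EuclideanSpace ℝ (Fin n) × EuclideanSpace ℝ (Fin n)) | (w.1.1, w.2.1) ∈ S₂} ∈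
      𝓝 (((x₀, 0), (0, 0)) : (F × EuclideanSpace ℝ (Fin n)) ×
      (EuclideanSpace ℝ (Fin n) × EuclideanSpace ℝ (Fin n))) := by
    have h1 : Continuous fun w : (F × EuclideanSpace ℝ (Fin n)) ×
      (EuclideanSpace ℝ (Fin n) × EuclideanSpace ℝ (Fin n)) => (w.1.1, w.2.1) := by fun_prop
    exact h1.continuousAt.preimage_mem_nhds hS₂
  obtain ⟨Ψ, hΨ, -⟩ := exists_flow hVV (.of_forall hVV0) hSS
  have hpr : Continuous fun w : (F × EuclideanSpace ℝ (Fin n)) ×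
      (EuclideanSpace ℝ (Fin n) × EuclideanSpace ℝ (Fin n)) => (w.1.1, w.2.1) := by fun_prop
  -- the derivative of the flow preserves the family `X`
  have hmain : ∀ᶠ w in 𝓝 (((x₀, 0), (0, 0)) : (F × EuclideanSpace ℝ (Fin n)) ×
      (EuclideanSpace ℝ (Fin n) × EuclideanSpace ℝ (Fin n))),
      fderiv ℝ (Φ 1) (w.1.1, w.2.1) (fieldComb X (w.1.1, w.1.2), w.2.2) =
        fieldComb X (Φ 1 (w.1.1, w.2.1), (Ψ 1 w).2) := by
    filter_upwards [hΨ, (hpr.tendsto' ((x₀, 0), (0, 0)) (x₀, 0) rfl).eventually hΦ] with w hw1 hw2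
    obtain ⟨⟨x, ρ₀⟩, ⟨t, τ⟩⟩ := w
    obtain ⟨-, ha0, -, ha, -⟩ := hw1
    obtain ⟨-, hb0, hb1, hb, hb2⟩ := hw2
    dsimp only at ha0 ha hb0 hb hb1 hb2 ⊢
    -- The first component of the extended flow solves the original equation, so uniqueness
    -- identifies it with `Φ`.
    have hfst : ∀ s ∈ 𝕀, (Ψ s ((x, ρ₀), (t, τ))).1 = Φ s (x, t) := by
      refine eqOn_of_lipschitzOnWith hK (lam := t) (α := fun s => (Ψ s ((x, ρ₀), (t, τ))).1)
        (fun s hs => ⟨(ha s hs).1.1, ?_⟩) (fun s hs => ⟨(hb s hs).1.1, (hb s hs).2⟩) ?_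
      · exact (ContinuousLinearMap.fst ℝ F (EuclideanSpace ℝ (Fin n))).hasFDerivAt.comp_hasDerivWithinAt
          s (ha s hs).2
      · simp only [ha0, hb0]
    let x' : ℝ → F := fun s => Φ s (x, t)
    let ρ : ℝ → EuclideanSpace ℝ (Fin n) := fun s => (Ψ s ((x, ρ₀), (t, τ))).2
    have hρ : ∀ j, ∀ s ∈ 𝕀, HasDerivWithinAt (fun s => ρ s j)
        (τ j - ∑ k, ∑ i, t k * ρ s i * c k i j (x' s)) 𝕀 s := by
      intro j s hs
      have h1 := ((EuclideanSpace.proj j : EuclideanSpace ℝ (Fin n) →L[ℝ] ℝ) ∘L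
        ContinuousLinearMap.snd ℝ F (EuclideanSpace ℝ (Fin n))).hasFDerivAt.comp_hasDerivWithinAt
          s (ha s hs).2
      have h2 := hfst s hs
      simp only [VV, h2] at h1
      exact h1
    have hx'S : ∀ s ∈ 𝕀, (∀ i, ContDiffAt ℝ ∞ (X i) (x' s)) ∧ ∀ k i,
        VectorField.lieBracket ℝ (X k) (X i) (x' s) = ∑ j, c k i j (x' s) • X j (x' s) :=
      fun s hs => (hb s hs).1.2.1
    have hXd : ∀ s ∈ 𝕀, ∀ i, DifferentiableAt ℝ (X i) (x' s) := fun s hs i =>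
      ((hx'S s hs).1 i).differentiableAt (by simp)
    let v := fieldComb X (x, ρ₀)
    let h : ℝ → F := fun s => fderiv ℝ (Φ s) (x, t) (v, τ)
    -- The remainder starts at zero and satisfies `R' = A R` by `variation_identity`, hence
    -- vanishes.
    let R : ℝ → F := fun s => h s - ∑ j, ρ s j • X j (x' s)
    let A : ℝ → F →L[ℝ] F := fun s => ∑ i, t i • fderiv ℝ (X i) (x' s)
    have hx'c : ContinuousOn x' 𝕀 := fun s hs => (hb s hs).2.continuousWithinAt
    have hA : ContinuousOn A 𝕀 := by
      refine continuousOn_finsetSum _ fun i _ => ContinuousOn.const_smul ?_ (t i)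
      intro s hs
      exact (((hx'S s hs).1 i).fderiv_right (m := ∞) (by simp)).continuousAt.comp_continuousWithinAt
        (hx'c s hs)
    have hR : ∀ s ∈ 𝕀, HasDerivWithinAt R (A s (R s)) 𝕀 s := by
      intro s hs
      have h1 := hb2 (v, τ) s hs
      rw [fderiv_fieldComb (hXd s hs)] at h1
      have h2 : ∀ j, HasDerivWithinAt (fun s => ρ s j • X j (x' s)) _ 𝕀 s := fun j =>
        (hρ j s hs).smul ((hXd s hs j).hasFDerivAt.comp_hasDerivWithinAt s (hb s hs).2)
      have h3 := h1.sub (HasDerivWithinAt.fun_sum fun j (_ : j ∈ Finset.univ) => h2 j)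
      refine h3.congr_deriv ?_
      have h5 : ∀ k j, fderiv ℝ (X j) (x' s) (X k (x' s)) =
          fderiv ℝ (X k) (x' s) (X j (x' s)) + ∑ l, c k j l (x' s) • X l (x' s) := by
        intro k j
        rw [← (hx'S s hs).2 k j, VectorField.lieBracket]
        abel
      simpa [A, R, fieldComb, x'] using variation_identity (fun i => fderiv ℝ (X i) (x' s))
        (fun i => X i (x' s)) t (ρ s) τ (fun k i j => c k i j (x' s)) (h s) h5
    have hR0 : R 0 = 0 := by
      simp only [R, h, x', ρ, hb1, ha0, hb0, v, fieldComb, sub_self]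
    have h1 := eq_zero_of_linear_ode hA hR hR0 1 ⟨zero_le_one, le_rfl⟩
    exact sub_eq_zero.1 h1
  let T := EuclideanSpace ℝ (Fin n)
  let ι : F × T →L[ℝ] (F × T) × (T × T) :=
    ((ContinuousLinearMap.fst ℝ F T).prod 0).prod ((ContinuousLinearMap.snd ℝ F T).prod 0)
  let J : T × T →L[ℝ] (F × T) × (T × T) :=
    ((0 : T × T →L[ℝ] F).prod (.fst ℝ T T)).prod ((0 : T × T →L[ℝ] T).prod (.snd ℝ T T))
  have hι : Filter.Tendsto ι (𝓝 (x₀, 0)) (𝓝 ((x₀, 0), (0, 0))) :=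
    ι.continuous.tendsto' _ _ rfl
  have hΨs : SmoothNear (Ψ 1) ((x₀, 0), (0, 0)) :=
    hΨ.mono fun z hz => hz.1 1 ⟨zero_le_one, le_rfl⟩
  have hΦs : SmoothNear (Φ 1) (x₀, (0 : T)) :=
    hΦ.mono fun z hz => hz.1 1 ⟨zero_le_one, le_rfl⟩
  -- `hmain` holds only for small `u = (ρ₀, τ)`, with coefficients that are not manifestly linear in
  -- `u`. Its left side is linear in `u`, so differentiating at `u = 0` gives linear coefficients `N
  -- z`, valid for all `u`.
  let N : F × T → T × T →L[ℝ] T := fun z => .snd ℝ F T ∘L fderiv ℝ (Ψ 1) (ι z) ∘L J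
  have hN : SmoothNear N (x₀, 0) :=
    (SmoothNear.const _).clm_comp ((hΨs.fderiv.comp_of_eq ι.contDiff.smoothNear rfl).clm_comp
      (.const J))
  have hNid : ∀ᶠ z in 𝓝 (x₀, (0 : T)), ∀ u : T × T,
      fderiv ℝ (Φ 1) z (fieldComb X (z.1, u.1), u.2) = fieldComb X (Φ 1 z, N z u) := by
    filter_upwards [hι.eventually hmain.eventually_nhds,
      hι.eventually hΨs.eventually_differentiableAt] with z hz hz2 u
    let L : T × T →L[ℝ] F :=
      fderiv ℝ (Φ 1) z ∘L ((fieldCombL X z.1 ∘L .fst ℝ T T).prod (.snd ℝ T T))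
    have h1 : Filter.Tendsto (fun u : T × T => ι z + J u) (𝓝 0) (𝓝 (ι z)) :=
      (continuous_const.add J.continuous).tendsto' _ _ (by simp)
    have h2 : (fun u => L u) =ᶠ[𝓝 0] fun u => fieldCombL X (Φ 1 z) (Ψ 1 (ι z + J u)).2 := by
      filter_upwards [h1.eventually hz] with u hu
      have h3 : ι z + J u = ((z.1, u.1), (z.2, u.2)) := by
        simp [ι, J]
      rw [h3] at hu ⊢
      simpa [L, fieldCombL_apply] using hu
    have h4 : HasFDerivAt (fun u => Ψ 1 (ι z + J u)) (fderiv ℝ (Ψ 1) (ι z) ∘L J) 0 := by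
      refine HasFDerivAt.comp (g := Ψ 1) (f := fun u => ι z + J u) 0 ?_ (J.hasFDerivAt.const_add _)
      simpa using hz2.hasFDerivAt
    have h5 := (fieldCombL X (Φ 1 z)).hasFDerivAt.comp (0 : T × T) (h4.snd)
    have h6 := (L.hasFDerivAt (x := 0)).unique (h5.congr_of_eventuallyEq h2)
    have h7 := congrArg (fun L => L u) h6
    simpa [L, N, fieldCombL_apply] using h7
  -- For `t = 0` the coefficient equation is `ρ' = τ`, so `ρ 1 = ρ₀ + τ`. Both blocks of `N` are the
  -- identity at the base point and therefore invertible nearby.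
  have hbase : ∀ u : T × T, N (x₀, 0) u = u.1 + u.2 := by
    intro u
    have hm : (1 : ℝ) ∈ 𝕀 := ⟨zero_le_one, le_rfl⟩
    have h1 : ∀ᶠ w in 𝓝 (((x₀, 0), (0, 0)) : (F × T) × (T × T)), w.2.1 = 0 →
        (Ψ 1 w).2 = w.1.2 + w.2.2 := by
      filter_upwards [hΨ] with w hw hw0
      obtain ⟨⟨x, ρ₀⟩, ⟨t, τ⟩⟩ := w
      dsimp only at hw0
      subst hw0
      obtain ⟨-, ha0, -, ha, -⟩ := hw
      have h2 := eq_zero_of_linear_ode (A := fun _ => (0 : T →L[ℝ] T))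
        (R := fun s => (Ψ s ((x, ρ₀), (0, τ))).2 - ρ₀ - s • τ) (a := 0) (b := 1)
        continuousOn_const (fun s hs => ?_) ?_ 1 hm
      · rw [one_smul, sub_sub, sub_eq_zero] at h2
        exact h2
      · have h3 := (ContinuousLinearMap.snd ℝ F T).hasFDerivAt.comp_hasDerivWithinAt s (ha s hs).2
        have h4 := (h3.sub_const ρ₀).sub ((hasDerivWithinAt_id s 𝕀).smul_const τ)
        refine h4.congr_deriv ?_
        ext l
        simp [VV]
      · simp [ha0]
    have h2 : Filter.Tendsto (fun u : T × T => ι (x₀, 0) + J u) (𝓝 0) (𝓝 ((x₀, 0), (0, 0))) :=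
      (continuous_const.add J.continuous).tendsto' _ _ (by simp [ι])
    have h3 : (fun u => (Ψ 1 (ι (x₀, 0) + J u)).2) =ᶠ[𝓝 0] fun u : T × T => u.1 + u.2 := by
      filter_upwards [h2.eventually h1] with u hu
      simpa [ι, J] using hu
    have h4 : HasFDerivAt (fun u => Ψ 1 (ι (x₀, 0) + J u)) (fderiv ℝ (Ψ 1) (ι (x₀, 0)) ∘L J) 0 := by
      refine HasFDerivAt.comp (g := Ψ 1) (f := fun u => ι (x₀, 0) + J u) 0 ?_
        (J.hasFDerivAt.const_add _)
      have h5 := (hΨs.contDiffAt.differentiableAt (by simp)).hasFDerivAt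
      simpa [ι] using h5
    have h5 := h4.snd.unique ((hasFDerivAt_fst.add hasFDerivAt_snd).congr_of_eventuallyEq h3)
    exact congrArg (fun L => L u) h5
  have hid : Filter.Tendsto (fun x : F => (x, (0 : T))) (𝓝 x₀) (𝓝 (x₀, 0)) :=
    (continuous_id.prodMk continuous_const).tendsto' _ _ rfl
  -- the derivatives of the flow in the two directions, in terms of `X`
  let A : F × T → T →L[ℝ] T := fun z => N z ∘L .inr ℝ T T
  let B : F × T → T →L[ℝ] T := fun z => N z ∘L .inl ℝ T T
  have hAs : SmoothNear A (x₀, 0) := hN.clm_comp (.const _)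
  have hBs : SmoothNear B (x₀, 0) := hN.clm_comp (.const _)
  have hA1 : A (x₀, 0) = .id ℝ T := by
    ext1 τ
    simp [A, hbase]
  have hB1 : B (x₀, 0) = .id ℝ T := by
    ext1 τ
    simp [B, hbase]
  have : CompleteSpace F := FiniteDimensional.complete ℝ F
  obtain ⟨hA', hAi⟩ := hAs.inverse (by rw [hA1]; exact ⟨.refl ℝ T, rfl⟩)
  obtain ⟨hB', hBi⟩ := hBs.inverse (by rw [hB1]; exact ⟨.refl ℝ T, rfl⟩)
  have hDs : SmoothNear (fun z => fderiv ℝ (Φ 1) z ∘L .inl ℝ F T) (x₀, (0 : T)) :=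
    hΦs.fderiv.clm_comp (.const _)
  have hD1 : fderiv ℝ (Φ 1) (x₀, 0) ∘L .inl ℝ F T = .id ℝ F := by
    have h1 : HasFDerivAt (fun x => Φ 1 (x, (0 : T))) (fderiv ℝ (Φ 1) (x₀, 0) ∘L .inl ℝ F T) x₀ :=
      (hΦs.contDiffAt.differentiableAt (by simp)).hasFDerivAt.comp x₀ (hasFDerivAt_prodMk_left x₀ 0)
    refine h1.unique ((hasFDerivAt_id x₀).congr_of_eventuallyEq ?_)
    filter_upwards [hΦ0] with x hx using hx 1 ⟨zero_le_one, le_rfl⟩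
  obtain ⟨-, hDi⟩ := hDs.inverse (by rw [hD1]; exact ⟨.refl ℝ F, rfl⟩)
  have hAz : ∀ᶠ z in 𝓝 (x₀, (0 : T)), ∀ τ : T, fderiv ℝ (Φ 1) z (0, τ) = fieldComb X (Φ 1 z, A z τ) := by
    filter_upwards [hNid] with z hz τ
    have h1 := hz (0, τ)
    rw [fieldComb_zero] at h1
    exact h1
  have hBz : ∀ᶠ z in 𝓝 (x₀, (0 : T)), ∀ ρ : T,
      fderiv ℝ (Φ 1) z (fieldComb X (z.1, ρ), 0) = fieldComb X (Φ 1 z, B z ρ) := by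
    filter_upwards [hNid] with z hz ρ
    exact hz (ρ, 0)
  have hXn : ∀ᶠ z in 𝓝 (x₀, (0 : T)), ∀ i, SmoothNear (X i) z.1 :=
    (continuous_fst.tendsto' (x₀, (0 : T)) x₀ rfl).eventually
      (Filter.eventually_all.2 fun i => (hX i).eventually_smoothNear)
  have hsingle : ∀ i (y : F), fieldComb X (y, EuclideanSpace.single i 1) = X i y := by
    intro i y
    simp [fieldComb, Finset.sum_ite_eq']
  refine ⟨Φ, ?_⟩
  filter_upwards [hΦ, hΦs.eventually_smoothNear, hA'.eventually_smoothNear, hB'.eventually_smoothNear,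
    hAs.eventually_smoothNear, hBs.eventually_smoothNear,
    hAi.eventually_nhds, hBi.eventually_nhds, hDi.eventually_nhds,
    hAz.eventually_nhds, hBz.eventually_nhds, hXn] with z hz1 hz2 hz3 hz4 hz5 hz6 hz7 hz8 hz9 hz10 hz11 hz12
  have hfst : ∀ z v : F × EuclideanSpace ℝ (Fin n), fderiv ℝ Prod.fst z v = v.1 := by
    intro z v
    rw [fderiv_fst]
    rfl
  refine ⟨hz1.2.1, fun s hs => ⟨(hz1.2.2.2.1 s hs).1.2.2, (hz1.2.2.2.1 s hs).2⟩,
    hz2.contDiffAt, ?_, ⟨fun i => ?_, fun ξ hξ hξ0 => ?_⟩, ⟨fun i => ?_, fun ξ hξ hξ0 => ?_⟩⟩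
  · intro v
    refine ⟨((fderiv ℝ (Φ 1) z ∘L .inl ℝ F T).inverse v, 0), ?_⟩
    exact congrArg (fun L => L v) hz9.self_of_nhds.self_comp_inverse
  · refine ⟨fun z => (0, (A z).inverse (EuclideanSpace.single i 1)),
      (SmoothNear.const 0).prodMk (hz3.clm_apply (.const _)), ?_⟩
    filter_upwards [hz7, hz10] with z h1 h2
    refine ⟨hfst _ _, ?_⟩
    rw [h2, show A z ((A z).inverse (EuclideanSpace.single i 1)) = EuclideanSpace.single i 1 from
      congrArg (fun L => L (EuclideanSpace.single i 1)) h1.self_comp_inverse, hsingle]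
  · refine ⟨fun i z => A z (ξ z).2 i, fun i => smoothNear_coord (hz5.clm_apply hξ.snd) i, ?_⟩
    filter_upwards [hξ0, hz10] with z h1 h2
    have h3 : (ξ z).1 = 0 := (hfst _ _).symm.trans h1
    rw [show ξ z = (0, (ξ z).2) from Prod.ext h3 rfl, h2]
    rfl
  -- The change of the endpoint caused by moving `x` along `X i` is cancelled by a change of `t`: by
  -- `hAz` and `hBz` both contributions are combinations of the fields at the endpoint.
  · refine ⟨fun z => (X i z.1, -(A z).inverse (B z (EuclideanSpace.single i 1))),
      ((hz12 i).comp (f := Prod.fst) SmoothNear.id.fst).prodMk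
        (hz3.clm_apply (hz6.clm_apply (.const _))).neg, ?_⟩
    filter_upwards [hz7, hz10, hz11] with z h1 h2 h3
    refine ⟨?_, hfst _ _⟩
    have h4 := h3 (EuclideanSpace.single i 1)
    have h5 := h2 (-(A z).inverse (B z (EuclideanSpace.single i 1)))
    rw [hsingle] at h4
    rw [map_neg, show A z ((A z).inverse (B z (EuclideanSpace.single i 1))) =
      B z (EuclideanSpace.single i 1) from
      congrArg (fun L => L (B z (EuclideanSpace.single i 1))) h1.self_comp_inverse,
      ← fieldCombL_apply, map_neg, fieldCombL_apply] at h5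
    rw [show ((X i z.1, -(A z).inverse (B z (EuclideanSpace.single i 1))) : F × T) =
      (X i z.1, 0) + (0, -(A z).inverse (B z (EuclideanSpace.single i 1))) by simp, map_add, h4, h5,
      add_neg_cancel]
  -- The combination of the `X i` with these coefficients has the same effect on the endpoint as the
  -- first component of `ξ`. They are equal because the derivative of `Φ 1` in the space direction
  -- is injective.
  · refine ⟨fun i z => (-(B z).inverse (A z (ξ z).2)) i,
      fun i => smoothNear_coord (hz4.clm_apply (hz5.clm_apply hξ.snd)).neg i, ?_⟩
    filter_upwards [hξ0, hz8, hz9, hz10, hz11] with z h1 h2 h3 h4 h5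
    have h6 : fderiv ℝ (Φ 1) z ((ξ z).1 - fieldComb X (z.1, -(B z).inverse (A z (ξ z).2)), 0) = 0 := by
      rw [show (((ξ z).1 - fieldComb X (z.1, -(B z).inverse (A z (ξ z).2)), 0) : F × T) =
        ξ z - ((0, (ξ z).2) + (fieldComb X (z.1, -(B z).inverse (A z (ξ z).2)), 0)) by
          ext <;> simp, map_sub, h1, map_add, h4, h5, map_neg,
        show B z ((B z).inverse (A z (ξ z).2)) = A z (ξ z).2 from
          congrArg (fun L => L (A z (ξ z).2)) h2.self_comp_inverse, ← fieldCombL_apply,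
        ← fieldCombL_apply, map_neg]
      simp
    have h7 : (ξ z).1 - fieldComb X (z.1, -(B z).inverse (A z (ξ z).2)) = 0 := by
      have h8 := congrArg (fun L => L ((ξ z).1 - fieldComb X (z.1, -(B z).inverse (A z (ξ z).2))))
        h3.inverse_comp_self
      have h9 : (fderiv ℝ (Φ 1) z ∘L .inl ℝ F T)
          ((ξ z).1 - fieldComb X (z.1, -(B z).inverse (A z (ξ z).2))) = 0 := h6
      simp only [ContinuousLinearMap.comp_apply] at h8 h9
      rw [h9, map_zero] at h8
      exact h8.symm
    rw [hfst]
    exact sub_eq_zero.1 h7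

end PathHolonomyEuclidean

noncomputable section

/-! ### Vector fields and maps read in charts. -/

section Coordinates

variable {E E' : Type} [NormedAddCommGroup E] [NormedSpace ℝ E]
  [NormedAddCommGroup E'] [NormedSpace ℝ E']
  {V W : Type u} [TopologicalSpace V] [ChartedSpace E V] [TopologicalSpace W] [ChartedSpace E' W]

/-- The differential at `v` of the chart around `v₀`. -/
def tanChart (v₀ v : V) : TangentSpace 𝓘(ℝ, E) v →L[ℝ] E :=
  mfderiv 𝓘(ℝ, E) 𝓘(ℝ, E) (chartAt E v₀) v

/-- The differential at the image of `v` of the inverse of the chart around `v₀`. -/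
def tanChartSymm (v₀ v : V) : E →L[ℝ] TangentSpace 𝓘(ℝ, E) v :=
  mfderiv 𝓘(ℝ, E) 𝓘(ℝ, E) (chartAt E v₀).symm (chartAt E v₀ v)

/-- The vector field `X` in the chart around `v₀`. -/
def localField (v₀ : V) (X : VField E V) (u : E) : E :=
  tanChart v₀ ((chartAt E v₀).symm u) (X ((chartAt E v₀).symm u))

/-- The vector field with the coordinates `ξ` in the chart around `v₀`. -/
def globalField (v₀ : V) (ξ : E → E) : VField E V :=
  fun v => tanChartSymm v₀ v (ξ (chartAt E v₀ v))

variable (E E') in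
/-- The map `f` in the charts around `v₀` and `w₀`. -/
def localMap (v₀ : V) (w₀ : W) (f : V → W) (u : E) : E' :=
  chartAt E' w₀ (f ((chartAt E v₀).symm u))

theorem localField_chart {v₀ v : V} (hv : v ∈ (chartAt E v₀).source) (X : VField E V) :
    localField v₀ X (chartAt E v₀ v) = tanChart v₀ v (X v) := by
  rw [localField, (chartAt E v₀).left_inv hv]

theorem localMap_chart {v₀ v : V} (hv : v ∈ (chartAt E v₀).source) (w₀ : W) (f : V → W) :
    localMap E E' v₀ w₀ f (chartAt E v₀ v) = chartAt E' w₀ (f v) := by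
  rw [localMap, (chartAt E v₀).left_inv hv]

theorem eventually_symm_chart {v₀ v : V} (hv : v ∈ (chartAt E v₀).source) {P : V → Prop}
    (h : ∀ᶠ v in 𝓝 v, P v) :
    ∀ᶠ u in 𝓝 (chartAt E v₀ v), u ∈ (chartAt E v₀).target ∧ P ((chartAt E v₀).symm u) := by
  have h1 := (chartAt E v₀).map_source hv
  have h2 := (chartAt E v₀).symm.continuousAt h1
  rw [ContinuousAt, (chartAt E v₀).left_inv hv] at h2
  exact (Filter.eventually_mem_set.2 ((chartAt E v₀).open_target.mem_nhds h1)).and (h2.eventually h)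

theorem eventually_chart {v₀ v : V} (hv : v ∈ (chartAt E v₀).source) {P : E → Prop}
    (h : ∀ᶠ u in 𝓝 (chartAt E v₀ v), P u) :
    ∀ᶠ v in 𝓝 v, v ∈ (chartAt E v₀).source ∧ P (chartAt E v₀ v) :=
  (Filter.eventually_mem_set.2 ((chartAt E v₀).open_source.mem_nhds hv)).and
    (((chartAt E v₀).continuousAt hv).eventually h)

variable [IsManifold 𝓘(ℝ, E) ∞ V]

theorem isManifold_one : IsManifold 𝓘(ℝ, E) 1 V :=
  IsManifold.of_le (n := ∞) (by simp)

theorem tanChart_symm {v₀ v : V} (hv : v ∈ (chartAt E v₀).source) (e : E) :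
    tanChart v₀ v (tanChartSymm v₀ v e) = e := by
  have := isManifold_one (E := E) (V := V)
  have h := (mdifferentiable_chart (I := 𝓘(ℝ, E)) v₀).comp_symm_deriv
    ((chartAt E v₀).map_source hv)
  rw [(chartAt E v₀).left_inv hv] at h
  exact congrArg (fun L => L e) h

theorem tanChartSymm_apply {v₀ v : V} (hv : v ∈ (chartAt E v₀).source)
    (e : TangentSpace 𝓘(ℝ, E) v) : tanChartSymm v₀ v (tanChart v₀ v e) = e := by
  have := isManifold_one (E := E) (V := V)
  have h := (mdifferentiable_chart (I := 𝓘(ℝ, E)) v₀).symm_comp_deriv hv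
  exact congrArg (fun L => L e) h

theorem tanChart_injective {v₀ v : V} (hv : v ∈ (chartAt E v₀).source) :
    Function.Injective (tanChart (E := E) v₀ v) :=
  Function.LeftInverse.injective (tanChartSymm_apply hv)

theorem tanChart_globalField {v₀ v : V} (hv : v ∈ (chartAt E v₀).source) (ξ : E → E) :
    tanChart v₀ v (globalField v₀ ξ v) = ξ (chartAt E v₀ v) :=
  tanChart_symm hv _

theorem contMDiffAt_chart_of_mem {v₀ v : V} (hv : v ∈ (chartAt E v₀).source) :
    ContMDiffAt 𝓘(ℝ, E) 𝓘(ℝ, E) ∞ (chartAt E v₀) v :=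
  contMDiffOn_chart.contMDiffAt ((chartAt E v₀).open_source.mem_nhds hv)

theorem contMDiffAt_chart_symm_of_mem {v₀ : V} {u : E} (hu : u ∈ (chartAt E v₀).target) :
    ContMDiffAt 𝓘(ℝ, E) 𝓘(ℝ, E) ∞ (chartAt E v₀).symm u :=
  contMDiffOn_chart_symm.contMDiffAt ((chartAt E v₀).open_target.mem_nhds hu)

section

variable [IsManifold 𝓘(ℝ, E') ∞ W]

theorem smoothNear_localMap {v₀ v : V} {w₀ : W} {f : V → W}
    (hf : ∀ᶠ v in 𝓝 v, ContMDiffAt 𝓘(ℝ, E) 𝓘(ℝ, E') ∞ f v) (hv : v ∈ (chartAt E v₀).source)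
    (hw : f v ∈ (chartAt E' w₀).source) : SmoothNear (localMap E E' v₀ w₀ f) (chartAt E v₀ v) := by
  have h1 : ∀ᶠ v in 𝓝 v, f v ∈ (chartAt E' w₀).source :=
    hf.self_of_nhds.continuousAt.eventually ((chartAt E' w₀).open_source.mem_nhds hw)
  filter_upwards [eventually_symm_chart hv (hf.and h1)] with u hu
  rw [← contMDiffAt_iff_contDiffAt]
  exact (contMDiffAt_chart_of_mem hu.2.2).comp u
    (ContMDiffAt.comp (g := f) u hu.2.1 (contMDiffAt_chart_symm_of_mem hu.1))

theorem fderiv_localMap {v₀ v : V} {w₀ : W} {f : V → W}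
    (hf : ContMDiffAt 𝓘(ℝ, E) 𝓘(ℝ, E') ∞ f v) (hv : v ∈ (chartAt E v₀).source)
    (hw : f v ∈ (chartAt E' w₀).source) (ξ : TangentSpace 𝓘(ℝ, E) v) :
    fderiv ℝ (localMap E E' v₀ w₀ f) (chartAt E v₀ v) (tanChart v₀ v ξ) =
      tanChart w₀ (f v) (mfderiv 𝓘(ℝ, E) 𝓘(ℝ, E') f v ξ) := by
  have := isManifold_one (E := E) (V := V)
  have := isManifold_one (E := E') (V := W)
  have h1 := ((mdifferentiable_chart (I := 𝓘(ℝ, E)) v₀).mdifferentiableAt hv).hasMFDerivAt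
  have h2 := ((mdifferentiable_chart (I := 𝓘(ℝ, E')) w₀).mdifferentiableAt hw).hasMFDerivAt
  have h3 := (hf.mdifferentiableAt (by simp)).hasMFDerivAt
  have h4 := h2.comp v h3
  have h5 : DifferentiableAt ℝ (localMap E E' v₀ w₀ f) (chartAt E v₀ v) := by
    have h6 : ContMDiffAt 𝓘(ℝ, E) 𝓘(ℝ, E') ∞ (localMap E E' v₀ w₀ f)
        (chartAt E v₀ v) := by
      refine ContMDiffAt.comp (I' := 𝓘(ℝ, E')) (g := chartAt E' w₀) _ ?_ (ContMDiffAt.comp (I' := 𝓘(ℝ, E)) (g := f) _ ?_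
        (contMDiffAt_chart_symm_of_mem ((chartAt E v₀).map_source hv)))
      · rw [(chartAt E v₀).left_inv hv]
        exact contMDiffAt_chart_of_mem hw
      · rw [(chartAt E v₀).left_inv hv]
        exact hf
    exact (contMDiffAt_iff_contDiffAt.1 h6).differentiableAt (by simp)
  have h6 := h5.hasFDerivAt.hasMFDerivAt.comp v h1
  have h7 : (localMap E E' v₀ w₀ f) ∘ (chartAt E v₀) =ᶠ[𝓝 v] (chartAt E' w₀) ∘ f := by
    filter_upwards [(chartAt E v₀).open_source.mem_nhds hv] with v' hv'
    exact localMap_chart (E' := E') hv' w₀ f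
  have h8 := hasMFDerivAt_unique (h6.congr_of_eventuallyEq h7.symm) h4
  exact congrArg (fun L => L ξ) h8

end

theorem inverse_tanChart {v₀ v : V} (hv : v ∈ (chartAt E v₀).source) :
    (tanChart (E := E) v₀ v).inverse = tanChartSymm v₀ v :=
  ContinuousLinearMap.inverse_eq (ContinuousLinearMap.ext fun e => tanChart_symm hv e)
    (ContinuousLinearMap.ext fun e => tanChartSymm_apply hv e)

theorem inverse_tanChartSymm {v₀ v : V} (hv : v ∈ (chartAt E v₀).source) :
    (tanChartSymm (E := E) v₀ v).inverse = tanChart v₀ v :=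
  ContinuousLinearMap.inverse_eq (ContinuousLinearMap.ext fun e => tanChartSymm_apply hv e)
    (ContinuousLinearMap.ext fun e => tanChart_symm hv e)

theorem isInvertible_tanChart {v₀ v : V} (hv : v ∈ (chartAt E v₀).source) :
    (tanChart (E := E) v₀ v).IsInvertible :=
  .of_inverse (g := tanChartSymm v₀ v) (ContinuousLinearMap.ext fun e => tanChart_symm hv e)
    (ContinuousLinearMap.ext fun e => tanChartSymm_apply hv e)

theorem isInvertible_tanChartSymm {v₀ v : V} (hv : v ∈ (chartAt E v₀).source) :
    (tanChartSymm (E := E) v₀ v).IsInvertible :=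
  .of_inverse (g := tanChart v₀ v) (ContinuousLinearMap.ext fun e => tanChartSymm_apply hv e)
    (ContinuousLinearMap.ext fun e => tanChart_symm hv e)

/-- This identification gives access to the smoothness of pulled back fields and to the naturality
of the Lie bracket. -/
theorem localField_eq_mpullback {v₀ : V} {u : E} (hu : u ∈ (chartAt E v₀).target)
    (X : VField E V) :
    localField v₀ X u =
      VectorField.mpullback 𝓘(ℝ, E) 𝓘(ℝ, E) (chartAt E v₀).symm X u := by
  rw [VectorField.mpullback_apply, localField]
  have h := inverse_tanChartSymm ((chartAt E v₀).map_target hu)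
  rw [tanChartSymm, (chartAt E v₀).right_inv hu] at h
  exact congrArg (fun L => L (X ((chartAt E v₀).symm u))) h.symm

variable [FiniteDimensional ℝ E]

theorem smoothNear_localField {v₀ v : V} {X : VField E V} {U : Opens V} (hX : SmoothField E U X)
    (hU : v ∈ U) (hv : v ∈ (chartAt E v₀).source) :
    SmoothNear (localField v₀ X) (chartAt E v₀ v) := by
  have := isManifold_one (E := E) (V := V)
  have : CompleteSpace E := FiniteDimensional.complete ℝ E
  filter_upwards [eventually_symm_chart hv (U.isOpen.mem_nhds hU)] with u hu
  have h1 := (hX.contMDiffAt (U.isOpen.mem_nhds hu.2)).mpullback_vectorField_preimage (n := ∞)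
    (contMDiffAt_chart_symm_of_mem hu.1) (by
      have h := isInvertible_tanChartSymm ((chartAt E v₀).map_target hu.1)
      rwa [tanChartSymm, (chartAt E v₀).right_inv hu.1] at h) (by simp)
  have h2 := contMDiffWithinAt_vectorSpace_iff_contDiffWithinAt.1
    (h1.contMDiffWithinAt (s := Set.univ))
  refine (contDiffWithinAt_univ.1 h2).congr_of_eventuallyEq ?_
  filter_upwards [(chartAt E v₀).open_target.mem_nhds hu.1] with u' hu'
  exact localField_eq_mpullback hu' X

theorem contMDiffAt_globalField {v₀ v : V} {ξ : E → E} (hξ : ContDiffAt ℝ ∞ ξ (chartAt E v₀ v))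
    (hv : v ∈ (chartAt E v₀).source) :
    ContMDiffAt 𝓘(ℝ, E) 𝓘(ℝ, E).tangent ∞
      (fun x => (⟨x, globalField v₀ ξ x⟩ : TangentBundle 𝓘(ℝ, E) V)) v := by
  have := isManifold_one (E := E) (V := V)
  have : CompleteSpace E := FiniteDimensional.complete ℝ E
  have h0 : ContMDiffWithinAt 𝓘(ℝ, E) 𝓘(ℝ, E).tangent ∞
      (fun x => (⟨x, ξ x⟩ : TangentBundle 𝓘(ℝ, E) E)) Set.univ (chartAt E v₀ v) :=
    (contMDiffWithinAt_vectorSpace_iff_contDiffWithinAt (V := ξ)).2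
      (ContDiffAt.contDiffWithinAt (f := ξ) hξ)
  have h1 := ContMDiffAt.mpullback_vectorField_preimage (n := ∞) (V := ξ)
    (I := 𝓘(ℝ, E)) (I' := 𝓘(ℝ, E)) (f := chartAt E v₀) (x₀ := v)
    (contMDiffWithinAt_univ.1 h0)
    (contMDiffAt_chart_of_mem hv) (isInvertible_tanChart (E := E) hv) (by simp)
  refine h1.congr_of_eventuallyEq ?_
  filter_upwards [(chartAt E v₀).open_source.mem_nhds hv] with v' hv'
  have h2 := congrArg (fun L => L (ξ (chartAt E v₀ v'))) (inverse_tanChart hv')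
  exact congrArg (Bundle.TotalSpace.mk v') h2.symm

theorem smoothField_globalField {v₀ v : V} {ξ : E → E} (hξ : SmoothNear ξ (chartAt E v₀ v))
    (hv : v ∈ (chartAt E v₀).source) :
    ∃ U : Opens V, v ∈ U ∧ SmoothField E U (globalField v₀ ξ) := by
  obtain ⟨S, hS, hSo, hvS⟩ := eventually_nhds_iff.1 (eventually_chart hv hξ)
  exact ⟨⟨S, hSo⟩, hvS, fun x hx =>
    (contMDiffAt_globalField (hS x hx).2 (hS x hx).1).contMDiffWithinAt⟩

theorem two_le_smooth : minSmoothness ℝ 2 ≤ (∞ : ℕ∞ω) := by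
  rw [minSmoothness_of_isRCLikeNormedField]
  exact WithTop.coe_le_coe.2 le_top

theorem localField_mlieBracket {v₀ v : V} {X Y : VField E V} {U : Opens V}
    (hX : SmoothField E U X) (hY : SmoothField E U Y) (hU : v ∈ U)
    (hv : v ∈ (chartAt E v₀).source) :
    localField v₀ (VectorField.mlieBracket 𝓘(ℝ, E) X Y) (chartAt E v₀ v) =
      VectorField.lieBracket ℝ (localField v₀ X) (localField v₀ Y) (chartAt E v₀ v) := by
  have := isManifold_one (E := E) (V := V)
  have : CompleteSpace E := FiniteDimensional.complete ℝ E
  have : IsManifold 𝓘(ℝ, E) (minSmoothness ℝ 2) V :=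
    IsManifold.of_le (n := ∞) two_le_smooth
  have hu := (chartAt E v₀).map_source hv
  have hX' : ∀ Z : VField E V, SmoothField E U Z → MDifferentiableAt 𝓘(ℝ, E) 𝓘(ℝ, E).tangent
      (fun x => (⟨x, Z x⟩ : TangentBundle 𝓘(ℝ, E) V)) ((chartAt E v₀).symm (chartAt E v₀ v)) := by
    intro Z hZ
    rw [(chartAt E v₀).left_inv hv]
    exact (hZ.contMDiffAt (U.isOpen.mem_nhds hU)).mdifferentiableAt (by simp)
  rw [localField_eq_mpullback hu, VectorField.mpullback_mlieBracket (n := ∞) (hX' X hX) (hX' Y hY)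
    (contMDiffAt_chart_symm_of_mem hu) two_le_smooth,
    ← VectorField.mlieBracketWithin_univ, VectorField.mlieBracketWithin_eq_lieBracketWithin]
  have h : ∀ Z : VField E V, VectorField.mpullback 𝓘(ℝ, E) 𝓘(ℝ, E) (chartAt E v₀).symm Z
      =ᶠ[𝓝 (chartAt E v₀ v)] localField v₀ Z := by
    intro Z
    filter_upwards [(chartAt E v₀).open_target.mem_nhds hu] with u' hu'
    exact (localField_eq_mpullback hu' Z).symm
  refine Eq.trans (congrFun (VectorField.lieBracketWithin_univ (𝕜 := ℝ)) _) ?_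
  exact Filter.EventuallyEq.lieBracket_vectorField_eq (h X) (h Y)

end Coordinates

end

noncomputable section

/-- The Euclidean space of dimension `m`. -/
abbrev Euc (m : ℕ) : Type := EuclideanSpace ℝ (Fin m)

theorem exists_opens_of_eventually {V : Type*} [TopologicalSpace V] {w : V} {P : V → Prop}
    (h : ∀ᶠ v in 𝓝 w, P v) : ∃ U : Opens V, w ∈ U ∧ ∀ v ∈ U, P v := by
  obtain ⟨S, hS, hSo, hw⟩ := eventually_nhds_iff.1 h
  exact ⟨⟨S, hSo⟩, hw, hS⟩

theorem TopologicalSpace.Opens.eventually_mem {V : Type*} [TopologicalSpace V] {w : V}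
    {U : Opens V} (h : w ∈ U) : ∀ᶠ v in 𝓝 w, v ∈ U :=
  U.isOpen.mem_nhds h

section Coordinates

variable {E E' : Type} [NormedAddCommGroup E] [NormedSpace ℝ E]
  [NormedAddCommGroup E'] [NormedSpace ℝ E']
  {V W : Type u} [TopologicalSpace V] [ChartedSpace E V] [TopologicalSpace W] [ChartedSpace E' W]
  [IsManifold 𝓘(ℝ, E) ∞ V] [IsManifold 𝓘(ℝ, E') ∞ W]

/-- The differential of the chart at `f v` is injective, so the equation may be tested after
applying it. This is the dictionary between the conditions on `M` and those of `KerImage`. -/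
theorem mfderiv_eq_sum_iff {ι : Type*} [Fintype ι] {v₀ v : V} {w₀ : W} {f : V → W}
    (hf : ContMDiffAt 𝓘(ℝ, E) 𝓘(ℝ, E') ∞ f v) (hv : v ∈ (chartAt E v₀).source)
    (hw : f v ∈ (chartAt E' w₀).source) (ξ : TangentSpace 𝓘(ℝ, E) v) (c : ι → ℝ)
    (X : ι → VField E' W) :
    mfderiv 𝓘(ℝ, E) 𝓘(ℝ, E') f v ξ = ∑ i, c i • X i (f v) ↔
      fderiv ℝ (localMap E E' v₀ w₀ f) (chartAt E v₀ v) (tanChart v₀ v ξ) =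
        ∑ i, c i • localField w₀ (X i) (localMap E E' v₀ w₀ f (chartAt E v₀ v)) := by
  rw [fderiv_localMap hf hv hw, localMap_chart (E' := E') hv, ← (tanChart_injective hw).eq_iff,
    map_sum]
  simp only [map_smul, localField_chart hw]

theorem mfderiv_eq_iff {v₀ v : V} {w₀ : W} {f : V → W}
    (hf : ContMDiffAt 𝓘(ℝ, E) 𝓘(ℝ, E') ∞ f v) (hv : v ∈ (chartAt E v₀).source)
    (hw : f v ∈ (chartAt E' w₀).source) (ξ : TangentSpace 𝓘(ℝ, E) v) (X : VField E' W) :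
    mfderiv 𝓘(ℝ, E) 𝓘(ℝ, E') f v ξ = X (f v) ↔
      fderiv ℝ (localMap E E' v₀ w₀ f) (chartAt E v₀ v) (tanChart v₀ v ξ) =
        localField w₀ X (localMap E E' v₀ w₀ f (chartAt E v₀ v)) := by
  simpa using mfderiv_eq_sum_iff hf hv hw ξ (fun _ : Unit => 1) fun _ => X

theorem mfderiv_eq_zero_iff {v₀ v : V} {w₀ : W} {f : V → W}
    (hf : ContMDiffAt 𝓘(ℝ, E) 𝓘(ℝ, E') ∞ f v) (hv : v ∈ (chartAt E v₀).source)
    (hw : f v ∈ (chartAt E' w₀).source) (ξ : TangentSpace 𝓘(ℝ, E) v) :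
    mfderiv 𝓘(ℝ, E) 𝓘(ℝ, E') f v ξ = 0 ↔
      fderiv ℝ (localMap E E' v₀ w₀ f) (chartAt E v₀ v) (tanChart v₀ v ξ) = 0 := by
  simpa using mfderiv_eq_sum_iff hf hv hw ξ (fun _ : Empty => 1) fun _ _ => 0

theorem smoothNear_localFun {v₀ v : V} {U : Opens V} {f : V → ℝ} (hf : SmoothFun E U f)
    (hU : v ∈ U) (hv : v ∈ (chartAt E v₀).source) :
    SmoothNear (fun u => f ((chartAt E v₀).symm u)) (chartAt E v₀ v) := by
  filter_upwards [eventually_symm_chart hv (U.isOpen.mem_nhds hU)] with u hu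
  rw [← contMDiffAt_iff_contDiffAt]
  exact ContMDiffAt.comp (g := f) u (hf.contMDiffAt (U.isOpen.mem_nhds hu.2))
    (contMDiffAt_chart_symm_of_mem hu.1)

theorem eventually_contMDiffAt_chart {F : Type*} [NormedAddCommGroup F] [NormedSpace ℝ F]
    {v₀ v : V} {g : E → F} (hg : SmoothNear g (chartAt E v₀ v))
    (hv : v ∈ (chartAt E v₀).source) :
    ∀ᶠ v in 𝓝 v, ContMDiffAt 𝓘(ℝ, E) 𝓘(ℝ, F) ∞ (fun v => g (chartAt E v₀ v)) v := by
  filter_upwards [eventually_chart hv hg] with v' hv'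
  exact ContMDiffAt.comp (g := g) v' (contMDiffAt_iff_contDiffAt.2 hv'.2)
    (contMDiffAt_chart_of_mem hv'.1)

theorem surjective_fderiv_localMap {v₀ v : V} {w₀ : W} {f : V → W}
    (hf : IsSmoothSubmersion E E' f) (hv : v ∈ (chartAt E v₀).source)
    (hw : f v ∈ (chartAt E' w₀).source) :
    Function.Surjective (fderiv ℝ (localMap E E' v₀ w₀ f) (chartAt E v₀ v)) := by
  intro e
  obtain ⟨ξ, hξ⟩ := hf.2 v (tanChartSymm w₀ (f v) e)
  refine ⟨tanChart v₀ v ξ, ?_⟩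
  rw [fderiv_localMap (hf.1 v) hv hw, hξ, tanChart_symm hw]

theorem eventually_of_chart {v₀ v : V} (hv : v ∈ (chartAt E v₀).source) {P : E → Prop}
    (h : ∀ᶠ v in 𝓝 v, v ∈ (chartAt E v₀).source → P (chartAt E v₀ v)) :
    ∀ᶠ u in 𝓝 (chartAt E v₀ v), P u := by
  filter_upwards [eventually_symm_chart hv h] with u hu
  simpa only [(chartAt E v₀).right_inv hu.1] using hu.2 ((chartAt E v₀).map_target hu.1)

variable [FiniteDimensional ℝ E]

theorem smoothField_iff {U : Opens V} {Z : VField E V} :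
    SmoothField E U Z ↔ ∀ v ∈ U, SmoothNear (localField v Z) (chartAt E v v) := by
  refine ⟨fun h v hv => smoothNear_localField h hv (mem_chart_source E v), fun h v hv => ?_⟩
  refine ContMDiffAt.contMDiffWithinAt ?_
  refine (contMDiffAt_globalField (h v hv).contDiffAt (mem_chart_source E v)).congr_of_eventuallyEq ?_
  filter_upwards [(chartAt E v).open_source.mem_nhds (mem_chart_source E v)] with v' hv'
  refine congrArg (Bundle.TotalSpace.mk v') ?_
  rw [globalField, localField_chart hv', tanChartSymm_apply hv']

end Coordinates

/-! ### Equivalence of the bi-submersion condition and its form in charts. -/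

section Bisubmersion

variable {E : Type} [NormedAddCommGroup E] [NormedSpace ℝ E]
  {V : Type u} [TopologicalSpace V] [ChartedSpace E V]
  {m : ℕ} {M : Type u} [TopologicalSpace M]
  [ChartedSpace (Euc m) M]

variable (E) in
/-- In charts, `Tq` maps `ker Tp` onto the combinations of the vector fields `X i` near `v`. -/
def ChartKerImage (p q : V → M) {n : ℕ} (X : Fin n → VField (Euc m) M)
    (v : V) : Prop :=
  KerImage (localMap E (Euc m) v (p v) p) (localMap E (Euc m) v (q v) q) (fun i => localField (q v) (X i))
    (chartAt E v v)

/-- The points of `V` near `w` at which the charts around `w` and `f w` are defined. -/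
theorem eventually_mem_charts {f : V → M} (hf : Continuous f) (w : V) :
    ∀ᶠ v in 𝓝 w, v ∈ (chartAt E w).source ∧
      f v ∈ (chartAt (Euc m) (f w)).source :=
  (Filter.eventually_mem_set.2 ((chartAt E w).open_source.mem_nhds (mem_chart_source E w))).and
    (hf.continuousAt.eventually ((chartAt _ (f w)).open_source.mem_nhds (mem_chart_source _ _)))

theorem kerSumSec_comm [IsManifold 𝓘(ℝ, E) ∞ V] (p q : V → M) (U : Opens V) :
    kerSumSec (m := m) E p q U = kerSumSec (m := m) E q p U := by
  have h : ∀ p q : V → M, kerSumSec (m := m) E p q U ⊆ kerSumSec (m := m) E q p U := by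
    intro p q Z hZ w hw
    obtain ⟨U', h1, h2, ξ, hξ, ζ, hζ, h3⟩ := hZ w hw
    exact ⟨U', h1, h2, ζ, hζ, ξ, hξ, fun y hy => by rw [h3 y hy, add_comm]⟩
  exact (h p q).antisymm (h q p)

variable [IsManifold (𝓡 m) ∞ M]

theorem Span.IsBiSubmersion.inv {F : SingularFoliation m M} {W : Span m M}
    (h : W.IsBiSubmersion F) : W.inv.IsBiSubmersion F := fun U =>
  ⟨(h U).1.symm, (h U).1.symm.trans ((h U).2.trans (kerSumSec_comm _ _ _))⟩

variable {F : SingularFoliation m M}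

variable [IsManifold 𝓘(ℝ, E) ∞ V]

/-- The coefficients of an element of the pull-back with respect to generators. -/
theorem pullback_eq_sum {q : V → M} (hq : IsSmoothSubmersion E (Euc m) q)
    {O : Opens M} {n : ℕ} {X : Fin n → VField (Euc m) M}
    (hX : F.Generates O X) {U : Opens V} {Z : VField E V} (hZ : Z ∈ F.pullback E q U) {w : V}
    (hw : w ∈ U) (hwO : q w ∈ O) :
    ∃ (U' : Opens V) (c : Fin n → V → ℝ), w ∈ U' ∧ U' ≤ U ∧ (∀ i, SmoothFun E U' (c i)) ∧
      ∀ y ∈ U', q y ∈ O ∧ mfderiv 𝓘(ℝ, E) (𝓡 m) q y (Z y) = ∑ i, c i y • X i (q y) := by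
  obtain ⟨U', O', hwU', hU', hO', k, Y, f, hY, hf, h⟩ := hZ.2 w hw
  have hYO : ∀ j, ∃ g : Fin n → M → ℝ,
      (∀ i, SmoothFun (Euc m) (O ⊓ O') (g i)) ∧
      ∀ y ∈ O ⊓ O', Y j y = ∑ i, g i y • X i y := fun j =>
    hX.2 _ inf_le_left _ (F.restrict _ _ inf_le_right _ (hY j))
  choose g hg hg' using hYO
  let U'' : Opens V := U' ⊓ ⟨q ⁻¹' O, O.isOpen.preimage hq.1.continuous⟩
  have hU'' : ∀ y ∈ U'', q y ∈ O ⊓ O' := fun y hy => ⟨hy.2, hO' y hy.1⟩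
  refine ⟨U'', fun i y => ∑ j, f j y * g j i (q y), ⟨hwU', hwO⟩, inf_le_left.trans hU', ?_, ?_⟩
  · intro i
    have h2 : ∀ j, ContMDiffOn 𝓘(ℝ, E) 𝓘(ℝ, ℝ) ∞ (fun y => f j y * g j i (q y)) U'' := by
      intro j
      have h1 : ContMDiffOn 𝓘(ℝ, E) 𝓘(ℝ, ℝ) ∞ (fun y => g j i (q y)) U'' :=
        ContMDiffOn.comp (hg j i) hq.1.contMDiffOn hU''
      exact ((hf j).mono fun y hy => hy.1).mul h1
    exact contMDiffOn_finsetSum fun j _ => h2 j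
  · intro y hy
    refine ⟨hy.2, ?_⟩
    rw [h y hy.1]
    simp only [hg' _ _ (hU'' y hy), Finset.smul_sum, Finset.sum_smul, smul_smul]
    exact Finset.sum_comm

theorem mem_pullback_of_eq_sum {q : V → M} (hq : IsSmoothSubmersion E (Euc m) q)
    {U : Opens V} {Z : VField E V} (hZ : SmoothField E U Z)
    (h : ∀ w ∈ U, ∃ (O : Opens M) (n : ℕ) (X : Fin n → VField (Euc m) M)
      (c : Fin n → V → ℝ), q w ∈ O ∧ (∀ i, X i ∈ F.sec O) ∧
      (∀ i, ∀ᶠ y in 𝓝 w, ContMDiffAt 𝓘(ℝ, E) 𝓘(ℝ, ℝ) ∞ (c i) y) ∧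
      ∀ᶠ y in 𝓝 w, mfderiv 𝓘(ℝ, E) (𝓡 m) q y (Z y) = ∑ i, c i y • X i (q y)) :
    Z ∈ F.pullback E q U := by
  refine ⟨hZ, fun w hw => ?_⟩
  obtain ⟨O, n, X, c, hwO, hX, hc, hZc⟩ := h w hw
  obtain ⟨U', hwU', hU'⟩ := exists_opens_of_eventually (((U.eventually_mem hw).and
    (hq.1.continuous.continuousAt.eventually (O.eventually_mem hwO))).and
    ((Filter.eventually_all.2 hc).and hZc))
  exact ⟨U', O, hwU', fun y hy => (hU' y hy).1.1, fun y hy => (hU' y hy).1.2, n, X, c, hX,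
    fun i y hy => ((hU' y hy).2.1 i).contMDiffWithinAt, fun y hy => (hU' y hy).2.2⟩

variable [FiniteDimensional ℝ E]

theorem IsSmoothSubmersion.smoothNear_localMap {f : V → M} (hf : IsSmoothSubmersion E (Euc m) f)
    (v : V) : SmoothNear (localMap E (Euc m) v (f v) f) (chartAt E v v) :=
  _root_.smoothNear_localMap (.of_forall hf.1) (mem_chart_source E v) (mem_chart_source _ _)

/-- A lift of `X i ∘ q` through `Tq` belongs to the pull-back, hence splits as `ξ + ζ` with `ξ` in
`ker Tp` and `ζ` in `ker Tq`; then `ξ` is still a lift. Conversely a section of `ker Tp` belongs to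
the sum, hence to the pull-back. -/
theorem chartKerImage_of_pullback_eq {p q : V → M} (hp : IsSmoothSubmersion E (Euc m) p)
    (hq : IsSmoothSubmersion E (Euc m) q)
    (h : ∀ U : Opens V, F.pullback E q U = kerSumSec (m := m) E p q U) {O : Opens M} {n : ℕ}
    {X : Fin n → VField (Euc m) M} (hX : F.Generates O X) {w : V} (hw : q w ∈ O) :
    ChartKerImage E p q X w := by
  have hqO : ∀ᶠ v in 𝓝 w, q v ∈ O := hq.1.continuous.continuousAt.eventually (O.eventually_mem hw)
  refine ⟨fun i => ?_, fun ξ hξ hξ0 => ?_⟩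
  · have hqs := hq.smoothNear_localMap w
    obtain ⟨R, hR, hR'⟩ := hqs.fderiv.exists_rightInverse
      (surjective_fderiv_localMap hq (mem_chart_source E w) (mem_chart_source _ _))
    have hXi : SmoothNear (localField (q w) (X i)) (localMap E (Euc m) w (q w) q (chartAt E w w)) := by
      rw [localMap_chart (E' := Euc m) (mem_chart_source E w)]
      exact smoothNear_localField (F.smooth _ _ (hX.1 i)) hw (mem_chart_source _ _)
    -- A field with `Tq ζ₀ = X i ∘ q` and no control of `Tp`.
    let ζ₀ : E → E := fun u =>
      R u (localField (q w) (X i) (localMap E (Euc m) w (q w) q u))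
    have hζ : SmoothNear ζ₀ (chartAt E w w) := hR.clm_apply (hXi.comp hqs)
    obtain ⟨U₁, hwU₁, hU₁⟩ := smoothField_globalField hζ (mem_chart_source E w)
    obtain ⟨U₂, hwU₂, hU₂⟩ := exists_opens_of_eventually ((eventually_mem_charts (m := m) (E := E)
      hq.1.continuous w).and (hqO.and (eventually_chart (mem_chart_source E w) hR')))
    have hZ : ∀ y ∈ U₂, mfderiv 𝓘(ℝ, E) (𝓡 m) q y (globalField w ζ₀ y) = X i (q y) := by
      intro y hy
      refine (mfderiv_eq_iff (hq.1 y) (hU₂ y hy).1.1 (hU₂ y hy).1.2 _ (X i)).2 ?_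
      rw [tanChart_globalField (hU₂ y hy).1.1]
      exact (hU₂ y hy).2.2.2 _
    have hmem : globalField w ζ₀ ∈ F.pullback E q (U₁ ⊓ U₂) :=
      mem_pullback_of_eq_sum hq (hU₁.mono fun y hy => hy.1) fun y hy =>
        ⟨O, 1, fun _ => X i, fun _ _ => 1, (hU₂ y hy.2).2.1, fun _ => hX.1 i,
          fun _ => .of_forall fun _ => contMDiffAt_const, by
            filter_upwards [U₂.eventually_mem hy.2] with y' hy'
            rw [hZ y' hy']
            simp⟩
    rw [h] at hmem
    obtain ⟨U', hwU', hU', ξ, hξ, ζ, hζ', hsum⟩ := hmem w ⟨hwU₁, hwU₂⟩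
    refine ⟨localField w ξ, smoothNear_localField hξ.1 hwU' (mem_chart_source E w),
      eventually_of_chart (mem_chart_source E w) ?_⟩
    filter_upwards [eventually_mem_charts (m := m) (E := E) hp.1.continuous w,
      eventually_mem_charts (m := m) (E := E) hq.1.continuous w, U'.eventually_mem hwU'] with y h1 h2 h3 hy
    rw [localField_chart hy]
    refine ⟨(mfderiv_eq_zero_iff (hp.1 y) hy h1.2 _).1 (hξ.2 y h3),
      (mfderiv_eq_iff (hq.1 y) hy h2.2 _ (X i)).1 ?_⟩
    have h4 := hZ y (hU' h3).2
    rw [hsum y h3, map_add, hζ'.2 y h3, add_zero] at h4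
    exact h4
  · obtain ⟨U₁, hwU₁, hU₁⟩ := smoothField_globalField hξ (mem_chart_source E w)
    obtain ⟨U₂, hwU₂, hU₂⟩ := exists_opens_of_eventually ((eventually_mem_charts (m := m) (E := E)
      hp.1.continuous w).and (eventually_chart (mem_chart_source E w) hξ0))
    have hmem : globalField w ξ ∈ F.pullback E q (U₁ ⊓ U₂) := by
      rw [h]
      refine fun y hy => ⟨U₁ ⊓ U₂, hy, le_rfl, globalField w ξ, ⟨hU₁.mono fun y hy => hy.1,
        fun z hz => ?_⟩, 0, ⟨?_, fun z hz => map_zero _⟩, fun z hz => (add_zero _).symm⟩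
      · refine (mfderiv_eq_zero_iff (hp.1 z) (hU₂ z hz.2).1.1 (hU₂ z hz.2).1.2 _).2 ?_
        rw [tanChart_globalField (hU₂ z hz.2).1.1]
        exact (hU₂ z hz.2).2.2
      · refine smoothField_iff.2 fun v hv => (SmoothNear.const (0 : E)).congr ?_
        exact .of_forall fun u => map_zero (tanChart v _)
    obtain ⟨U', c, hwU', hU', hc, hsum⟩ := pullback_eq_sum hq hX hmem ⟨hwU₁, hwU₂⟩ hw
    refine ⟨fun i u => c i ((chartAt E w).symm u), fun i =>
      smoothNear_localFun (hc i) hwU' (mem_chart_source E w),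
      eventually_of_chart (mem_chart_source E w) ?_⟩
    filter_upwards [eventually_mem_charts (m := m) (E := E) hq.1.continuous w, U'.eventually_mem hwU']
      with y h1 h2 hy
    have h3 := (mfderiv_eq_sum_iff (hq.1 y) hy h1.2 _ (fun i => c i y) X).1 (hsum y h2).2
    rw [tanChart_globalField hy] at h3
    simpa only [(chartAt E w).left_inv hy] using h3

/-- If `Tq Z = ∑ cᵢ Xᵢ ∘ q`, then `∑ cᵢ ξᵢ`, with `ξᵢ` the lifts in `ker Tp`, has the same image,
and the difference lies in `ker Tq`. In the other direction only the `ker Tp` part contributes to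
`Tq Z`, and `maps` applies to it. -/
theorem pullback_eq_of_chartKerImage {p q : V → M} (hp : IsSmoothSubmersion E (Euc m) p)
    (hq : IsSmoothSubmersion E (Euc m) q)
    (h : ∀ w : V, ∃ (O : Opens M) (n : ℕ) (X : Fin n → VField (Euc m) M),
      q w ∈ O ∧ F.Generates O X ∧ ChartKerImage E p q X w) (U : Opens V) :
    F.pullback E q U = kerSumSec (m := m) E p q U := by
  refine Set.Subset.antisymm (fun Z hZ w hw => ?_) fun Z hZ => ?_
  · obtain ⟨O, n, X, hwO, hX, hK⟩ := h w
    obtain ⟨U', c, hwU', hU', hc, hsum⟩ := pullback_eq_sum hq hX hZ hw hwO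
    choose ξ hξ hξ' using hK.lift
    have hζ : SmoothNear (fun u => ∑ i, c i ((chartAt E w).symm u) • ξ i u) (chartAt E w w) :=
      .sum _ fun i _ => (smoothNear_localFun (hc i) hwU' (mem_chart_source E w)).smul (hξ i)
    have hZs : SmoothNear (localField w Z) (chartAt E w w) := smoothField_iff.1 hZ.1 w hw
    obtain ⟨U₁, hwU₁, hU₁⟩ := smoothField_globalField hζ (mem_chart_source E w)
    obtain ⟨U₂, hwU₂, hU₂⟩ := smoothField_globalField (hZs.sub hζ) (mem_chart_source E w)
    obtain ⟨U₃, hwU₃, hU₃⟩ := exists_opens_of_eventually ((eventually_mem_charts (m := m) (E := E)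
      hp.1.continuous w).and ((eventually_mem_charts (m := m) (E := E) hq.1.continuous w).and
        (eventually_chart (mem_chart_source E w) (Filter.eventually_all.2 hξ'))))
    refine ⟨U' ⊓ U₁ ⊓ U₂ ⊓ U₃, ⟨⟨⟨hwU', hwU₁⟩, hwU₂⟩, hwU₃⟩, fun y hy => hU' hy.1.1.1,
      globalField w _, ⟨hU₁.mono fun y hy => hy.1.1.2, fun y hy => ?_⟩,
      globalField w _, ⟨hU₂.mono fun y hy => hy.1.2, fun y hy => ?_⟩, fun y hy => ?_⟩
    · obtain ⟨h1, h2, h3⟩ := hU₃ y hy.2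
      refine (mfderiv_eq_zero_iff (hp.1 y) h1.1 h1.2 _).2 ?_
      rw [tanChart_globalField h1.1, map_sum]
      simp only [map_smul, (h3.2 _).1, smul_zero, Finset.sum_const_zero]
    · obtain ⟨h1, h2, h3⟩ := hU₃ y hy.2
      refine (mfderiv_eq_zero_iff (hq.1 y) h1.1 h2.2 _).2 ?_
      have h4 := (mfderiv_eq_sum_iff (hq.1 y) h1.1 h2.2 _ (fun i => c i y) X).1
        (hsum y hy.1.1.1).2
      rw [tanChart_globalField h1.1, map_sub, map_sum, localField_chart h1.1, h4, sub_eq_zero]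
      simp only [map_smul, (h3.2 _).2, (chartAt E w).left_inv h1.1]
    · obtain ⟨h1, h2, h3⟩ := hU₃ y hy.2
      refine tanChart_injective h1.1 ?_
      rw [map_add, tanChart_globalField h1.1, tanChart_globalField h1.1, localField_chart h1.1,
        add_sub_cancel]
  · have hZs : SmoothField E U Z := by
      refine smoothField_iff.2 fun w hw => ?_
      obtain ⟨U', hwU', -, ξ, hξ, ζ, hζ, hsum⟩ := hZ w hw
      refine ((smoothField_iff.1 hξ.1 w hwU').add (smoothField_iff.1 hζ.1 w hwU')).congr
        (eventually_of_chart (mem_chart_source E w) ?_)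
      filter_upwards [U'.eventually_mem hwU'] with y hy hyw
      rw [localField_chart hyw, localField_chart hyw, localField_chart hyw, hsum y hy, map_add]
    refine mem_pullback_of_eq_sum hq hZs fun w hw => ?_
    obtain ⟨O, n, X, hwO, hX, hK⟩ := h w
    obtain ⟨U', hwU', -, ξ, hξ, ζ, hζ, hsum⟩ := hZ w hw
    obtain ⟨c, hc, hc'⟩ := hK.maps (localField w ξ) (smoothField_iff.1 hξ.1 w hwU')
      (eventually_of_chart (mem_chart_source E w) (by
        filter_upwards [eventually_mem_charts (m := m) (E := E) hp.1.continuous w, U'.eventually_mem hwU']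
          with y h1 h2 hy
        rw [localField_chart hy]
        exact (mfderiv_eq_zero_iff (hp.1 y) hy h1.2 _).1 (hξ.2 y h2)))
    refine ⟨O, n, X, fun i v => c i (chartAt E w v), hwO, hX.1, fun i =>
      eventually_contMDiffAt_chart (hc i) (mem_chart_source E w), ?_⟩
    filter_upwards [eventually_mem_charts (m := m) (E := E) hq.1.continuous w, U'.eventually_mem hwU',
      eventually_chart (mem_chart_source E w) hc'] with y h1 h2 h3
    rw [hsum y h2, map_add, hζ.2 y h2, add_zero]
    refine (mfderiv_eq_sum_iff (hq.1 y) h1.1 h1.2 _ (fun i => c i (chartAt E w y)) X).2 ?_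
    rw [← localField_chart h1.1]
    exact h3.2

theorem Span.IsBiSubmersion.chartKerImage {W : Span m M} (h : W.IsBiSubmersion F) {O : Opens M}
    {n : ℕ} {X : Fin n → VField (Euc m) M} (hX : F.Generates O X) {w : W.carrier}
    (hw : W.q w ∈ O) : ChartKerImage W.model W.p W.q X w :=
  chartKerImage_of_pullback_eq W.submersion_p W.submersion_q
    (fun U => (h U).1.symm.trans (h U).2) hX hw

theorem Span.isBiSubmersion_of_chartKerImage {W : Span m M}
    (h : ∀ w : W.carrier, ∃ (O : Opens M) (n : ℕ) (X : Fin n → VField (Euc m) M),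
      W.q w ∈ O ∧ F.Generates O X ∧ ChartKerImage W.model W.p W.q X w)
    (h' : ∀ w : W.carrier, ∃ (O : Opens M) (n : ℕ) (X : Fin n → VField (Euc m) M),
      W.p w ∈ O ∧ F.Generates O X ∧ ChartKerImage W.model W.q W.p X w) :
    W.IsBiSubmersion F := by
  intro U
  have h1 := pullback_eq_of_chartKerImage W.submersion_p W.submersion_q h U
  have h2 := pullback_eq_of_chartKerImage W.submersion_q W.submersion_p h' U
  rw [kerSumSec_comm] at h2
  exact ⟨h2.trans h1.symm, h2⟩

end Bisubmersion

end

noncomputable section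

/-! ### Local equivalence of spans and composition of bi-submersions. -/

section Transfer

variable {E E' G : Type} [NormedAddCommGroup E] [NormedSpace ℝ E] [FiniteDimensional ℝ E]
  [NormedAddCommGroup E'] [NormedSpace ℝ E'] [FiniteDimensional ℝ E']
  [NormedAddCommGroup G] [NormedSpace ℝ G] [FiniteDimensional ℝ G]
  {V V' T : Type u} [TopologicalSpace V] [ChartedSpace E V] [IsManifold 𝓘(ℝ, E) ∞ V]
  [TopologicalSpace V'] [ChartedSpace E' V'] [IsManifold 𝓘(ℝ, E') ∞ V']
  [TopologicalSpace T] [ChartedSpace G T] [IsManifold 𝓘(ℝ, G) ∞ T]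
  {m : ℕ} {M : Type u} [TopologicalSpace M] [ChartedSpace (Euc m) M] [IsManifold (𝓡 m) ∞ M]

theorem eventually_localMap_comp {E₁ E₂ E₃ : Type} [NormedAddCommGroup E₁] [NormedSpace ℝ E₁]
    [NormedAddCommGroup E₂] [NormedSpace ℝ E₂] [NormedAddCommGroup E₃] [NormedSpace ℝ E₃]
    {V₁ V₂ V₃ : Type u} [TopologicalSpace V₁] [ChartedSpace E₁ V₁] [TopologicalSpace V₂]
    [ChartedSpace E₂ V₂] [TopologicalSpace V₃] [ChartedSpace E₃ V₃]
    {f : V₁ → V₂} {g : V₂ → V₃} (hf : Continuous f) (v : V₁) (w : V₃) :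
    ∀ᶠ u in 𝓝 (chartAt E₁ v v), localMap E₁ E₃ v w (fun x => g (f x)) u =
      localMap E₂ E₃ (f v) w g (localMap E₁ E₂ v (f v) f u) := by
  filter_upwards [eventually_symm_chart (mem_chart_source E₁ v)
    (hf.continuousAt.eventually ((chartAt E₂ (f v)).open_source.mem_nhds
      (mem_chart_source E₂ (f v))))] with u hu
  simp only [localMap]
  rw [(chartAt E₂ (f v)).left_inv hu.2]

theorem ChartKerImage.transfer {p q : V → M} {p' q' : V' → M} {δ : T → V} {η : T → V'} {n : ℕ}
    {X : Fin n → VField (Euc m) M} {t : T} (h : ChartKerImage E p q X (δ t))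
    (hp : IsSmoothSubmersion E (Euc m) p) (hq : IsSmoothSubmersion E (Euc m) q)
    (hp' : IsSmoothSubmersion E' (Euc m) p') (hq' : IsSmoothSubmersion E' (Euc m) q')
    (hδ : IsSmoothSubmersion G E δ) (hη : IsSmoothSubmersion G E' η)
    (hpp : ∀ t, p (δ t) = p' (η t)) (hqq : ∀ t, q (δ t) = q' (η t)) :
    ChartKerImage E' p' q' X (η t) := by
  have hη0 : localMap G E' t (η t) η (chartAt G t t) = chartAt E' (η t) (η t) :=
    localMap_chart (E' := E') (mem_chart_source G t) _ _
  have hδ0 : localMap G E t (δ t) δ (chartAt G t t) = chartAt E (δ t) (δ t) :=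
    localMap_chart (E' := E) (mem_chart_source G t) _ _
  have hps := hp.smoothNear_localMap (δ t)
  have hqs := hq.smoothNear_localMap (δ t)
  unfold ChartKerImage at h ⊢
  rw [hpp, hqq] at h
  rw [hpp] at hps
  rw [hqq] at hqs
  have hsurj := surjective_fderiv_localMap hp (mem_chart_source E (δ t))
    (w₀ := p (δ t)) (mem_chart_source _ _)
  rw [hpp] at hsurj
  rw [← hη0]
  have hp's := hp'.smoothNear_localMap (η t)
  have hq's := hq'.smoothNear_localMap (η t)
  rw [← hη0] at hp's hq's
  have hδs : SmoothNear (localMap G E t (δ t) δ) (chartAt G t t) :=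
    smoothNear_localMap (.of_forall hδ.1) (mem_chart_source G t) (mem_chart_source _ _)
  have hηs : SmoothNear (localMap G E' t (η t) η) (chartAt G t t) :=
    smoothNear_localMap (.of_forall hη.1) (mem_chart_source G t) (mem_chart_source _ _)
  refine h.transfer hps hqs hsurj hp's hq's hδs hδ0
    (surjective_fderiv_localMap hδ (mem_chart_source G t) (mem_chart_source _ _)) hηs
    (surjective_fderiv_localMap hη (mem_chart_source G t) (mem_chart_source _ _)) ?_ ?_
  · filter_upwards [eventually_localMap_comp (E₁ := G) (E₂ := E) (E₃ := Euc m) (g := p)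
      hδ.1.continuous t (p' (η t)), eventually_localMap_comp (E₁ := G) (E₂ := E') (E₃ := Euc m)
      (g := p') hη.1.continuous t (p' (η t))] with u h1 h2
    rw [← h1, ← h2]
    simp only [hpp]
  · filter_upwards [eventually_localMap_comp (E₁ := G) (E₂ := E) (E₃ := Euc m) (g := q)
      hδ.1.continuous t (q' (η t)), eventually_localMap_comp (E₁ := G) (E₂ := E') (E₃ := Euc m)
      (g := q') hη.1.continuous t (q' (η t))] with u h1 h2
    rw [← h1, ← h2]
    simp only [hqq]

end Transfer

variable {m : ℕ} {M : Type u} [TopologicalSpace M] [ChartedSpace (Euc m) M]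
  [IsManifold (𝓡 m) ∞ M]

/-- The points `w` of `W` and `w'` of `W'` are related by an equivalence of neighbourhoods of
these points. -/
def LocEq (W : Span m M) (w : W.carrier) (W' : Span m M) (w' : W'.carrier) : Prop :=
  ∃ (V : PureManifold.{u}) (v : V.carrier) (δ : V.carrier → W.carrier)
    (η : V.carrier → W'.carrier), IsSmoothSubmersion V.model W.model δ ∧
    IsSmoothSubmersion V.model W'.model η ∧ (∀ x, W.p (δ x) = W'.p (η x)) ∧
    (∀ x, W.q (δ x) = W'.q (η x)) ∧ δ v = w ∧ η v = w'

namespace LocEq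

variable {W W' W'' : Span m M} {w : W.carrier} {w' : W'.carrier} {w'' : W''.carrier}

theorem symm (h : LocEq W w W' w') : LocEq W' w' W w := by
  obtain ⟨V, v, δ, η, hδ, hη, hp, hq, h1, h2⟩ := h
  exact ⟨V, v, η, δ, hη, hδ, fun x => (hp x).symm, fun x => (hq x).symm, h2, h1⟩

theorem inv (h : LocEq W w W' w') : LocEq W.inv w W'.inv w' := by
  obtain ⟨V, v, δ, η, hδ, hη, hp, hq, h1, h2⟩ := h
  exact ⟨V, v, δ, η, hδ, hη, hq, hp, h1, h2⟩

theorem p_eq (h : LocEq W w W' w') : W.p w = W'.p w' := by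
  obtain ⟨V, v, δ, η, hδ, hη, hp, hq, rfl, rfl⟩ := h
  exact hp v

theorem q_eq (h : LocEq W w W' w') : W.q w = W'.q w' := h.inv.p_eq

/-- The new covering manifold is the fibre product of the two given ones over `W'`. -/
theorem trans (h : LocEq W w W' w') (h' : LocEq W' w' W'' w'') : LocEq W w W'' w'' := by
  obtain ⟨V, v, δ, η, hδ, hη, hp, hq, rfl, rfl⟩ := h
  obtain ⟨V', v', δ', η', hδ', hη', hp', hq', h1, rfl⟩ := h'
  let _ := FiberProduct.chartedSpace (F := V.model) hη.1.continuous hδ'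
  have := FiberProduct.isManifold (F := V.model) hη.1 hδ'
  refine ⟨{ model := FiberProduct.Model V'.model W'.model V.model
            carrier := FiberProduct η δ' }, ⟨v, v', h1.symm⟩, δ ∘ FiberProduct.fst,
    η' ∘ FiberProduct.snd, hδ.comp (FiberProduct.isSmoothSubmersion_fst hη.1 hδ'),
    hη'.comp (FiberProduct.isSmoothSubmersion_snd hδ' hη), fun x => ?_, fun x => ?_, rfl, rfl⟩
  · simp only [Function.comp_apply]
    rw [hp, x.w, hp']
  · simp only [Function.comp_apply]
    rw [hq, x.w, hq']

end LocEq

variable {F : SingularFoliation m M}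

theorem SingularFoliation.exists_generates (F : SingularFoliation m M) (x : M) :
    ∃ (O : Opens M) (n : ℕ) (X : Fin n → VField (Euc m) M), x ∈ O ∧ F.Generates O X := by
  obtain ⟨U, hx, n, X, h1, h2⟩ := F.locally_finitely_generated x
  exact ⟨U, n, X, hx, h1, h2⟩

/-- A span whose points are locally equivalent to points of bi-submersions is a bi-submersion. -/
theorem Span.isBiSubmersion_of_locEq {W' : Span m M}
    (h : ∀ w', ∃ (W : Span m M) (w : W.carrier), W.IsBiSubmersion F ∧ LocEq W w W' w') :
    W'.IsBiSubmersion F := by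
  refine Span.isBiSubmersion_of_chartKerImage (fun w' => ?_) fun w' => ?_
  · obtain ⟨O, n, X, hO, hX⟩ := F.exists_generates (W'.q w')
    obtain ⟨W, w, hW, V, v, δ, η, hδ, hη, hp, hq, rfl, rfl⟩ := h w'
    have hO' := hO
    rw [← hq] at hO'
    exact ⟨O, n, X, hO, hX, (hW.chartKerImage hX hO').transfer W.submersion_p W.submersion_q
      W'.submersion_p W'.submersion_q hδ hη hp hq⟩
  · obtain ⟨O, n, X, hO, hX⟩ := F.exists_generates (W'.p w')
    obtain ⟨W, w, hW, V, v, δ, η, hδ, hη, hp, hq, rfl, rfl⟩ := h w'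
    have hO' := hO
    rw [← hp] at hO'
    exact ⟨O, n, X, hO, hX, (hW.inv.chartKerImage hX hO').transfer W.submersion_q W.submersion_p
      W'.submersion_q W'.submersion_p hδ hη hq hp⟩

/-- The fibre product in the coordinates `(e, a)` with `e` in the first factor and `a` a fibre
coordinate `θ` of the second factor. -/
theorem KerImage.fiberProduct_coordinates {E₁ E₂ F₀ F₁ F₂ A : Type} [NormedAddCommGroup E₁]
    [NormedSpace ℝ E₁]
    [FiniteDimensional ℝ E₁] [NormedAddCommGroup E₂] [NormedSpace ℝ E₂] [FiniteDimensional ℝ E₂]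
    [NormedAddCommGroup F₀] [NormedSpace ℝ F₀] [FiniteDimensional ℝ F₀]
    [NormedAddCommGroup F₁] [NormedSpace ℝ F₁] [FiniteDimensional ℝ F₁]
    [NormedAddCommGroup F₂] [NormedSpace ℝ F₂] [NormedAddCommGroup A] [NormedSpace ℝ A]
    [FiniteDimensional ℝ A]
    {p₁ : E₁ → F₀} {q₁ : E₁ → F₁} {p₂ : E₂ → F₁} {q₂ : E₂ → F₂} {n₁ n₂ : ℕ}
    {X₁ : Fin n₁ → F₁ → F₁} {X₂ : Fin n₂ → F₂ → F₂} {m₁ : E₁ × A → E₁} {m₂ : E₁ × A → E₂}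
    {g₀ : E₁ × A}
    (h₁ : KerImage p₁ q₁ X₁ (m₁ g₀)) (h₂ : KerImage p₂ q₂ X₂ (m₂ g₀))
    (h₂' : KerImage q₂ p₂ X₁ (m₂ g₀)) (hm₁ : ∀ᶠ g in 𝓝 g₀, m₁ g = g.1) (hm₂ : SmoothNear m₂ g₀)
    (hp₁ : SmoothNear p₁ (m₁ g₀)) (hq₁ : SmoothNear q₁ (m₁ g₀)) (hp₂ : SmoothNear p₂ (m₂ g₀))
    (hq₂ : SmoothNear q₂ (m₂ g₀)) (hs₁ : Function.Surjective (fderiv ℝ p₁ (m₁ g₀)))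
    (hs₂ : Function.Surjective (fderiv ℝ p₂ (m₂ g₀)))
    (hqp : ∀ᶠ g in 𝓝 g₀, q₁ (m₁ g) = p₂ (m₂ g)) {θ : E₂ → A} {σ : F₁ × A → E₂}
    (hθ : SmoothNear θ (m₂ g₀)) (hσ : SmoothNear σ (p₂ (m₂ g₀), θ (m₂ g₀)))
    (hσθ : ∀ᶠ e in 𝓝 (m₂ g₀), σ (p₂ e, θ e) = e) (hm₂θ : ∀ᶠ g in 𝓝 g₀, θ (m₂ g) = g.2) :
    KerImage (fun g => p₁ (m₁ g)) (fun g => q₂ (m₂ g)) X₂ g₀ := by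
  have hm₁s : SmoothNear m₁ g₀ := contDiff_fst.smoothNear.congr hm₁
  have hpθ : SmoothNear (fun e => (p₂ e, θ e)) (m₂ g₀) := hp₂.prodMk hθ
  have hinj := fderiv_comp_eventually hpθ hσ
  have hpθ' : ∀ᶠ e in 𝓝 (m₂ g₀), ∀ v, fderiv ℝ (fun e => (p₂ e, θ e)) e v =
      (fderiv ℝ p₂ e v, fderiv ℝ θ e v) := by
    filter_upwards [hp₂.eventually_differentiableAt, hθ.eventually_differentiableAt] with e h3 h4 v
    rw [(h3.hasFDerivAt.prodMk h4.hasFDerivAt).fderiv]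
    rfl
  have hid : ∀ᶠ e in 𝓝 (m₂ g₀), fderiv ℝ (fun e => σ (p₂ e, θ e)) e = .id ℝ E₂ := by
    filter_upwards [hσθ.eventually_nhds] with e he
    exact (Filter.EventuallyEq.fderiv_eq (f := id) he).trans fderiv_id
  have hQP := fderiv_comp_eventuallyEq hm₁s hq₁ hm₂ hp₂ hqp
  have hΘ := fderiv_comp_eventuallyEq hm₂ hθ contDiff_id.smoothNear contDiff_snd.smoothNear hm₂θ
  refine KerImage.fiberProduct h₁ h₂ h₂' hm₁s hm₂ hp₁ hq₁ hp₂ hq₂ hs₁ hs₂ hqp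
    fun η₁ η₂ hη₁ hη₂ hη => ?_
  -- The pair `(p₂, θ)` has the left inverse `σ`, so a tangent vector of the second factor is
  -- determined by its images under `Tp₂` and `Tθ`. The former is prescribed by `η₁` and the latter
  -- is the `A`-component.
  refine ⟨fun g => (η₁ g, fderiv ℝ θ (m₂ g) (η₂ g)),
    hη₁.prodMk ((hθ.fderiv.comp hm₂).clm_apply hη₂), ?_⟩
  have hm₁' : ∀ᶠ g in 𝓝 g₀, fderiv ℝ m₁ g = .fst ℝ E₁ A := by
    filter_upwards [hm₁.eventually_nhds] with g hg
    exact (Filter.EventuallyEq.fderiv_eq (f := Prod.fst) hg).trans fderiv_fst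
  filter_upwards [hm₁', hQP, hΘ, hη, hm₂.continuousAt.eventually hinj,
    hm₂.continuousAt.eventually hpθ', hm₂.continuousAt.eventually hid] with g a1 a2 a3 a4 a5 a6 a7
  refine ⟨by rw [a1]; rfl, ?_⟩
  have a8 : ∀ v, fderiv ℝ σ (p₂ (m₂ g), θ (m₂ g)) (fderiv ℝ p₂ (m₂ g) v, fderiv ℝ θ (m₂ g) v) =
      v := by
    intro v
    rw [← a6, ← a5, a7]
    rfl
  rw [← a8 (fderiv ℝ m₂ g _), ← a2, a3, a1]
  refine Eq.trans ?_ (a8 (η₂ g))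
  rw [← a4]
  simp [fderiv_snd]

theorem KerImage.congr {E F F' : Type} [NormedAddCommGroup E] [NormedSpace ℝ E]
    [NormedAddCommGroup F] [NormedSpace ℝ F] [NormedAddCommGroup F'] [NormedSpace ℝ F']
    {n : ℕ} {p p' : E → F} {q q' : E → F'} {X : Fin n → F' → F'} {e : E} (h : KerImage p q X e)
    (hp : p' =ᶠ[𝓝 e] p) (hq : q' =ᶠ[𝓝 e] q) : KerImage p' q' X e := by
  refine ⟨fun i => ?_, fun ξ hξ hξ0 => ?_⟩
  · obtain ⟨ξ, hξ, hξ'⟩ := h.lift i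
    refine ⟨ξ, hξ, ?_⟩
    filter_upwards [hξ', hp.eventually_nhds, hq.eventually_nhds] with z h1 h2 h3
    rw [Filter.EventuallyEq.fderiv_eq h2, Filter.EventuallyEq.fderiv_eq h3, h3.self_of_nhds]
    exact h1
  · obtain ⟨g, hg, hg'⟩ := h.maps ξ hξ (by
      filter_upwards [hξ0, hp.eventually_nhds] with z h1 h2
      rw [← Filter.EventuallyEq.fderiv_eq h2, h1])
    refine ⟨g, hg, ?_⟩
    filter_upwards [hg', hq.eventually_nhds] with z h1 h3
    rw [Filter.EventuallyEq.fderiv_eq h3, h3.self_of_nhds, h1]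

/-- In the chart of the fibre product the first projection is a coordinate projection, and the
straightening `Θ` of `W.p` provides the fibre coordinate `θ` and its inverse `σ`. This is the
situation of `KerImage.fiberProduct_coordinates`. -/
theorem chartKerImage_fiberProduct {V W : Span m M} (hV : V.IsBiSubmersion F)
    (hW : W.IsBiSubmersion F) {O : Opens M} {n : ℕ} {X : Fin n → VField (Euc m) M}
    (hX : F.Generates O X) (z : FiberProduct V.q W.p) (hz : W.q z.snd ∈ O) :
    letI := FiberProduct.chartedSpace (F := V.model) V.submersion_q.1.continuous W.submersion_p
    ChartKerImage (FiberProduct.Model W.model (Euc m) V.model) (V.p ∘ FiberProduct.fst)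
      (W.q ∘ FiberProduct.snd) X z := by
  let _ := FiberProduct.chartedSpace (F := V.model) V.submersion_q.1.continuous W.submersion_p
  have := FiberProduct.isManifold (F := V.model) V.submersion_q.1 W.submersion_p
  let G := FiberProduct.Model W.model (Euc m) V.model
  let ψ := chartAt V.model z.fst
  let ψ' := chartAt W.model z.snd
  let φ := chartAt (Euc m) (V.q z.fst)
  let Θ := FiberProduct.straightening W.submersion_p z.snd
  let g₀ := chartAt G z z
  have hzsrc := mem_chart_source G z
  have hΘ : z.snd ∈ Θ.source := FiberProduct.mem_straightening_source W.submersion_p z.snd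
  have hΘfst := FiberProduct.straightening_fst W.submersion_p z.snd
  -- Generators near the middle point, where the two factors are glued.
  obtain ⟨O₁, n₁, X₁, hO₁, hX₁⟩ := F.exists_generates (V.q z.fst)
  have hO₁' := hO₁
  rw [z.w] at hO₁'
  have hfst := FiberProduct.isSmoothSubmersion_fst (F := V.model) V.submersion_q.1 W.submersion_p
  have hsnd := FiberProduct.isSmoothSubmersion_snd (F := V.model) W.submersion_p V.submersion_q
  have e₁ : localMap G V.model z z.fst FiberProduct.fst g₀ = ψ z.fst :=
    localMap_chart (E' := V.model) hzsrc _ _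
  have e₂ : localMap G W.model z z.snd FiberProduct.snd g₀ = ψ' z.snd :=
    localMap_chart (E' := W.model) hzsrc _ _
  have h₁ := hV.chartKerImage hX₁ hO₁
  have h₂ := hW.chartKerImage hX hz
  have h₂' := hW.inv.chartKerImage hX₁ hO₁'
  have hp₁ := V.submersion_p.smoothNear_localMap z.fst
  have hq₁ := V.submersion_q.smoothNear_localMap z.fst
  have hp₂ := W.submersion_p.smoothNear_localMap z.snd
  have hq₂ := W.submersion_q.smoothNear_localMap z.snd
  have hs₁ := surjective_fderiv_localMap V.submersion_p (mem_chart_source V.model z.fst)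
    (mem_chart_source _ (V.p z.fst))
  have hs₂ := surjective_fderiv_localMap W.submersion_p (mem_chart_source W.model z.snd)
    (mem_chart_source _ (W.p z.snd))
  unfold ChartKerImage at h₁ h₂ h₂' ⊢
  have hsp : SmoothNear (localMap G W.model z z.snd FiberProduct.snd) g₀ :=
    smoothNear_localMap (.of_forall hsnd.1) hzsrc (mem_chart_source _ _)
  have htarget : ∀ᶠ u in 𝓝 g₀, u ∈ (chartAt G z).target :=
    (chartAt G z).open_target.mem_nhds ((chartAt G z).map_source hzsrc)
  have hm₁ : ∀ᶠ u in 𝓝 g₀, localMap G V.model z z.fst FiberProduct.fst u = u.1 := by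
    filter_upwards [htarget] with u hu
    change ψ ((chartAt G z).symm u).fst = u.1
    rw [show ((chartAt G z).symm u).fst = ψ.symm u.1 from
      FiberProduct.chartInv_fst z ψ Θ hΘfst hu.2, ψ.right_inv hu.1]
  let θ : W.model → EuclideanSpace ℝ
      (Fin (Module.finrank ℝ W.model - Module.finrank ℝ (Euc m))) := fun e => (Θ (ψ'.symm e)).2
  let σ : Euc m × EuclideanSpace ℝ
      (Fin (Module.finrank ℝ W.model - Module.finrank ℝ (Euc m))) → W.model :=
    fun y => ψ' (Θ.symm (φ.symm y.1, y.2))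
  have hθ : SmoothNear θ (ψ' z.snd) := by
    filter_upwards [eventually_symm_chart (mem_chart_source W.model z.snd)
      (Θ.open_source.mem_nhds hΘ)] with e he
    rw [← contMDiffAt_iff_contDiffAt]
    exact ContMDiffAt.comp (g := fun w => (Θ w).2) e
      ((FiberProduct.contMDiffOn_straightening W.submersion_p z.snd).contMDiffAt
        (Θ.open_source.mem_nhds he.2)) (contMDiffAt_chart_symm_of_mem he.1)
  have hΘz : (V.q z.fst, (Θ z.snd).2) = Θ z.snd := FiberProduct.pair_eq (hΘfst _ hΘ)
  have hφ : φ.symm (φ (V.q z.fst)) = V.q z.fst := φ.left_inv (mem_chart_source _ _)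
  have hσ : SmoothNear σ (φ (V.q z.fst), θ (ψ' z.snd)) := by
    have a0 : θ (ψ' z.snd) = (Θ z.snd).2 := by
      simp only [θ]
      rw [ψ'.left_inv (mem_chart_source _ _)]
    rw [a0]
    let P : Euc m × EuclideanSpace ℝ
      (Fin (Module.finrank ℝ W.model - Module.finrank ℝ (Euc m))) → M × EuclideanSpace ℝ
      (Fin (Module.finrank ℝ W.model - Module.finrank ℝ (Euc m))) := fun y => (φ.symm y.1, y.2)
    have a1 : ∀ y, y.1 ∈ φ.target → ContMDiffAt 𝓘(ℝ, Euc m × EuclideanSpace ℝ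
        (Fin (Module.finrank ℝ W.model - Module.finrank ℝ (Euc m)))) (𝓘(ℝ, Euc m).prod
        𝓘(ℝ, EuclideanSpace ℝ (Fin (Module.finrank ℝ W.model - Module.finrank ℝ (Euc m))))) ∞
        P y := by
      intro y hy
      exact ((contMDiffAt_chart_symm_of_mem (v₀ := V.q z.fst) hy).comp y
        (contDiff_fst.contMDiff y)).prodMk (contDiff_snd.contMDiff y)
    have a2 : P (φ (V.q z.fst), (Θ z.snd).2) = Θ z.snd := by
      simp only [P]
      rw [hφ, hΘz]
    have a3 : (φ (V.q z.fst)) ∈ φ.target := φ.map_source (mem_chart_source _ _)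
    have a4 : ∀ᶠ y in 𝓝 (φ (V.q z.fst), (Θ z.snd).2), y.1 ∈ φ.target :=
      (φ.open_target.preimage continuous_fst).mem_nhds a3
    have a5 : ∀ᶠ y in 𝓝 (φ (V.q z.fst), (Θ z.snd).2), P y ∈ Θ.target ∧
        Θ.symm (P y) ∈ ψ'.source := by
      refine (a1 (φ (V.q z.fst), (Θ z.snd).2) a3).continuousAt.eventually
        (p := fun x => x ∈ Θ.target ∧ Θ.symm x ∈ ψ'.source) ?_
      rw [a2]
      refine (Filter.eventually_mem_set.2
        (Θ.open_target.mem_nhds (Θ.map_source hΘ))).and ?_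
      have a6 := Θ.symm.continuousAt (Θ.map_source hΘ)
      rw [ContinuousAt, Θ.left_inv hΘ] at a6
      exact a6.eventually (ψ'.open_source.mem_nhds (mem_chart_source _ _))
    filter_upwards [a4, a5] with y b1 b2
    rw [← contMDiffAt_iff_contDiffAt]
    exact ContMDiffAt.comp (g := ψ') y (contMDiffAt_chart_of_mem b2.2)
      (ContMDiffAt.comp (g := Θ.symm) y
        ((FiberProduct.contMDiffOn_straightening_symm W.submersion_p z.snd).contMDiffAt
          (Θ.open_target.mem_nhds b2.1)) (a1 y b1))
  have hσθ : ∀ᶠ e in 𝓝 (ψ' z.snd), σ (localMap W.model (Euc m) z.snd (V.q z.fst) W.p e, θ e) =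
      e := by
    have a1 : ∀ᶠ w in 𝓝 z.snd, W.p w ∈ φ.source := by
      refine W.submersion_p.1.continuous.continuousAt.eventually (φ.open_source.mem_nhds ?_)
      rw [← z.w]
      exact mem_chart_source _ _
    filter_upwards [eventually_symm_chart (mem_chart_source W.model z.snd)
      (a1.and (Θ.open_source.mem_nhds hΘ))] with e he
    simp only [σ, θ]
    change ψ' (Θ.symm (φ.symm (φ (W.p (ψ'.symm e))), _)) = e
    rw [φ.left_inv he.2.1, ← hΘfst _ he.2.2]
    change ψ' (Θ.symm (Θ (ψ'.symm e))) = e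
    rw [Θ.left_inv he.2.2, ψ'.right_inv he.1]
  have hm₂θ : ∀ᶠ u in 𝓝 g₀, θ (localMap G W.model z z.snd FiberProduct.snd u) = u.2 := by
    filter_upwards [eventually_symm_chart hzsrc
      (hsnd.1.continuous.continuousAt.eventually
        (ψ'.open_source.mem_nhds (mem_chart_source _ _)))] with u hu
    change (Θ (ψ'.symm (ψ' ((chartAt G z).symm u).snd))).2 = u.2
    rw [ψ'.left_inv hu.2, show ((chartAt G z).symm u).snd = Θ.symm (V.q (ψ.symm u.1), u.2) from
      FiberProduct.chartInv_snd z ψ Θ hΘfst hu.1.2, Θ.right_inv hu.1.2]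
  -- The maps `V.q` and `W.p` must be read in one chart of `M`, the one at `V.q z.fst`.
  rw [← z.w] at hp₂ hs₂ h₂
  have hw : W.inv.q z.snd = V.q z.fst := z.w.symm
  have hbase : localMap W.model (Euc m) z.snd (V.q z.fst) W.p (ψ' z.snd) = φ (V.q z.fst) := by
    rw [localMap_chart (E' := Euc m) (mem_chart_source W.model z.snd), ← z.w]
  rw [hw] at h₂'
  rw [← hbase] at hσ
  have hqp : ∀ᶠ u in 𝓝 g₀, localMap V.model (Euc m) z.fst (V.q z.fst) V.q
      (localMap G V.model z z.fst FiberProduct.fst u) =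
      localMap W.model (Euc m) z.snd (V.q z.fst) W.p
        (localMap G W.model z z.snd FiberProduct.snd u) := by
    filter_upwards [eventually_localMap_comp (E₁ := G) (E₂ := V.model) (E₃ := Euc m) (g := V.q)
      hfst.1.continuous z (V.q z.fst), eventually_localMap_comp (E₁ := G) (E₂ := W.model)
      (E₃ := Euc m) (g := W.p) hsnd.1.continuous z (V.q z.fst)] with u b1 b2
    rw [← b1, ← b2]
    simp only [localMap]
    rw [((chartAt G z).symm u).w]
  refine (KerImage.fiberProduct_coordinates (m₁ := localMap G V.model z z.fst FiberProduct.fst)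
    (m₂ := localMap G W.model z z.snd FiberProduct.snd) (θ := θ) (σ := σ)
    (e₁ ▸ h₁) (e₂ ▸ h₂) (e₂ ▸ h₂') hm₁ hsp (e₁ ▸ hp₁) (e₁ ▸ hq₁) (e₂ ▸ hp₂) (e₂ ▸ hq₂)
    (e₁ ▸ hs₁) (e₂ ▸ hs₂) hqp (e₂ ▸ hθ) (e₂ ▸ hσ) (e₂ ▸ hσθ) hm₂θ).congr ?_ ?_
  · exact eventually_localMap_comp (E₁ := G) (E₂ := V.model) (E₃ := Euc m) (g := V.p)
      hfst.1.continuous z (V.p z.fst)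
  · exact eventually_localMap_comp (E₁ := G) (E₂ := W.model) (E₃ := Euc m) (g := W.q)
      hsnd.1.continuous z (W.q z.snd)

theorem IsSmoothSubmersion.of_inverse {E E' : Type} [NormedAddCommGroup E] [NormedSpace ℝ E]
    [NormedAddCommGroup E'] [NormedSpace ℝ E'] {V W : Type u} [TopologicalSpace V]
    [ChartedSpace E V] [TopologicalSpace W] [ChartedSpace E' W] {f : V → W} {g : W → V}
    (hf : ContMDiff 𝓘(ℝ, E) 𝓘(ℝ, E') ∞ f) (hg : ContMDiff 𝓘(ℝ, E') 𝓘(ℝ, E) ∞ g)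
    (hgf : ∀ v, g (f v) = v) (hfg : ∀ w, f (g w) = w) : IsSmoothSubmersion E E' f := by
  refine ⟨hf, fun v => ?_⟩
  have h := mfderiv_surjective_of_section (f := f) (σ := g) (y := f v)
    ((hf _).mdifferentiableAt (by simp)) ((hg _).mdifferentiableAt (by simp)) (.of_forall hfg)
  rwa [hgf] at h

/-- The exchange of the factors of a composition. -/
def Span.swap (V W : Span m M) (z : (V.comp W).carrier) : (W.inv.comp V.inv).carrier :=
  ⟨FiberProduct.snd z, FiberProduct.fst z, (FiberProduct.w z).symm⟩

theorem Span.contMDiff_swap (V W : Span m M) :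
    ContMDiff 𝓘(ℝ, (V.comp W).model) 𝓘(ℝ, (W.inv.comp V.inv).model) ∞ (V.swap W) := by
  intro z
  refine FiberProduct.contMDiffAt_of_components (F := W.model) W.submersion_p.1 V.submersion_q
    (f := V.swap W) ?_ ?_
  · exact FiberProduct.contMDiff_snd V.submersion_q.1 W.submersion_p z
  · exact FiberProduct.contMDiff_fst V.submersion_q.1 W.submersion_p z

theorem Span.isSmoothSubmersion_swap (V W : Span m M) :
    IsSmoothSubmersion (V.comp W).model (W.inv.comp V.inv).model (V.swap W) :=
  .of_inverse (V.contMDiff_swap W) (W.inv.contMDiff_swap V.inv) (fun _ => rfl) fun _ => rfl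

theorem isSmoothSubmersion_id {E : Type} [NormedAddCommGroup E] [NormedSpace ℝ E] {V : Type u}
    [TopologicalSpace V] [ChartedSpace E V] : IsSmoothSubmersion E E (id : V → V) :=
  .of_inverse contMDiff_id contMDiff_id (fun _ => rfl) fun _ => rfl

/-- The condition on `q` is `chartKerImage_fiberProduct`. The condition on `p` follows from it
because exchanging the factors identifies the inverse of `V * W` with `W⁻¹ * V⁻¹`. -/
theorem Span.IsBiSubmersion.comp {V W : Span m M} (hV : V.IsBiSubmersion F)
    (hW : W.IsBiSubmersion F) : (V.comp W).IsBiSubmersion F := by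
  refine Span.isBiSubmersion_of_chartKerImage (fun z => ?_) fun z => ?_
  · obtain ⟨O, n, X, hO, hX⟩ := F.exists_generates ((V.comp W).q z)
    exact ⟨O, n, X, hO, hX, chartKerImage_fiberProduct hV hW hX z hO⟩
  · obtain ⟨O, n, X, hO, hX⟩ := F.exists_generates ((V.comp W).p z)
    have h : ChartKerImage (W.inv.comp V.inv).model (W.inv.comp V.inv).p (W.inv.comp V.inv).q X
        (V.swap W z) := chartKerImage_fiberProduct hW.inv hV.inv hX (V.swap W z) hO
    exact ⟨O, n, X, hO, hX, ChartKerImage.transfer (T := (V.comp W).carrier) (δ := V.swap W)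
      (η := id) (t := z) h (W.inv.comp V.inv).submersion_p (W.inv.comp V.inv).submersion_q
      (V.comp W).submersion_q (V.comp W).submersion_p (V.isSmoothSubmersion_swap W)
      isSmoothSubmersion_id (fun _ => rfl) fun _ => rfl⟩

theorem LocEq.inv_comp (V W : Span m M) (z : (V.comp W).carrier) :
    LocEq (V.comp W).inv z (W.inv.comp V.inv) (V.swap W z) :=
  ⟨(V.comp W).toPureManifold, z, id, (V.swap W), isSmoothSubmersion_id,
    V.isSmoothSubmersion_swap W, fun _ => rfl, fun _ => rfl, rfl, rfl⟩

theorem LocEq.refl (W : Span m M) (w : W.carrier) : LocEq W w W w :=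
  ⟨W.toPureManifold, w, id, id, isSmoothSubmersion_id, isSmoothSubmersion_id, fun _ => rfl,
    fun _ => rfl, rfl, rfl⟩

end

/-! ### Lifting exponentials to a bi-submersion, in coordinates. -/

section

open Set Filter

variable {E F F₀ : Type} [NormedAddCommGroup E] [NormedSpace ℝ E] [FiniteDimensional ℝ E]
  [NormedAddCommGroup F] [NormedSpace ℝ F] [FiniteDimensional ℝ F]
  [NormedAddCommGroup F₀] [NormedSpace ℝ F₀] [FiniteDimensional ℝ F₀] {n : ℕ}

/-- `Ψ (y, t)` is the value at time one of an integral curve of `∑ tᵢ Yᵢ` starting at `y`, where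
`(y, t)` is near `(y₀, 0)` and the curves stay in a set on which they are unique. -/
def ExpNear (Y : Fin n → F → F) (y₀ : F) (Ψ : F × Euc n → F) : Prop :=
  ∃ K, ∃ S ∈ 𝓝 (y₀, (0 : Euc n)), LipschitzOnWith K (fieldComb Y) S ∧
    ∀ᶠ z in 𝓝 (y₀, (0 : Euc n)), ∃ c : ℝ → F, c 0 = z.1 ∧ c 1 = Ψ z ∧
      ∀ s ∈ Icc (0 : ℝ) 1, (c s, z.2) ∈ S ∧
        HasDerivWithinAt c (fieldComb Y (c s, z.2)) (Icc 0 1) s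

theorem exists_expNear {Y : Fin n → F → F} {y₀ : F} (hY : ∀ i, SmoothNear (Y i) y₀) :
    ∃ Ψ, ExpNear Y y₀ Ψ := by
  have hV := smoothNear_fieldComb hY 0
  obtain ⟨K, S, hS, hK⟩ := hV.exists_lipschitzOnWith
  obtain ⟨Φ, hΦ, -⟩ := exists_flow hV (.of_forall fun y => fieldComb_zero y) hS
  refine ⟨Φ 1, K, S, hS, hK, ?_⟩
  filter_upwards [hΦ] with z hz
  exact ⟨fun s => Φ s z, hz.2.1, rfl, hz.2.2.2.1⟩

theorem eq_of_hasDerivWithinAt_zero {f : ℝ → F} (h : ∀ s ∈ Icc (0 : ℝ) 1,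
    HasDerivWithinAt f 0 (Icc 0 1) s) {s : ℝ} (hs : s ∈ Icc (0 : ℝ) 1) : f s = f 0 :=
  constant_of_has_deriv_right_zero (fun s hs => (h s hs).continuousWithinAt)
    (fun s hs => hasDerivWithinAt_Ici_of_Icc hs (h s (Ico_subset_Icc_self hs))) s hs

/-- Flowing a section of `p` along vector fields `Ξ i` tangent to the fibres of `p` which are
`q`-related to vector fields `Y i`. -/
theorem exists_flow_lift {p : E → F₀} {q : E → F} {Ξ : Fin n → E → E} {Y : Fin n → F → F} {e : E}
    (hp : SmoothNear p e) (hq : SmoothNear q e) (hΞ : ∀ i, SmoothNear (Ξ i) e)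
    (hlift : ∀ᶠ z in 𝓝 e, ∀ i, fderiv ℝ p z (Ξ i z) = 0 ∧ fderiv ℝ q z (Ξ i z) = Y i (q z))
    {Ψ : F × Euc n → F} (hΨ : ExpNear Y (q e) Ψ) {σ : F₀ → E} {x₀ : F₀} (hσ : SmoothNear σ x₀)
    (hσ0 : σ x₀ = e) (hσp : ∀ᶠ x in 𝓝 x₀, p (σ x) = x) :
    ∃ δ : F₀ × Euc n → E, SmoothNear δ (x₀, 0) ∧ δ (x₀, 0) = e ∧
      (∀ᶠ z in 𝓝 (x₀, (0 : Euc n)), p (δ z) = z.1 ∧ q (δ z) = Ψ (q (σ z.1), z.2)) ∧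
      ∀ a b, fderiv ℝ δ (x₀, 0) (a, b) = fderiv ℝ σ x₀ a + fieldComb Ξ (e, b) := by
  obtain ⟨K, S, hS, hK, hc⟩ := hΨ
  have hV := smoothNear_fieldComb hΞ 0
  have hqS : ∀ᶠ z in 𝓝 (e, (0 : Euc n)), (q z.1, z.2) ∈ S := by
    have h1 : ContinuousAt (fun z : E × Euc n => (q z.1, z.2)) (e, 0) :=
      (ContinuousAt.comp (g := q) hq.continuousAt continuousAt_fst).prodMk continuousAt_snd
    exact h1.eventually hS
  -- The lifted curves are kept in the set where the `Ξ i` are related to `0` and to the `Y i`, with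
  -- image under `q` in the uniqueness set of `Ψ`.
  have hgood : ∀ᶠ z in 𝓝 (e, (0 : Euc n)), ((q z.1, z.2) ∈ S ∧ DifferentiableAt ℝ p z.1 ∧
      DifferentiableAt ℝ q z.1) ∧
      ∀ i, fderiv ℝ p z.1 (Ξ i z.1) = 0 ∧ fderiv ℝ q z.1 (Ξ i z.1) = Y i (q z.1) :=
    (hqS.and (((hp.eventually_differentiableAt).and hq.eventually_differentiableAt).prod_inl_nhds
      0)).and (hlift.prod_inl_nhds 0)
  obtain ⟨Φ, hΦ, hΦ0⟩ := exists_flow hV (.of_forall fun y => fieldComb_zero y) hgood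
  have hpair : SmoothNear (fun z : F₀ × Euc n => (σ z.1, z.2)) (x₀, 0) :=
    (hσ.comp (f := Prod.fst) SmoothNear.id.fst).prodMk SmoothNear.id.snd
  have hpair0 : (fun z : F₀ × Euc n => (σ z.1, z.2)) (x₀, 0) = (e, 0) := by simp [hσ0]
  have hpt : Tendsto (fun z : F₀ × Euc n => (σ z.1, z.2)) (𝓝 (x₀, 0)) (𝓝 (e, 0)) := by
    have h1 := hpair.continuousAt.tendsto
    simpa only [hσ0] using h1
  have hΦs : SmoothNear (Φ 1) (e, 0) := by
    filter_upwards [hΦ] with z hz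
    exact hz.1 1 (by simp)
  refine ⟨fun z => Φ 1 (σ z.1, z.2), hΦs.comp_of_eq hpair hpair0, ?_, ?_, fun a b => ?_⟩
  · change Φ 1 (σ x₀, 0) = e
    rw [hσ0]
    exact hΦ0.self_of_nhds 1 (by simp)
  · have hqt : Tendsto (fun z : F₀ × Euc n => (q (σ z.1), z.2)) (𝓝 (x₀, 0)) (𝓝 (q e, 0)) := by
      have h1 : ContinuousAt (fun z : E × Euc n => (q z.1, z.2)) (e, 0) :=
        (ContinuousAt.comp (g := q) hq.continuousAt continuousAt_fst).prodMk continuousAt_snd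
      exact h1.tendsto.comp hpt
    filter_upwards [hpt.eventually hΦ, hqt.eventually hc, hσp.prod_inl_nhds 0] with z hz hz' hz''
    obtain ⟨-, h0, -, hcurve, -⟩ := hz
    obtain ⟨c, hc0, hc1, hc⟩ := hz'
    refine ⟨?_, ?_⟩
    -- The fields `Ξ i` are tangent to the fibres of `p`, so `p` is constant along the lifted curve.
    · have h1 : ∀ s ∈ Icc (0 : ℝ) 1,
          HasDerivWithinAt (fun s => p (Φ s (σ z.1, z.2))) 0 (Icc 0 1) s := by
        intro s hs
        obtain ⟨⟨⟨-, h2, -⟩, h3⟩, h4⟩ := hcurve s hs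
        have h5 := h2.hasFDerivAt.comp_hasDerivWithinAt s h4
        have h6 : fderiv ℝ p (Φ s (σ z.1, z.2)) (fieldComb Ξ (Φ s (σ z.1, z.2), z.2)) = 0 := by
          simp only [fieldComb, map_sum, map_smul, (h3 _).1, smul_zero, Finset.sum_const_zero]
        rw [h6] at h5
        exact h5
      have h2 := eq_of_hasDerivWithinAt_zero h1 (s := 1) (by simp)
      exact h2.trans ((congrArg p h0).trans hz'')
    -- The image of the lifted curve under `q` solves the equation defining `Ψ`, with the same
    -- initial value.
    · have h1 : ∀ s ∈ Icc (0 : ℝ) 1, (q (Φ s (σ z.1, z.2)), z.2) ∈ S ∧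
          HasDerivWithinAt (fun s => q (Φ s (σ z.1, z.2)))
            (fieldComb Y (q (Φ s (σ z.1, z.2)), z.2)) (Icc 0 1) s := by
        intro s hs
        obtain ⟨⟨⟨h1, -, h2⟩, h3⟩, h4⟩ := hcurve s hs
        refine ⟨h1, ?_⟩
        have h5 := h2.hasFDerivAt.comp_hasDerivWithinAt s h4
        have h6 : fderiv ℝ q (Φ s (σ z.1, z.2)) (fieldComb Ξ (Φ s (σ z.1, z.2), z.2)) =
            fieldComb Y (q (Φ s (σ z.1, z.2)), z.2) := by
          simp only [fieldComb, map_sum, map_smul, (h3 _).2]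
        rw [h6] at h5
        exact h5
      have h2 := eqOn_of_lipschitzOnWith hK h1 hc (by rw [hc0, h0]) (x := 1) (by simp)
      exact h2.trans hc1
  · have h1 := hΦ.self_of_nhds
    obtain ⟨hd, -, h0, hcurve, hvar⟩ := h1
    have h2 := (hd 1 (by simp)).differentiableAt (by simp)
    have h3 : HasFDerivAt (fun z : F₀ × Euc n => (σ z.1, z.2))
        ((fderiv ℝ σ x₀ ∘L .fst ℝ F₀ (Euc n)).prod (.snd ℝ F₀ (Euc n))) (x₀, 0) :=
      (HasFDerivAt.comp (x₀, (0 : Euc n)) (hσ.contDiffAt.differentiableAt (by simp)).hasFDerivAt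
        hasFDerivAt_fst).prodMk hasFDerivAt_snd
    have h4 : fderiv ℝ (fun z : F₀ × Euc n => Φ 1 (σ z.1, z.2)) (x₀, 0) (a, b) =
        fderiv ℝ (Φ 1) (e, 0) (fderiv ℝ σ x₀ a, b) := by
      have h5 : HasFDerivAt (Φ 1) (fderiv ℝ (Φ 1) (e, 0))
          ((fun z : F₀ × Euc n => (σ z.1, z.2)) (x₀, 0)) := by
        rw [hpair0]
        exact h2.hasFDerivAt
      exact congrArg (fun L => L (a, b)) (h5.comp (x₀, (0 : Euc n)) h3).fderiv
    rw [h4]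
    -- For the zero parameter the flow is stationary, so the variational equation has the constant
    -- right-hand side `fieldComb Ξ (e, b)`.
    have h6 : ∀ s ∈ Icc (0 : ℝ) 1, HasDerivWithinAt
        (fun s => fderiv ℝ (Φ s) (e, 0) (fderiv ℝ σ x₀ a, b) - s • fieldComb Ξ (e, b)) 0
        (Icc 0 1) s := by
      intro s hs
      have h7 := hvar (fderiv ℝ σ x₀ a, b) s hs
      rw [hΦ0.self_of_nhds s hs,
        fderiv_fieldComb (fun i => (hΞ i).contDiffAt.differentiableAt (by simp))] at h7
      have h8 := h7.sub ((hasDerivWithinAt_id s (Icc 0 1)).smul_const (fieldComb Ξ (e, b)))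
      refine HasDerivWithinAt.congr_deriv h8 ?_
      simp
    have h9 := eq_of_hasDerivWithinAt_zero h6 (s := 1) (by simp)
    simp only [one_smul, zero_smul, sub_zero, h0] at h9
    exact sub_eq_iff_eq_add.1 h9

/-- Fields `κⱼ` spanning `ker Tp` satisfy `Tq κⱼ = ∑ cⱼᵢ Xᵢ ∘ q`, so `ζⱼ = κⱼ - ∑ cⱼᵢ ξᵢ` is killed
by `Tp` and `Tq`, while the `ξᵢ` and `ζⱼ` together still span. Nothing is claimed about `ker Tp ∩
ker Tq`, whose dimension may jump. -/
theorem KerImage.exists_spanning {p : E → F₀} {q : E → F} {X : Fin n → F → F} {e : E}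
    (h : KerImage p q X e) (hp : SmoothNear p e) (hs : Function.Surjective (fderiv ℝ p e)) :
    ∃ (k : ℕ) (ξ : Fin n → E → E) (ζ : Fin k → E → E), (∀ i, SmoothNear (ξ i) e) ∧
      (∀ j, SmoothNear (ζ j) e) ∧
      (∀ᶠ z in 𝓝 e, ∀ i, fderiv ℝ p z (ξ i z) = 0 ∧ fderiv ℝ q z (ξ i z) = X i (q z)) ∧
      (∀ᶠ z in 𝓝 e, ∀ j, fderiv ℝ p z (ζ j z) = 0 ∧ fderiv ℝ q z (ζ j z) = 0) ∧
      ∀ v, fderiv ℝ p e v = 0 → ∃ (a : Fin n → ℝ) (b : Fin k → ℝ),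
        v = ∑ i, a i • ξ i e + ∑ j, b j • ζ j e := by
  obtain ⟨R, hR, hR'⟩ := hp.fderiv.exists_rightInverse hs
  let b := Module.finBasis ℝ E
  let κ : Fin (Module.finrank ℝ E) → E → E := fun j z => b j - R z (fderiv ℝ p z (b j))
  have hκ : ∀ j, SmoothNear (κ j) e := fun j =>
    (SmoothNear.const _).sub (hR.clm_apply (hp.fderiv.clm_apply (.const _)))
  have hκ0 : ∀ j, ∀ᶠ z in 𝓝 e, fderiv ℝ p z (κ j z) = 0 := by
    intro j
    filter_upwards [hR'] with z hz
    simp only [κ, map_sub, hz, sub_self]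
  choose c hc hc' using fun j => h.maps (κ j) (hκ j) (hκ0 j)
  choose ξ hξ hξ' using h.lift
  refine ⟨_, ξ, fun j z => κ j z - ∑ i, c j i z • ξ i z, hξ, fun j =>
    (hκ j).sub (.sum _ fun i _ => (hc j i).smul (hξ i)), eventually_all.2 hξ', ?_, fun v hv => ?_⟩
  · filter_upwards [eventually_all.2 hξ', eventually_all.2 hκ0, eventually_all.2 hc']
      with z h1 h2 h3 j
    simp only [map_sub, map_sum, map_smul, (h1 _).1, (h1 _).2, h2, h3, smul_zero,
      Finset.sum_const_zero, sub_self]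
    exact ⟨trivial, trivial⟩
  · have h1 : v = ∑ j, b.coord j v • κ j e := by
      simp only [κ, smul_sub, Finset.sum_sub_distrib]
      have h2 : ∑ j, b.coord j v • b j = v := b.sum_repr v
      have h3 : ∑ j, b.coord j v • R e (fderiv ℝ p e (b j)) = 0 := by
        simp only [← map_smul, ← map_sum]
        rw [h2, hv, map_zero]
      rw [h2, h3, sub_zero]
    refine ⟨fun i => ∑ j, b.coord j v * c j i e, fun j => b.coord j v, ?_⟩
    conv_lhs => rw [h1]
    simp only [smul_sub, Finset.sum_sub_distrib, Finset.smul_sum, Finset.sum_smul, smul_smul]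
    rw [Finset.sum_comm (γ := Fin n)]
    abel

end

noncomputable section

/-! ### Submersions, restrictions to open subsets and sections. -/

section General

variable {E E' G : Type} [NormedAddCommGroup E] [NormedSpace ℝ E]
  [NormedAddCommGroup E'] [NormedSpace ℝ E'] [NormedAddCommGroup G] [NormedSpace ℝ G]
  {V W T : Type u} [TopologicalSpace V] [ChartedSpace E V] [TopologicalSpace W] [ChartedSpace E' W]
  [TopologicalSpace T] [ChartedSpace G T]

theorem surjective_mfderiv_of_localMap [IsManifold 𝓘(ℝ, E) ∞ V] [IsManifold 𝓘(ℝ, E') ∞ W]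
    {v₀ v : V} {w₀ : W} {f : V → W} (hf : ContMDiffAt 𝓘(ℝ, E) 𝓘(ℝ, E') ∞ f v)
    (hv : v ∈ (chartAt E v₀).source) (hw : f v ∈ (chartAt E' w₀).source)
    (hs : Function.Surjective (fderiv ℝ (localMap E E' v₀ w₀ f) (chartAt E v₀ v))) :
    Function.Surjective (mfderiv 𝓘(ℝ, E) 𝓘(ℝ, E') f v) := by
  intro ξ
  obtain ⟨e, he⟩ := hs (tanChart w₀ (f v) ξ)
  refine ⟨tanChartSymm v₀ v e, tanChart_injective hw ?_⟩
  rw [← fderiv_localMap hf hv hw, tanChart_symm hv, he]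

/-- An extension to `T` of the identity of the open subset `U`. -/
theorem exists_retraction (U : Opens T) (u₀ : U) : ∃ g : T → U, (∀ u : U, g u = u) ∧
    ∀ u : U, ContMDiffAt 𝓘(ℝ, G) 𝓘(ℝ, G) ∞ g u ∧
      Function.Surjective (mfderiv 𝓘(ℝ, G) 𝓘(ℝ, G) g u) := by
  classical
  let g : T → U := fun y => if h : y ∈ U then ⟨y, h⟩ else u₀
  have hg : ∀ u : U, g u = u := fun u => by simp [g]
  have hgs : ∀ u : U, ContMDiffAt 𝓘(ℝ, G) 𝓘(ℝ, G) ∞ g u := by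
    intro u
    rw [← contMDiffAt_subtype_iff]
    simp only [hg]
    exact contMDiffAt_id
  exact ⟨g, hg, fun u => ⟨hgs u, mfderiv_surjective_of_section (σ := Subtype.val)
    ((hgs u).mdifferentiableAt (by simp)) ((contMDiff_subtype_val u).mdifferentiableAt
      (n := ∞) (by simp)) (.of_forall hg)⟩⟩

theorem isSmoothSubmersion_subtype_val (U : Opens T) :
    IsSmoothSubmersion G G (Subtype.val : U → T) := by
  refine ⟨contMDiff_subtype_val, fun u => ?_⟩
  obtain ⟨g, hg, hg'⟩ := exists_retraction (G := G) U u
  have h1 : ∀ᶠ y in 𝓝 u.1, (g y).1 = y := by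
    filter_upwards [U.isOpen.mem_nhds u.2] with y hy
    exact congrArg Subtype.val (hg ⟨y, hy⟩)
  have h2 := mfderiv_surjective_of_section (f := (Subtype.val : U → T))
    ((contMDiff_subtype_val _).mdifferentiableAt (n := ∞) (by simp))
    ((hg' u).1.mdifferentiableAt (by simp)) h1
  rwa [hg] at h2

theorem isSmoothSubmersion_restrict (U : Opens T) {f : T → W}
    (hf : ∀ u ∈ U, ContMDiffAt 𝓘(ℝ, G) 𝓘(ℝ, E') ∞ f u ∧
      Function.Surjective (mfderiv 𝓘(ℝ, G) 𝓘(ℝ, E') f u)) :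
    IsSmoothSubmersion G E' (fun u : U => f u) := by
  have h := isSmoothSubmersion_subtype_val (G := G) U
  refine ⟨fun u => ContMDiffAt.comp (g := f) u (hf u u.2).1 (h.1 u), fun u => ?_⟩
  have h1 := mfderiv_comp (g := f) u ((hf u u.2).1.mdifferentiableAt (by simp))
    ((h.1 u).mdifferentiableAt (by simp))
  have h2 := (hf u u.2).2.comp (h.2 u)
  change Function.Surjective (mfderiv 𝓘(ℝ, G) 𝓘(ℝ, E') (f ∘ Subtype.val) u)
  rw [h1]
  exact h2

theorem isSmoothSubmersion_codRestrict (U : Opens T) {f : W → T} (hf : IsSmoothSubmersion E' G f)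
    (hU : ∀ w, f w ∈ U) : IsSmoothSubmersion E' G (fun w => (⟨f w, hU w⟩ : U)) := by
  have key : ∀ w, ContMDiffAt 𝓘(ℝ, E') 𝓘(ℝ, G) ∞ (fun w => (⟨f w, hU w⟩ : U)) w ∧
      Function.Surjective (mfderiv 𝓘(ℝ, E') 𝓘(ℝ, G) (fun w => (⟨f w, hU w⟩ : U)) w) := by
    intro w
    obtain ⟨g, hg, hg'⟩ := exists_retraction (G := G) U ⟨f w, hU w⟩
    have h0 : (fun w => (⟨f w, hU w⟩ : U)) = g ∘ f := funext fun w => (hg ⟨f w, hU w⟩).symm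
    have h1 := hg' ⟨f w, hU w⟩
    rw [h0]
    refine ⟨h1.1.comp w (hf.1 w), ?_⟩
    rw [mfderiv_comp w (h1.1.mdifferentiableAt (by simp)) ((hf.1 w).mdifferentiableAt (by simp))]
    exact h1.2.comp (hf.2 w)
  exact ⟨fun w => (key w).1, fun w => (key w).2⟩

theorem IsSmoothSubmersion.exists_section [FiniteDimensional ℝ E] [FiniteDimensional ℝ E']
    [IsManifold 𝓘(ℝ, E) ∞ V] [IsManifold 𝓘(ℝ, E') ∞ W] {f : V → W}
    (hf : IsSmoothSubmersion E E' f) (v : V) :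
    ∃ σ : W → V, σ (f v) = v ∧
      ∀ᶠ w in 𝓝 (f v), ContMDiffAt 𝓘(ℝ, E') 𝓘(ℝ, E) ∞ σ w ∧ f (σ w) = w := by
  obtain ⟨Θ, hv, hΘ, -, hΘs⟩ := hf.exists_normalForm v
  have h0 : (f v, (Θ v).2) = Θ v := Prod.ext (hΘ v hv).symm rfl
  have h1 : ContMDiff (M := W) 𝓘(ℝ, E') (𝓘(ℝ, E').prod
      𝓘(ℝ, EuclideanSpace ℝ (Fin (Module.finrank ℝ E - Module.finrank ℝ E')))) ∞
      (fun w => (w, (Θ v).2)) := contMDiff_id.prodMk contMDiff_const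
  have h2 : ∀ᶠ w in 𝓝 (f v), (w, (Θ v).2) ∈ Θ.target := by
    refine h1.continuous.continuousAt.eventually (Θ.open_target.mem_nhds ?_)
    change (f v, (Θ v).2) ∈ Θ.target
    rw [h0]
    exact Θ.map_source hv
  refine ⟨fun w => Θ.symm (w, (Θ v).2), ?_, ?_⟩
  · change Θ.symm (f v, (Θ v).2) = v
    rw [h0, Θ.left_inv hv]
  · filter_upwards [h2] with w hw
    refine ⟨(hΘs.contMDiffAt (Θ.open_target.mem_nhds hw)).comp w (h1 w), ?_⟩
    rw [← hΘ _ (Θ.map_target hw), Θ.right_inv hw]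

theorem contMDiffAt_symm_comp_chart [IsManifold 𝓘(ℝ, E) ∞ V] [IsManifold 𝓘(ℝ, E') ∞ W]
    {v₀ v : V} {w₀ : W} {δ : E → E'} (hv : v ∈ (chartAt E v₀).source)
    (hδ : ContDiffAt ℝ ∞ δ (chartAt E v₀ v)) (hw : δ (chartAt E v₀ v) ∈ (chartAt E' w₀).target) :
    ContMDiffAt 𝓘(ℝ, E) 𝓘(ℝ, E') ∞ (fun v => (chartAt E' w₀).symm (δ (chartAt E v₀ v))) v :=
  ContMDiffAt.comp (g := (chartAt E' w₀).symm) v (contMDiffAt_chart_symm_of_mem hw)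
    (ContMDiffAt.comp (g := δ) v (contMDiffAt_iff_contDiffAt.2 hδ) (contMDiffAt_chart_of_mem hv))

end General

/-! ### Germs carried by local sections. -/

section Carries

variable {m : ℕ} {M : Type u} [TopologicalSpace M] [ChartedSpace (Euc m) M]
  [IsManifold (𝓡 m) ∞ M]

/-- The germ of the map `φ` is carried by a local section of `W` through `w`. -/
def Carries (W : Span m M) (w : W.carrier) (φ : M → M) : Prop :=
  ∃ σ : M → W.carrier, σ (W.p w) = w ∧ ∀ᶠ x in 𝓝 (W.p w),
    ContMDiffAt (𝓡 m) 𝓘(ℝ, W.model) ∞ σ x ∧ W.p (σ x) = x ∧ W.q (σ x) = φ x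

variable {W W' : Span m M} {w : W.carrier} {w' : W'.carrier} {φ : M → M}

/-- The germ is `q ∘ σ` for a local section `σ` of the submersion `p`. It need not be unique, since
different sections through `w` may give different germs. -/
theorem exists_carries (W : Span m M) (w : W.carrier) : ∃ φ, Carries W w φ := by
  obtain ⟨σ, h1, h2⟩ := W.submersion_p.exists_section w
  exact ⟨fun x => W.q (σ x), σ, h1, h2.mono fun x hx => ⟨hx.1, hx.2, rfl⟩⟩

theorem Carries.apply_eq (h : Carries W w φ) : φ (W.p w) = W.q w := by
  obtain ⟨σ, h1, h2⟩ := h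
  rw [← h2.self_of_nhds.2.2, h1]

theorem Carries.congr (h : Carries W w φ) {ψ : M → M} (hψ : ψ =ᶠ[𝓝 (W.p w)] φ) :
    Carries W w ψ := by
  obtain ⟨σ, h1, h2⟩ := h
  refine ⟨σ, h1, ?_⟩
  filter_upwards [h2, hψ] with x hx hx'
  exact ⟨hx.1, hx.2.1, hx.2.2.trans hx'.symm⟩

theorem Carries.continuousAt_section {σ : M → W.carrier} (h : ∀ᶠ x in 𝓝 (W.p w),
    ContMDiffAt (𝓡 m) 𝓘(ℝ, W.model) ∞ σ x ∧ W.p (σ x) = x ∧ W.q (σ x) = φ x) :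
    ContinuousAt σ (W.p w) :=
  h.self_of_nhds.1.continuousAt

/-- A section of `W` is transported by a local section of `δ` followed by `η`. -/
theorem LocEq.carries (h : LocEq W w W' w') (hφ : Carries W w φ) : Carries W' w' φ := by
  obtain ⟨V, v, δ, η, hδ, hη, hp, hq, rfl, rfl⟩ := h
  obtain ⟨σ, h1, h2⟩ := hφ
  obtain ⟨s, h3, h4⟩ := hδ.exists_section v
  refine ⟨fun x => η (s (σ x)), ?_, ?_⟩
  · change η (s (σ (W'.p (η v)))) = η v
    rw [← hp, h1, h3]
  · rw [← hp]
    have h5 : Filter.Tendsto σ (𝓝 (W.p (δ v))) (𝓝 (δ v)) := by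
      have := Carries.continuousAt_section h2
      rwa [ContinuousAt, h1] at this
    filter_upwards [h2, h5.eventually h4] with x hx hx'
    refine ⟨(hη.1 _).comp x (hx'.1.comp x hx.1), ?_, ?_⟩
    · rw [← hp, hx'.2, hx.2.1]
    · rw [← hq, hx'.2, hx.2.2]

theorem Carries.comp {V : Span m M} {v : V.carrier} {ψ : M → M} (hV : Carries V v φ)
    (hW : Carries W w ψ) (h : V.q v = W.p w) :
    Carries (V.comp W) (⟨v, w, h⟩ : FiberProduct V.q W.p) (fun x => ψ (φ x)) := by
  classical
  obtain ⟨σ, hσ, hσ'⟩ := hV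
  obtain ⟨τ, hτ, hτ'⟩ := hW
  let ρ : M → (V.comp W).carrier := fun x =>
    if h' : V.q (σ x) = W.p (τ (V.q (σ x))) then (⟨σ x, τ (V.q (σ x)), h'⟩ : FiberProduct V.q W.p)
    else (⟨v, w, h⟩ : FiberProduct V.q W.p)
  have hc : Filter.Tendsto (fun x => V.q (σ x)) (𝓝 (V.p v)) (𝓝 (W.p w)) := by
    have h1 := V.submersion_q.1.continuous.continuousAt.comp (Carries.continuousAt_section hσ')
    rw [ContinuousAt, Function.comp_apply, hσ, h] at h1
    exact h1
  have hρ : ∀ᶠ x in 𝓝 (V.p v), FiberProduct.fst (ρ x) = σ x ∧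
      FiberProduct.snd (ρ x) = τ (V.q (σ x)) := by
    filter_upwards [hc.eventually hτ'] with x hx
    have h1 : ρ x = (⟨σ x, τ (V.q (σ x)), hx.2.1.symm⟩ : FiberProduct V.q W.p) :=
      dif_pos hx.2.1.symm
    rw [h1]
    exact ⟨rfl, rfl⟩
  refine ⟨ρ, ?_, ?_⟩
  · change ρ (V.p v) = _
    have h1 := hρ.self_of_nhds
    rw [hσ, h, hτ] at h1
    exact FiberProduct.ext h1.1 h1.2
  · change ∀ᶠ x in 𝓝 (V.p v), _
    filter_upwards [hρ.eventually_nhds, hc.eventually hτ', hσ'] with x hx hx' hx''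
    refine ⟨?_, ?_, ?_⟩
    · refine FiberProduct.contMDiffAt_of_components (F := V.model) V.submersion_q.1 W.submersion_p
        (f := ρ) ?_ ?_
      · exact hx''.1.congr_of_eventuallyEq (hx.mono fun y hy => hy.1)
      · exact (hx'.1.comp x ((V.submersion_q.1 _).comp x hx''.1)).congr_of_eventuallyEq
          (hx.mono fun y hy => hy.2)
    · change V.p (FiberProduct.fst (ρ x)) = x
      rw [hx.self_of_nhds.1, hx''.2.1]
    · change W.q (FiberProduct.snd (ρ x)) = ψ (φ x)
      rw [hx.self_of_nhds.2, hx'.2.2, hx''.2.2]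

/-- The associativity of the composition. -/
def Span.assoc (U V W : Span m M) (z : ((U.comp V).comp W).carrier) :
    (U.comp (V.comp W)).carrier :=
  let z' : FiberProduct (V.q ∘ FiberProduct.snd : FiberProduct U.q V.p → M) W.p := z
  (⟨z'.fst.fst, (⟨z'.fst.snd, z'.snd, z'.w⟩ : FiberProduct V.q W.p), z'.fst.w⟩ :
    FiberProduct U.q (V.p ∘ FiberProduct.fst : FiberProduct V.q W.p → M))

/-- The inverse of `Span.assoc`. -/
def Span.assocSymm (U V W : Span m M) (z : (U.comp (V.comp W)).carrier) :
    ((U.comp V).comp W).carrier :=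
  let z' : FiberProduct U.q (V.p ∘ FiberProduct.fst : FiberProduct V.q W.p → M) := z
  (⟨(⟨z'.fst, z'.snd.fst, z'.w⟩ : FiberProduct U.q V.p), z'.snd.snd, z'.snd.w⟩ :
    FiberProduct (V.q ∘ FiberProduct.snd : FiberProduct U.q V.p → M) W.p)

theorem Span.contMDiff_comp_fst (V W : Span m M) :
    ContMDiff 𝓘(ℝ, (V.comp W).model) 𝓘(ℝ, V.model) ∞
      (fun z : (V.comp W).carrier => (FiberProduct.fst z : V.carrier)) :=
  FiberProduct.contMDiff_fst V.submersion_q.1 W.submersion_p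

theorem Span.contMDiff_comp_snd (V W : Span m M) :
    ContMDiff 𝓘(ℝ, (V.comp W).model) 𝓘(ℝ, W.model) ∞
      (fun z : (V.comp W).carrier => (FiberProduct.snd z : W.carrier)) :=
  FiberProduct.contMDiff_snd V.submersion_q.1 W.submersion_p

theorem Span.contMDiff_comp_of_components {G T : Type*} [NormedAddCommGroup G] [NormedSpace ℝ G]
    [TopologicalSpace T] [ChartedSpace G T] (V W : Span m M) {f : T → (V.comp W).carrier}
    (h1 : ContMDiff 𝓘(ℝ, G) 𝓘(ℝ, V.model) ∞ (fun t => (FiberProduct.fst (f t) : V.carrier)))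
    (h2 : ContMDiff 𝓘(ℝ, G) 𝓘(ℝ, W.model) ∞ (fun t => (FiberProduct.snd (f t) : W.carrier))) :
    ContMDiff 𝓘(ℝ, G) 𝓘(ℝ, (V.comp W).model) ∞ f := fun t =>
  FiberProduct.contMDiffAt_of_components (F := V.model) V.submersion_q.1 W.submersion_p (f := f)
    (h1 t) (h2 t)

theorem Span.isSmoothSubmersion_assoc (U V W : Span m M) :
    IsSmoothSubmersion ((U.comp V).comp W).model (U.comp (V.comp W)).model (U.assoc V W) := by
  refine .of_inverse (g := U.assocSymm V W) ?_ ?_ (fun _ => rfl) fun _ => rfl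
  · refine U.contMDiff_comp_of_components (V.comp W) ?_ (V.contMDiff_comp_of_components W ?_ ?_)
    · exact (U.contMDiff_comp_fst V).comp ((U.comp V).contMDiff_comp_fst W)
    · exact (U.contMDiff_comp_snd V).comp ((U.comp V).contMDiff_comp_fst W)
    · exact (U.comp V).contMDiff_comp_snd W
  · refine (U.comp V).contMDiff_comp_of_components W (U.contMDiff_comp_of_components V ?_ ?_) ?_
    · exact U.contMDiff_comp_fst (V.comp W)
    · exact (V.contMDiff_comp_fst W).comp (U.contMDiff_comp_snd (V.comp W))
    · exact (V.contMDiff_comp_snd W).comp (U.contMDiff_comp_snd (V.comp W))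

theorem LocEq.assoc (U V W : Span m M) (z : ((U.comp V).comp W).carrier) :
    LocEq ((U.comp V).comp W) z (U.comp (V.comp W)) (U.assoc V W z) :=
  ⟨((U.comp V).comp W).toPureManifold, z, id, U.assoc V W, isSmoothSubmersion_id,
    U.isSmoothSubmersion_assoc V W, fun _ => rfl, fun _ => rfl, rfl, rfl⟩

end Carries

/-! ### Lifting exponentials to a bi-submersion, on manifolds. -/

section FlowLift

attribute [local instance] chartedSpaceProd chartedSpaceOpens

variable {m : ℕ} {M : Type u} [TopologicalSpace M] [ChartedSpace (Euc m) M] {n : ℕ}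

theorem contMDiff_fst_prod :
    ContMDiff 𝓘(ℝ, Euc m × Euc n) (𝓡 m) ∞ (Prod.fst : M × Euc n → M) := by
  rw [modelWithCornersSelf_prod]
  exact contMDiff_fst (I := 𝓡 m) (J := 𝓡 n)

theorem contMDiff_snd_prod :
    ContMDiff 𝓘(ℝ, Euc m × Euc n) (𝓡 n) ∞ (Prod.snd : M × Euc n → Euc n) := by
  rw [modelWithCornersSelf_prod]
  exact contMDiff_snd (I := 𝓡 m) (J := 𝓡 n)

theorem ContMDiffAt.prodMk_prod {G T : Type*} [NormedAddCommGroup G] [NormedSpace ℝ G]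
    [TopologicalSpace T] [ChartedSpace G T] {f : T → M} {g : T → Euc n} {t : T}
    (hf : ContMDiffAt 𝓘(ℝ, G) (𝓡 m) ∞ f t) (hg : ContMDiffAt 𝓘(ℝ, G) (𝓡 n) ∞ g t) :
    ContMDiffAt 𝓘(ℝ, G) 𝓘(ℝ, Euc m × Euc n) ∞ (fun t => (f t, g t)) t := by
  rw [modelWithCornersSelf_prod]
  exact hf.prodMk hg

variable [IsManifold (𝓡 m) ∞ M]

/-- The coordinate version `_root_.exists_flow_lift` is applied to a section of `W` carrying `φ`,
and the result is read back through the charts. The last clause makes `δ` a submersion when the `Ξ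
i` span `ker Tp` at `w`: the section supplies the complementary directions. -/
theorem Span.exists_flow_lift (W : Span m M) {w : W.carrier} {φ : M → M} (hφ : Carries W w φ)
    {Ξ : Fin n → W.model → W.model} {Y : Fin n → Euc m → Euc m}
    (hΞ : ∀ i, SmoothNear (Ξ i) (chartAt W.model w w))
    (hlift : ∀ᶠ z in 𝓝 (chartAt W.model w w), ∀ i,
      fderiv ℝ (localMap W.model (Euc m) w (W.p w) W.p) z (Ξ i z) = 0 ∧
      fderiv ℝ (localMap W.model (Euc m) w (W.q w) W.q) z (Ξ i z) =
        Y i (localMap W.model (Euc m) w (W.q w) W.q z))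
    {Ψ : Euc m × Euc n → Euc m} (hΨ : ExpNear Y (chartAt (Euc m) (W.q w) (W.q w)) Ψ) :
    ∃ δ : M × Euc n → W.carrier, δ (W.p w, 0) = w ∧
      (∀ᶠ z in 𝓝 (W.p w, (0 : Euc n)),
        ContMDiffAt 𝓘(ℝ, Euc m × Euc n) 𝓘(ℝ, W.model) ∞ δ z ∧ W.p (δ z) = z.1 ∧
        chartAt (Euc m) (W.q w) (W.q (δ z)) = Ψ (chartAt (Euc m) (W.q w) (φ z.1), z.2) ∧
        W.q (δ z) ∈ (chartAt (Euc m) (W.q w)).source) ∧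
      ((∀ v, fderiv ℝ (localMap W.model (Euc m) w (W.p w) W.p) (chartAt W.model w w) v = 0 →
        ∃ b, v = fieldComb Ξ (chartAt W.model w w, b)) → ∀ᶠ z in 𝓝 (W.p w, (0 : Euc n)),
        Function.Surjective (mfderiv 𝓘(ℝ, Euc m × Euc n) 𝓘(ℝ, W.model) δ z)) := by
  have := isManifold_prod (m := m) (M := M) (n := n)
  obtain ⟨σ, hσw, hσ⟩ := hφ
  let ψ := chartAt W.model w
  let χ := chartAt (Euc m) (W.p w)
  let χ' := chartAt (Euc m) (W.q w)
  let Z := chartAt (Euc m × Euc n) (W.p w, (0 : Euc n))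
  have hZ : ∀ z, Z z = (χ z.1, z.2) := fun z => rfl
  have hZs : ∀ u, Z.symm u = (χ.symm u.1, u.2) := fun u => rfl
  have hps := W.submersion_p.smoothNear_localMap w
  have hqs := W.submersion_q.smoothNear_localMap w
  have hψw : w ∈ ψ.source := mem_chart_source _ w
  have hχw : W.p w ∈ χ.source := mem_chart_source _ _
  have hχ'w : W.q w ∈ χ'.source := mem_chart_source _ _
  have hσs : SmoothNear (localMap (Euc m) W.model (W.p w) w σ) (χ (W.p w)) :=
    _root_.smoothNear_localMap (hσ.mono fun x hx => hx.1) hχw (by rw [hσw]; exact hψw)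
  have hσ0 : localMap (Euc m) W.model (W.p w) w σ (χ (W.p w)) = ψ w := by
    rw [localMap_chart (E' := W.model) hχw, hσw]
  have hσc : Filter.Tendsto σ (𝓝 (W.p w)) (𝓝 w) := by
    have h1 := Carries.continuousAt_section hσ
    rwa [ContinuousAt, hσw] at h1
  have hσp : ∀ᶠ x in 𝓝 (χ (W.p w)), localMap W.model (Euc m) w (W.p w) W.p
      (localMap (Euc m) W.model (W.p w) w σ x) = x := by
    filter_upwards [eventually_symm_chart hχw (hσ.and
      (hσc.eventually (ψ.open_source.mem_nhds hψw)))] with x hx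
    change χ (W.p (ψ.symm (ψ (σ (χ.symm x))))) = x
    rw [ψ.left_inv hx.2.2, hx.2.1.2.1, χ.right_inv hx.1]
  have hbase : localMap W.model (Euc m) w (W.q w) W.q (ψ w) = χ' (W.q w) :=
    localMap_chart (E' := Euc m) hψw _ _
  rw [← hbase] at hΨ
  obtain ⟨δ, hδ, hδ0, hδpq, hδ'⟩ := _root_.exists_flow_lift hps hqs hΞ hlift hΨ hσs hσ0 hσp
  have hZw : Z (W.p w, 0) = (χ (W.p w), 0) := rfl
  have hZsrc : (W.p w, (0 : Euc n)) ∈ Z.source := mem_chart_source _ _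
  rw [← hZw] at hδ hδpq
  have hδt : Filter.Tendsto δ (𝓝 (Z (W.p w, 0))) (𝓝 (ψ w)) := by
    have h1 := hδ.continuousAt.tendsto
    rwa [hZw, hδ0] at h1
  have hψs : Filter.Tendsto ψ.symm (𝓝 (ψ w)) (𝓝 w) := by
    have h1 := ψ.symm.continuousAt (ψ.map_source hψw)
    rwa [ContinuousAt, ψ.left_inv hψw] at h1
  have hgood : ∀ᶠ u in 𝓝 (Z (W.p w, 0)), δ u ∈ ψ.target ∧
      W.p (ψ.symm (δ u)) ∈ χ.source ∧ W.q (ψ.symm (δ u)) ∈ χ'.source :=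
    hδt.eventually ((Filter.eventually_mem_set.2 (ψ.open_target.mem_nhds (ψ.map_source hψw))).and
      (hψs.eventually ((W.submersion_p.1.continuous.continuousAt.eventually
        (χ.open_source.mem_nhds hχw)).and (W.submersion_q.1.continuous.continuousAt.eventually
          (χ'.open_source.mem_nhds hχ'w)))))
  have hsm : ∀ᶠ z in 𝓝 (W.p w, (0 : Euc n)),
      ContMDiffAt 𝓘(ℝ, Euc m × Euc n) 𝓘(ℝ, W.model) ∞ (fun z => ψ.symm (δ (Z z))) z := by
    filter_upwards [eventually_chart hZsrc (hδ.and hgood)] with z hz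
    exact contMDiffAt_symm_comp_chart hz.1 hz.2.1 hz.2.2.1
  refine ⟨fun z => ψ.symm (δ (Z z)), ?_, ?_, fun hspan => ?_⟩
  · change ψ.symm (δ (Z (W.p w, 0))) = w
    rw [hZw, hδ0, ψ.left_inv hψw]
  · have hσe : ∀ᶠ z in 𝓝 (W.p w, (0 : Euc n)), z.1 ∈ χ.source ∧ σ z.1 ∈ ψ.source ∧
        W.q (σ z.1) = φ z.1 :=
      ((Filter.eventually_mem_set.2 (χ.open_source.mem_nhds hχw)).and
        ((hσc.eventually (ψ.open_source.mem_nhds hψw)).and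
          (hσ.mono fun x hx => hx.2.2))).prod_inl_nhds 0
    filter_upwards [hsm, eventually_chart hZsrc (hδpq.and hgood), hσe] with z h1 h2 h3
    obtain ⟨-, ⟨h4, h5⟩, h6, h7, h8⟩ := h2
    refine ⟨h1, ?_, ?_, h8⟩
    · have h9 : χ (W.p (ψ.symm (δ (Z z)))) = χ z.1 := h4
      exact χ.injOn h7 h3.1 h9
    · refine Eq.trans h5 ?_
      rw [hZ]
      simp only [localMap]
      rw [χ.left_inv h3.1, ψ.left_inv h3.2.1, h3.2.2]
  · have hsurj : Function.Surjective (fderiv ℝ δ (Z (W.p w, 0))) := by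
      intro v
      have hσd := fderiv_comp_eventuallyEq hσs (by rw [hσ0]; exact hps) contDiff_id.smoothNear
        contDiff_id.smoothNear hσp
      have h1 := hσd.self_of_nhds (fderiv ℝ (localMap W.model (Euc m) w (W.p w) W.p) (ψ w) v)
      rw [hσ0] at h1
      simp only [fderiv_id, ContinuousLinearMap.id_apply] at h1
      -- Subtracting from `v` the lift of `Tp v` along the section leaves a vector of `ker Tp`,
      -- which is a combination of the `Ξ i`.
      obtain ⟨b, hb⟩ := hspan (v - fderiv ℝ (localMap (Euc m) W.model (W.p w) w σ) (χ (W.p w))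
        (fderiv ℝ (localMap W.model (Euc m) w (W.p w) W.p) (ψ w) v)) (by
          rw [map_sub, sub_eq_zero]
          exact h1.symm)
      refine ⟨(fderiv ℝ (localMap W.model (Euc m) w (W.p w) W.p) (ψ w) v, b), ?_⟩
      rw [hZw, hδ', ← hb]
      abel
    obtain ⟨R, -, hR⟩ := hδ.fderiv.exists_rightInverse hsurj
    have hloc : ∀ᶠ u in 𝓝 (Z (W.p w, 0)), localMap (Euc m × Euc n) W.model (W.p w, (0 : Euc n)) w
        (fun z => ψ.symm (δ (Z z))) u = δ u := by
      filter_upwards [hgood, Z.open_target.mem_nhds (Z.map_source hZsrc)] with u h1 h2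
      change ψ (ψ.symm (δ (Z (Z.symm u)))) = δ u
      rw [Z.right_inv h2, ψ.right_inv h1.1]
    filter_upwards [hsm, eventually_chart hZsrc ((hR.and hloc.eventually_nhds).and hgood)]
      with z h1 h2
    refine surjective_mfderiv_of_localMap h1 h2.1 (w₀ := w) (ψ.map_target h2.2.2.1) fun v =>
      ⟨R (Z z) v, ?_⟩
    rw [Filter.EventuallyEq.fderiv_eq h2.2.1.2]
    exact h2.2.1.1 v

end FlowLift

end

noncomputable section

/-! ### Bi-submersions carrying a common germ are locally equivalent. -/

section Key

attribute [local instance] chartedSpaceProd chartedSpaceOpens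

variable {m : ℕ} {M : Type u} [TopologicalSpace M] [ChartedSpace (Euc m) M] {n : ℕ}
  [IsManifold (𝓡 m) ∞ M] [T2Space M] [SecondCountableTopology M]

/-- An open subset of `M × ℝⁿ` as a manifold. -/
def opensManifold (V : Opens (M × Euc n)) : PureManifold.{u} where
  model := Euc m × Euc n
  carrier := V
  manifold := isManifold_opens V

theorem LocEq.of_eventually {W W' : Span m M} {w : W.carrier} {w' : W'.carrier} {z₀ : M × Euc n}
    {δ : M × Euc n → W.carrier} {δ' : M × Euc n → W'.carrier} (hw : δ z₀ = w) (hw' : δ' z₀ = w')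
    (h : ∀ᶠ z in 𝓝 z₀, (ContMDiffAt 𝓘(ℝ, Euc m × Euc n) 𝓘(ℝ, W.model) ∞ δ z ∧
      Function.Surjective (mfderiv 𝓘(ℝ, Euc m × Euc n) 𝓘(ℝ, W.model) δ z)) ∧
      (ContMDiffAt 𝓘(ℝ, Euc m × Euc n) 𝓘(ℝ, W'.model) ∞ δ' z ∧
      Function.Surjective (mfderiv 𝓘(ℝ, Euc m × Euc n) 𝓘(ℝ, W'.model) δ' z)) ∧
      W.p (δ z) = W'.p (δ' z) ∧ W.q (δ z) = W'.q (δ' z)) : LocEq W w W' w' := by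
  obtain ⟨V, hz₀, hV⟩ := exists_opens_of_eventually h
  have h1 := isSmoothSubmersion_restrict V fun u hu => (hV u hu).1
  have h2 := isSmoothSubmersion_restrict V fun u hu => (hV u hu).2.1
  exact ⟨opensManifold V, (⟨z₀, hz₀⟩ : V), fun z : V => δ z.1, fun z : V => δ' z.1, h1, h2,
    fun z : V => (hV z.1 z.2).2.2.1, fun z : V => (hV z.1 z.2).2.2.2, hw, hw'⟩

theorem fieldComb_reindex {E ι : Type} [NormedAddCommGroup E] [NormedSpace ℝ E] [Fintype ι]
    (e : ι ≃ Fin n) (A : ι → E → E) (z : E) (t : Euc n) :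
    fieldComb (fun j => A (e.symm j)) (z, t) = ∑ i, t (e i) • A i z := by
  rw [fieldComb, ← e.sum_comp]
  simp

variable {F : SingularFoliation m M}

/-- Two bi-submersions are locally equivalent at points at which they carry a common germ. -/
theorem LocEq.of_carries {W W' : Span m M} (hW : W.IsBiSubmersion F) (hW' : W'.IsBiSubmersion F)
    {w : W.carrier} {w' : W'.carrier} {φ : M → M} (h : Carries W w φ) (h' : Carries W' w' φ)
    (hp : W.p w = W'.p w') : LocEq W w W' w' := by
  have hq : W.q w = W'.q w' := by rw [← h.apply_eq, hp, h'.apply_eq]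
  obtain ⟨O, n, X, hO, hX⟩ := F.exists_generates (W.q w)
  obtain ⟨k, ξ, ζ, hξ, hζ, hξ', hζ', hspan⟩ :=
    (hW.chartKerImage hX hO).exists_spanning (W.submersion_p.smoothNear_localMap w)
      (surjective_fderiv_localMap W.submersion_p (mem_chart_source _ _) (mem_chart_source _ _))
  have hO' := hO
  rw [hq] at hO'
  obtain ⟨k', ξ₁, ζ₁, hξ₁, hζ₁, hξ₁', hζ₁', hspan₁⟩ :=
    (hW'.chartKerImage hX hO').exists_spanning (W'.submersion_p.smoothNear_localMap w')
      (surjective_fderiv_localMap W'.submersion_p (mem_chart_source _ _) (mem_chart_source _ _))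
  -- A common parameter space: `n` coefficients for the lifted generators, `k` for the fields `ζ`,
  -- which act only on `W`, and `k'` for the fields `ζ₁`, which act only on `W'`. The last two
  -- blocks act trivially on `M`.
  let e := Fintype.equivFin (Fin n ⊕ Fin k ⊕ Fin k')
  let A : Fin n ⊕ Fin k ⊕ Fin k' → W.model → W.model := Sum.elim ξ (Sum.elim ζ fun _ _ => 0)
  let A₁ : Fin n ⊕ Fin k ⊕ Fin k' → W'.model → W'.model :=
    Sum.elim ξ₁ (Sum.elim (fun _ _ => 0) ζ₁)
  let B : Fin n ⊕ Fin k ⊕ Fin k' → Euc m → Euc m :=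
    Sum.elim (fun i => localField (W.q w) (X i)) (Sum.elim (fun _ _ => 0) fun _ _ => 0)
  have hB : ∀ i, SmoothNear (B i) (chartAt (Euc m) (W.q w) (W.q w)) := by
    rintro (i | j | j)
    · exact smoothNear_localField (F.smooth _ _ (hX.1 i)) hO (mem_chart_source _ _)
    · exact SmoothNear.const _
    · exact SmoothNear.const _
  -- The same exponential on `M` is used for both lifts, so the two maps to `M` agree after both
  -- submersions.
  obtain ⟨Ψ, hΨ⟩ := exists_expNear fun j => hB (e.symm j)
  obtain ⟨δ, hδ0, hδ, hδs⟩ := W.exists_flow_lift h (Ξ := fun j => A (e.symm j))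
    (Y := fun j => B (e.symm j)) (fun j => by
      rcases e.symm j with i | j | j
      · exact hξ i
      · exact hζ j
      · exact SmoothNear.const _) (by
      filter_upwards [hξ', hζ'] with z h1 h2 j
      rcases e.symm j with i | j | j
      · exact h1 i
      · exact h2 j
      · exact ⟨map_zero _, map_zero _⟩) hΨ
  have hΨ₁ := hΨ
  rw [hq] at hΨ₁
  obtain ⟨δ₁, hδ0₁, hδ₁, hδs₁⟩ := W'.exists_flow_lift h' (Ξ := fun j => A₁ (e.symm j))
    (Y := fun j => B (e.symm j)) (fun j => by
      rcases e.symm j with i | j | j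
      · exact hξ₁ i
      · exact SmoothNear.const _
      · exact hζ₁ j) (by
      filter_upwards [hξ₁', hζ₁'] with z h1 h2 j
      rcases e.symm j with i | j | j
      · have h3 := h1 i
        rw [← hq] at h3 ⊢
        exact h3
      · exact ⟨map_zero _, map_zero _⟩
      · exact h2 j) hΨ₁
  have hs := hδs fun v hv => by
    obtain ⟨a, b, hab⟩ := hspan v hv
    refine ⟨WithLp.toLp 2 fun j => Sum.elim a (Sum.elim b 0) (e.symm j), ?_⟩
    rw [fieldComb_reindex, hab]
    simp [A, Fintype.sum_sum_type]
  have hs₁ := hδs₁ fun v hv => by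
    obtain ⟨a, b, hab⟩ := hspan₁ v hv
    refine ⟨WithLp.toLp 2 fun j => Sum.elim a (Sum.elim 0 b) (e.symm j), ?_⟩
    rw [fieldComb_reindex, hab]
    simp [A₁, Fintype.sum_sum_type]
  rw [← hp] at hδ0₁ hδ₁ hs₁
  refine LocEq.of_eventually hδ0 hδ0₁ ?_
  filter_upwards [hδ, hδ₁, hs, hs₁] with z h1 h2 h3 h4
  refine ⟨⟨h1.1, h3⟩, ⟨h2.1, h4⟩, h1.2.1.trans h2.2.1.symm, ?_⟩
  have h5 := h2.2.2
  rw [← hq] at h5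
  exact (chartAt (Euc m) (W.q w)).injOn h1.2.2.2 h5.2 (h1.2.2.1.trans h5.1.symm)

/-- Both composites carry the composite of the germs carried by the factors, so `LocEq.of_carries`
applies and no fibre product of the given equivalences has to be formed. -/
theorem LocEq.comp {V V' W W' : Span m M} (hV : V.IsBiSubmersion F) (hV' : V'.IsBiSubmersion F)
    (hW : W.IsBiSubmersion F) (hW' : W'.IsBiSubmersion F) {v : V.carrier} {v' : V'.carrier}
    {w : W.carrier} {w' : W'.carrier} (h₁ : LocEq V v V' v') (h₂ : LocEq W w W' w')
    (h : V.q v = W.p w) (h' : V'.q v' = W'.p w') :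
    LocEq (V.comp W) (⟨v, w, h⟩ : FiberProduct V.q W.p) (V'.comp W')
      (⟨v', w', h'⟩ : FiberProduct V'.q W'.p) := by
  obtain ⟨φ, hφ⟩ := exists_carries V v
  obtain ⟨ψ, hψ⟩ := exists_carries W w
  exact LocEq.of_carries (hV.comp hW) (hV'.comp hW') (hφ.comp hψ h)
    ((h₁.carries hφ).comp (h₂.carries hψ) h') h₁.p_eq

end Key

end

noncomputable section

/-! ### Reduction of the dimension. -/

section Reduction

attribute [local instance] chartedSpaceProd chartedSpaceOpens

variable {m : ℕ} {M : Type u} [TopologicalSpace M] [ChartedSpace (Euc m) M]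
  [IsManifold (𝓡 m) ∞ M]

theorem isSmoothSubmersion_prodMap {N r : ℕ} {L : Euc N →L[ℝ] Euc r} {L' : Euc r →L[ℝ] Euc N}
    (h : ∀ t, L (L' t) = t) :
    IsSmoothSubmersion (Euc m × Euc N) (Euc m × Euc r)
      (fun z : M × Euc N => (z.1, L z.2)) := by
  have h1 : ContMDiff 𝓘(ℝ, Euc m × Euc N) 𝓘(ℝ, Euc m × Euc r) ∞
      (fun z : M × Euc N => (z.1, L z.2)) := fun z =>
    ContMDiffAt.prodMk_prod (contMDiff_fst_prod z)
      (ContMDiffAt.comp (g := L) z (L.contMDiff _) (contMDiff_snd_prod z))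
  refine ⟨h1, fun z => ?_⟩
  have h2 : ContMDiff 𝓘(ℝ, Euc m × Euc r) 𝓘(ℝ, Euc m × Euc N) ∞
      (fun y : M × Euc r => (y.1, L' y.2 + (z.2 - L' (L z.2)))) := fun y =>
    ContMDiffAt.prodMk_prod (contMDiff_fst_prod y)
      (ContMDiffAt.comp (g := fun t => L' t + (z.2 - L' (L z.2))) y
        ((L'.contDiff.add contDiff_const).contMDiff _) (contMDiff_snd_prod y))
  have h3 : (z.1, L' (L z.2) + (z.2 - L' (L z.2))) = z := by simp
  have h4 := mfderiv_surjective_of_section (f := fun z : M × Euc N => (z.1, L z.2))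
    (y := ((z.1, L z.2) : M × Euc r)) ((h1 _).mdifferentiableAt (by simp))
    ((h2 _).mdifferentiableAt (by simp)) (.of_forall fun y => by simp [h])
  dsimp only at h4
  rwa [h3] at h4

variable [T2Space M] [SecondCountableTopology M]

/-- If the second projection of a chart `δ : M × ℝᴺ → W` of a bi-submersion factors through
`M × ℝʳ`, then `W` is locally equivalent to an open subset of `M × ℝʳ`. -/
theorem Span.exists_reduction (W : Span m M) {N r : ℕ} {δ : M × Euc N → W.carrier}
    {L : Euc N →L[ℝ] Euc r} {L' : Euc r →L[ℝ] Euc N} (hL : ∀ t, L (L' t) = t)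
    {V₀ : Opens (M × Euc N)}
    (hδ : ∀ z ∈ V₀, ContMDiffAt 𝓘(ℝ, Euc m × Euc N) 𝓘(ℝ, W.model) ∞ δ z ∧
      Function.Surjective (mfderiv 𝓘(ℝ, Euc m × Euc N) 𝓘(ℝ, W.model) δ z))
    (hp : ∀ z ∈ V₀, W.p (δ z) = z.1)
    (hq : ∀ z ∈ V₀, ∀ z' ∈ V₀, z.1 = z'.1 → L z.2 = L z'.2 → W.q (δ z) = W.q (δ z'))
    {x : M} (hx : (x, 0) ∈ V₀) :
    ∃ T : Span m M, T.dim = r + m ∧ (∃ t, LocEq W (δ (x, 0)) T t) ∧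
      ∀ t, ∃ w, LocEq W w T t := by
  let ι : M × Euc r → M × Euc N := fun z => (z.1, L' z.2)
  let η : M × Euc N → M × Euc r := fun z => (z.1, L z.2)
  have hηι : ∀ t, η (ι t) = t := fun t => by simp [η, ι, hL]
  have hι : ContMDiff 𝓘(ℝ, Euc m × Euc r) 𝓘(ℝ, Euc m × Euc N) ∞ ι := fun z =>
    ContMDiffAt.prodMk_prod (contMDiff_fst_prod z)
      (ContMDiffAt.comp (g := L') z (L'.contMDiff _) (contMDiff_snd_prod z))
  have hη : IsSmoothSubmersion (Euc m × Euc N) (Euc m × Euc r) η := isSmoothSubmersion_prodMap hL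
  let T₀ : Opens (M × Euc r) := ⟨ι ⁻¹' V₀, V₀.isOpen.preimage hι.continuous⟩
  -- On `V` both `z` and its normalisation `ι (η z)` lie in `V₀`, and `q ∘ δ` has the same value at
  -- both by `hq`.
  let V : Opens (M × Euc N) :=
    ⟨V₀ ∩ η ⁻¹' T₀, V₀.isOpen.inter (T₀.isOpen.preimage hη.1.continuous)⟩
  have hιV : ∀ t ∈ T₀, ι t ∈ V := fun t ht => ⟨ht, by change η (ι t) ∈ T₀; rwa [hηι]⟩
  have hqV : ∀ z ∈ V, W.q (δ (ι (η z))) = W.q (δ z) := fun z hz =>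
    hq _ hz.2 _ hz.1 rfl (hL _)
  have hqs : ∀ t ∈ T₀, ContMDiffAt 𝓘(ℝ, Euc m × Euc r) (𝓡 m) ∞ (fun t => W.q (δ (ι t))) t ∧
      Function.Surjective (mfderiv 𝓘(ℝ, Euc m × Euc r) (𝓡 m) (fun t => W.q (δ (ι t))) t) := by
    intro t ht
    have h1 := hδ (ι t) ht
    have h2 : ContMDiffAt 𝓘(ℝ, Euc m × Euc N) (𝓡 m) ∞ (fun z => W.q (δ z)) (ι t) :=
      ContMDiffAt.comp (g := W.q) _ (W.submersion_q.1 _) h1.1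
    have h3 : ContMDiffAt 𝓘(ℝ, Euc m × Euc r) (𝓡 m) ∞ (fun t => W.q (δ (ι t))) t :=
      ContMDiffAt.comp (g := fun z => W.q (δ z)) t h2 (hι t)
    refine ⟨h3, ?_⟩
    have h4 := mfderiv_comp (ι t) (g := W.q) ((W.submersion_q.1 _).mdifferentiableAt (by simp))
      (h1.1.mdifferentiableAt (by simp))
    have h5 := (W.submersion_q.2 (δ (ι t))).comp h1.2
    -- The right side is a submersion at `ι t`, so the outer factor on the left has surjective
    -- differential.
    have h6 : (fun t => W.q (δ (ι t))) ∘ η =ᶠ[𝓝 (ι t)] W.q ∘ δ := by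
      filter_upwards [V.isOpen.mem_nhds (hιV t ht)] with z hz using hqV z hz
    have h7 := mfderiv_comp_of_eq (x := ι t) (y := t) (g := fun t => W.q (δ (ι t)))
      (h3.mdifferentiableAt (by simp)) ((hη.1 (ι t)).mdifferentiableAt (by simp)) (hηι t)
    suffices h : Function.Surjective (mfderiv 𝓘(ℝ, Euc m × Euc r) (𝓡 m)
        (fun t => W.q (δ (ι t))) (η (ι t))) by rwa [hηι] at h
    intro v
    obtain ⟨u, hu⟩ := h5 v
    refine ⟨mfderiv 𝓘(ℝ, Euc m × Euc N) 𝓘(ℝ, Euc m × Euc r) η (ι t) u, ?_⟩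
    have h9 := h6.mfderiv_eq (I := 𝓘(ℝ, Euc m × Euc N)) (I' := 𝓡 m)
    rw [h7, h4] at h9
    exact (DFunLike.congr_fun h9 u).trans hu
  let T : Span m M :=
    { model := Euc m × Euc r
      carrier := T₀
      manifold := isManifold_opens T₀
      p := fun z => z.1.1
      q := fun z => W.q (δ (ι z.1))
      submersion_p := isSmoothSubmersion_fst_opens T₀
      submersion_q := isSmoothSubmersion_restrict T₀ hqs }
  have hT : ∀ t : T₀, LocEq W (δ (ι t)) T t := by
    intro t
    have h1 := isSmoothSubmersion_restrict V fun u hu => hδ u hu.1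
    have h2 := isSmoothSubmersion_codRestrict T₀
      (hη.comp (isSmoothSubmersion_subtype_val (G := Euc m × Euc N) V)) fun z => z.2.2
    exact ⟨opensManifold V, (⟨ι t, hιV t t.2⟩ : V), fun z : V => δ z.1,
      fun z : V => (⟨η z.1, z.2.2⟩ : T₀), h1, h2, fun z : V => hp z.1 z.2.1,
      fun z : V => (hqV z.1 z.2).symm, rfl, Subtype.ext (hηι t)⟩
  have hx' : ι (x, 0) = (x, 0) := by simp [ι]
  have hx'' : ((x, 0) : M × Euc r) ∈ T₀ := by
    change ι (x, 0) ∈ V₀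
    rwa [hx']
  refine ⟨T, ?_, ⟨(⟨(x, 0), hx''⟩ : T₀), ?_⟩, fun t => ⟨_, hT t⟩⟩
  · change Module.finrank ℝ (Euc m × Euc r) = r + m
    simp [add_comm]
  · have h : ∀ y, y = ι (x, 0) → LocEq W (δ y) T (⟨(x, 0), hx''⟩ : T₀) := by
      rintro _ rfl
      exact hT ⟨(x, 0), hx''⟩
    exact h _ hx'.symm

/-- A minimal family of generators is padded with zero fields, so that the same number `r` can be
used at all points. -/
theorem SingularFoliation.exists_generates_of_rankAt_le (F : SingularFoliation m M) {x : M}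
    {r : ℕ} (h : F.rankAt x ≤ r) : ∃ (O : Opens M) (X : Fin r → VField (Euc m) M),
      x ∈ O ∧ F.Generates O X := by
  have h0 : {n | ∃ (U : Opens M) (X : Fin n → VField (Euc m) M),
      x ∈ U ∧ F.Generates U X}.Nonempty := by
    obtain ⟨O, n, X, hO, hX⟩ := F.exists_generates x
    exact ⟨n, O, X, hO, hX⟩
  obtain ⟨d, hd, O, X, hO, hX⟩ : ∃ d ≤ r, ∃ (O : Opens M) (X : Fin d → VField (Euc m) M),
      x ∈ O ∧ F.Generates O X := ⟨_, h, Nat.sInf_mem h0⟩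
  obtain ⟨k, rfl⟩ := Nat.exists_eq_add_of_le hd
  refine ⟨O, Fin.append X fun _ => 0, hO, fun i => ?_, fun V hV Y hY => ?_⟩
  · refine Fin.addCases (fun i => ?_) (fun i => ?_) i
    · rw [Fin.append_left]
      exact hX.1 i
    · rw [Fin.append_right]
      exact F.zero_mem O
  · obtain ⟨f, hf, hfY⟩ := hX.2 V hV Y hY
    refine ⟨Fin.append f fun _ => 0, fun i => ?_, fun y hy => ?_⟩
    · refine Fin.addCases (fun i => ?_) (fun i => ?_) i
      · rw [Fin.append_left]
        exact hf i
      · rw [Fin.append_right]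
        exact contMDiffOn_const
    · rw [hfY y hy, Fin.sum_univ_add]
      simp [Fin.append_left, Fin.append_right]

end Reduction

/-- The parameter acts only through `L`, so the same curves serve, with the Lipschitz constant
enlarged by the norm of the linear change of variables. -/
theorem ExpNear.comp_linear {F : Type} [NormedAddCommGroup F] [NormedSpace ℝ F] {n N : ℕ}
    {X : Fin n → F → F} {Y : Fin N → F → F} {y₀ : F} {Ψ : F × Euc n → F} (h : ExpNear X y₀ Ψ)
    (L : Euc N →L[ℝ] Euc n) (hY : ∀ y t, fieldComb Y (y, t) = fieldComb X (y, L t)) :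
    ExpNear Y y₀ fun z => Ψ (z.1, L z.2) := by
  obtain ⟨K, S, hS, hK, hΨ⟩ := h
  let A : F × Euc N →L[ℝ] F × Euc n := (ContinuousLinearMap.fst ℝ _ _).prod
    (L.comp (ContinuousLinearMap.snd ℝ _ _))
  have hA : Filter.Tendsto A (𝓝 (y₀, 0)) (𝓝 (y₀, 0)) := by
    have := A.continuous.tendsto (y₀, 0)
    simpa [A] using this
  have hYA : fieldComb Y = fieldComb X ∘ A := funext fun z => hY z.1 z.2
  refine ⟨K * ‖A‖₊, A ⁻¹' S, hA hS, ?_, ?_⟩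
  · rw [hYA]
    exact hK.comp A.lipschitz.lipschitzOnWith fun z hz => hz
  · filter_upwards [hA.eventually hΨ] with z ⟨c, h0, h1, hc⟩
    refine ⟨c, h0, h1, fun s hs => ⟨(hc s hs).1, ?_⟩⟩
    rw [hY]
    exact (hc s hs).2

section

variable {m : ℕ} {M : Type u} [TopologicalSpace M] [ChartedSpace (Euc m) M]
  [IsManifold (𝓡 m) ∞ M] [T2Space M] [SecondCountableTopology M] {F : SingularFoliation m M}

/-- A bi-submersion is locally equivalent to one of dimension `r + m` if `r` is at least the rank of
the foliation. -/
theorem Span.IsBiSubmersion.exists_locEq_dim_eq {W : Span m M} (hW : W.IsBiSubmersion F)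
    (w : W.carrier) {r : ℕ} (hr : F.rankAt (W.q w) ≤ r) :
    ∃ T : Span m M, T.IsBiSubmersion F ∧ T.dim = r + m ∧ (∃ t, LocEq W w T t) ∧
      ∀ t, ∃ w', LocEq W w' T t := by
  obtain ⟨φ, hφ⟩ := exists_carries W w
  obtain ⟨O, X, hO, hX⟩ := F.exists_generates_of_rankAt_le hr
  obtain ⟨k, ξ, ζ, hξ, hζ, hξ', hζ', hspan⟩ :=
    (hW.chartKerImage hX hO).exists_spanning (W.submersion_p.smoothNear_localMap w)
      (surjective_fderiv_localMap W.submersion_p (mem_chart_source _ _) (mem_chart_source _ _))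
  let e := Fintype.equivFin (Fin r ⊕ Fin k)
  let A : Fin r ⊕ Fin k → W.model → W.model := Sum.elim ξ ζ
  let B : Fin r ⊕ Fin k → Euc m → Euc m :=
    Sum.elim (fun i => localField (W.q w) (X i)) (fun _ _ => 0)
  obtain ⟨Ψ, hΨ⟩ := exists_expNear fun i =>
    smoothNear_localField (F.smooth _ _ (hX.1 i)) hO (mem_chart_source (Euc m) (W.q w))
  -- `L` forgets the coefficients of the `ζ`, and `L'` fills them with zeros. Since the `ζ` are
  -- related to zero on `M`, the exponential depends on the parameter only through `L`.
  let L : Euc (Fintype.card (Fin r ⊕ Fin k)) →L[ℝ] Euc r := LinearMap.toContinuousLinearMap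
    { toFun := fun t => WithLp.toLp 2 fun i => t (e (Sum.inl i))
      map_add' := fun _ _ => rfl
      map_smul' := fun _ _ => rfl }
  let L' : Euc r →L[ℝ] Euc (Fintype.card (Fin r ⊕ Fin k)) := LinearMap.toContinuousLinearMap
    { toFun := fun t => WithLp.toLp 2 fun j => Sum.elim (fun i => t i) 0 (e.symm j)
      map_add' := fun s t => by
        ext j
        rcases h : e.symm j with i | i <;> simp [h]
      map_smul' := fun s t => by
        ext j
        rcases h : e.symm j with i | i <;> simp [h] }
  have hL : ∀ t, L (L' t) = t := fun t => by
    ext i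
    change Sum.elim (fun i => t i) 0 (e.symm (e (Sum.inl i))) = t i
    simp
  have hΨ' := ExpNear.comp_linear hΨ L (Y := fun j => B (e.symm j)) fun y t => by
    rw [fieldComb_reindex, Fintype.sum_sum_type]
    simp [B, fieldComb, L]
    rfl
  obtain ⟨δ, hδ0, hδ, hδs⟩ := W.exists_flow_lift hφ (Ξ := fun j => A (e.symm j))
    (Y := fun j => B (e.symm j)) (fun j => by
      rcases e.symm j with i | j
      · exact hξ i
      · exact hζ j) (by
      filter_upwards [hξ', hζ'] with z h1 h2 j
      rcases e.symm j with i | j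
      · exact h1 i
      · exact h2 j) hΨ'
  have hs := hδs fun v hv => by
    obtain ⟨a, b, hab⟩ := hspan v hv
    refine ⟨WithLp.toLp 2 fun j => Sum.elim a b (e.symm j), ?_⟩
    rw [fieldComb_reindex, hab]
    simp [A, Fintype.sum_sum_type]
  obtain ⟨V₀, hV₀, hV⟩ := exists_opens_of_eventually (hδ.and hs)
  obtain ⟨T, hT, ht, hT'⟩ := W.exists_reduction hL (V₀ := V₀)
    (fun z hz => ⟨(hV z hz).1.1, (hV z hz).2⟩) (fun z hz => (hV z hz).1.2.1)
    (fun z hz z' hz' h1 h2 => by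
      have h3 := (hV z hz).1.2.2
      have h4 := (hV z' hz').1.2.2
      refine (chartAt (Euc m) (W.q w)).injOn h3.2 h4.2 (h3.1.trans (.trans ?_ h4.1.symm))
      dsimp only
      rw [h1, h2]) hV₀
  rw [hδ0] at ht
  exact ⟨T, Span.isBiSubmersion_of_locEq fun t =>
    let ⟨w', hw'⟩ := hT' t
    ⟨W, w', hW, hw'⟩, hT, ht, hT'⟩

end

end

/-! ### From local equivalence at all points to equivalence. -/

noncomputable section

/-- In a nonempty Lindelöf space, countably many of given neighbourhoods of the points cover. -/
theorem exists_seq_cover_nhds {X : Type*} [TopologicalSpace X] [SecondCountableTopology X]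
    [Nonempty X] {f : X → Set X} (hf : ∀ x, f x ∈ 𝓝 x) : ∃ s : ℕ → X, ∀ x, ∃ n, x ∈ f (s n) := by
  obtain ⟨S, hS, hSu⟩ := TopologicalSpace.countable_cover_nhds hf
  have hne : S.Nonempty := by
    obtain ⟨x⟩ := ‹Nonempty X›
    obtain ⟨y, hy, -⟩ := Set.mem_iUnion₂.1 (hSu ▸ Set.mem_univ x)
    exact ⟨y, hy⟩
  obtain ⟨s, rfl⟩ := hS.exists_eq_range hne
  refine ⟨s, fun x => ?_⟩
  obtain ⟨_, ⟨n, rfl⟩, hn⟩ := Set.mem_iUnion₂.1 (hSu ▸ Set.mem_univ x)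
  exact ⟨n, hn⟩

namespace SpanFamily

variable {m : ℕ} {M : Type u} [TopologicalSpace M] [ChartedSpace (Euc m) M]
  [IsManifold (𝓡 m) ∞ M]

/-- The image of each `δ` is a neighbourhood of the point because submersions have local sections.
Second countability selects countably many of these images that cover each piece. -/
theorem exists_cover_of_locEq {A B : SpanFamily m M}
    (h : ∀ a (w : (A.piece a).carrier), ∃ (b : B.ι) (w' : (B.piece b).carrier),
      LocEq (A.piece a) w (B.piece b) w') :
    ∃ (κ : Type) (_ : Countable κ) (V : κ → PureManifold.{u}) (i : κ → A.ι) (j : κ → B.ι)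
      (δ : ∀ k, (V k).carrier → (A.piece (i k)).carrier)
      (η : ∀ k, (V k).carrier → (B.piece (j k)).carrier),
      (∀ k, IsSmoothSubmersion (V k).model (A.piece (i k)).model (δ k)) ∧
      (∀ k, IsSmoothSubmersion (V k).model (B.piece (j k)).model (η k)) ∧
      (∀ (a : A.ι) (w : (A.piece a).carrier), ∃ (k : κ) (v : (V k).carrier),
        (⟨i k, δ k v⟩ : Σ a, (A.piece a).carrier) = ⟨a, w⟩) ∧
      ∀ (k : κ) (v : (V k).carrier),
        (A.piece (i k)).p (δ k v) = (B.piece (j k)).p (η k v) ∧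
        (A.piece (i k)).q (δ k v) = (B.piece (j k)).q (η k v) := by
  unfold LocEq at h
  choose b w' V v δ η hδ hη hp hq hv hw' using h
  have hnhds : ∀ a (w : (A.piece a).carrier), Set.range (δ a w) ∈ 𝓝 w := by
    intro a w
    obtain ⟨σ, hσ⟩ := (hδ a w).exists_section (v a w)
    have h1 := hσ.2
    rw [hv] at h1
    filter_upwards [h1] with y hy using ⟨σ y, hy.2⟩
  -- Empty pieces are discarded, since a sequence of points has to be chosen in each remaining
  -- piece.
  have hseq : ∀ a : {a // Nonempty (A.piece a).carrier}, ∃ s : ℕ → (A.piece a.1).carrier,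
      ∀ w, ∃ n, w ∈ Set.range (δ a.1 (s n)) := by
    rintro ⟨a, ha⟩
    exact exists_seq_cover_nhds (hnhds a)
  choose s hs using hseq
  refine ⟨{a // Nonempty (A.piece a).carrier} × ℕ, inferInstance,
    fun k => V k.1.1 (s k.1 k.2), fun k => k.1.1, fun k => b k.1.1 (s k.1 k.2),
    fun k => δ k.1.1 (s k.1 k.2), fun k => η k.1.1 (s k.1 k.2), fun k => hδ _ _, fun k => hη _ _,
    fun a w => ?_, fun k v => ⟨hp _ _ _, hq _ _ _⟩⟩
  obtain ⟨n, x, hx⟩ := hs ⟨a, ⟨w⟩⟩ w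
  exact ⟨(⟨a, ⟨w⟩⟩, n), x, congrArg (Sigma.mk a) hx⟩

/-- Families that are locally equivalent at all points are equivalent. -/
theorem equivalent_of_locEq {A B : SpanFamily m M}
    (h : ∀ a (w : (A.piece a).carrier), ∃ (b : B.ι) (w' : (B.piece b).carrier),
      LocEq (A.piece a) w (B.piece b) w')
    (h' : ∀ b (w' : (B.piece b).carrier), ∃ (a : A.ι) (w : (A.piece a).carrier),
      LocEq (B.piece b) w' (A.piece a) w) : A.Equivalent B := by
  obtain ⟨κ, _, V, i, j, δ, η, hδ, hη, hc, hpq⟩ := exists_cover_of_locEq h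
  obtain ⟨κ', _, V', j', i', η', δ', hη', hδ', hc', hpq'⟩ := exists_cover_of_locEq h'
  -- One half of the disjoint union is surjective onto `A` and the other onto `B`.
  refine ⟨κ ⊕ κ', inferInstance, Sum.elim V V', Sum.elim i i', Sum.elim j j',
    Sum.rec δ δ', Sum.rec η η', Sum.rec hδ hδ', Sum.rec hη hη', fun a w => ?_, fun b w => ?_,
    Sum.rec hpq fun k v => ⟨(hpq' k v).1.symm, (hpq' k v).2.symm⟩⟩
  · obtain ⟨k, v, hk⟩ := hc a w
    exact ⟨Sum.inl k, v, hk⟩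
  · obtain ⟨k, v, hk⟩ := hc' b w
    exact ⟨Sum.inr k, v, hk⟩

/-- Every point of `A` is locally equivalent to a point of `B`. -/
def LocLE (A B : SpanFamily m M) : Prop :=
  ∀ a (w : (A.piece a).carrier), ∃ (b : B.ι) (w' : (B.piece b).carrier),
    LocEq (A.piece a) w (B.piece b) w'

theorem LocLE.trans {A B C : SpanFamily m M} (h : A.LocLE B) (h' : B.LocLE C) : A.LocLE C := by
  intro a w
  obtain ⟨b, w', hb⟩ := h a w
  obtain ⟨c, w'', hc⟩ := h' b w'
  exact ⟨c, w'', hb.trans hc⟩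

/-- A bi-submersion is locally equivalent to a countable family of bi-submersions of
dimension `r + m`, if `r` is at least the rank of the foliation. -/
theorem IsBiSubmersion.exists_family_dim_eq [T2Space M] [SecondCountableTopology M]
    {F : SingularFoliation m M} {B : SpanFamily m M} (hB : B.IsBiSubmersion F)
    {r : ℕ} (hr : ∀ x, F.rankAt x ≤ r) :
    ∃ A : SpanFamily m M, A.IsBiSubmersion F ∧ (∀ a, (A.piece a).dim = r + m) ∧
      A.LocLE B ∧ B.LocLE A := by
  choose T hT hdim ht hT' using fun (b : B.ι) (w : (B.piece b).carrier) =>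
    (hB b).exists_locEq_dim_eq w (hr _)
  -- The span `T b w` accounts not only for `w` but for all points in the image of the submersion
  -- `δ`, so countably many `T b w` suffice.
  have hnhds : ∀ b (w : (B.piece b).carrier),
      {y | ∃ t', LocEq (B.piece b) y (T b w) t'} ∈ 𝓝 w := by
    intro b w
    obtain ⟨t, V, v, δ, η, hδ, hη, hp, hq, hv, -⟩ := ht b w
    obtain ⟨σ, hσ⟩ := hδ.exists_section v
    have h1 := hσ.2
    rw [hv] at h1
    filter_upwards [h1] with y hy
    exact ⟨η (σ y), V, σ y, δ, η, hδ, hη, hp, hq, hy.2, rfl⟩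
  have hseq : ∀ b : {b // Nonempty (B.piece b).carrier}, ∃ s : ℕ → (B.piece b.1).carrier,
      ∀ w, ∃ n t', LocEq (B.piece b.1) w (T b.1 (s n)) t' := by
    rintro ⟨b, hb⟩
    exact exists_seq_cover_nhds (hnhds b)
  choose s hs using hseq
  refine ⟨⟨{b // Nonempty (B.piece b).carrier} × ℕ, fun k => T k.1.1 (s k.1 k.2)⟩,
    fun k => hT _ _, fun k => hdim _ _, fun k x => ?_, fun b w => ?_⟩
  · obtain ⟨w', hw'⟩ := hT' k.1.1 (s k.1 k.2) x
    exact ⟨_, w', hw'.symm⟩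
  · obtain ⟨n, t', ht'⟩ := hs ⟨b, ⟨w⟩⟩ w
    exact ⟨(⟨b, ⟨w⟩⟩, n), t', ht'⟩

end SpanFamily

end

/-! ### Composition and inversion in a path holonomy atlas. -/

noncomputable section

variable {m : ℕ} {M : Type u} [TopologicalSpace M] [ChartedSpace (Euc m) M]
  [IsManifold (𝓡 m) ∞ M] [T2Space M] [SecondCountableTopology M] {F : SingularFoliation m M}

/-- The section `x ↦ (σ x, σ x)` goes along `σ` and back. -/
theorem Carries.comp_inv {W : Span m M} {w : W.carrier} {φ : M → M} (h : Carries W w φ) :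
    Carries (W.comp W.inv) (⟨w, w, rfl⟩ : FiberProduct W.q W.inv.p) id := by
  obtain ⟨σ, h1, h2⟩ := h
  refine ⟨fun x => (⟨σ x, σ x, rfl⟩ : FiberProduct W.q W.inv.p), ?_, ?_⟩
  · exact FiberProduct.ext h1 h1
  · change ∀ᶠ x in 𝓝 (W.p w), _
    filter_upwards [h2] with x hx
    refine ⟨FiberProduct.contMDiffAt_of_components (F := W.model) W.submersion_q.1
      W.inv.submersion_p hx.1 hx.1, hx.2.1, hx.2.1⟩

namespace PathHolonomyFamily

variable (P : PathHolonomyFamily F)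

theorem isBiSubmersion_letter (a : P.I × Bool) : (P.letter a).IsBiSubmersion F := by
  obtain ⟨i, b⟩ := a
  cases b
  · exact (P.piece i).isBiSubmersion.inv
  · exact (P.piece i).isBiSubmersion

theorem isBiSubmersion_word (a : P.I × Bool) (l : List (P.I × Bool)) :
    (P.word a l).IsBiSubmersion F := by
  induction l generalizing a with
  | nil => exact P.isBiSubmersion_letter a
  | cons b l ih => exact (P.isBiSubmersion_letter a).comp (ih b)

/-- The point `w` of `W` is locally equivalent to a point of the path holonomy atlas. -/
def Reaches (W : Span m M) (w : W.carrier) : Prop :=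
  ∃ a l z, LocEq W w (P.word a l) z

variable {P}

theorem Reaches.of_locEq {W W' : Span m M} {w : W.carrier} {w' : W'.carrier}
    (h : P.Reaches W' w') (hw : LocEq W w W' w') : P.Reaches W w := by
  obtain ⟨a, l, z, hz⟩ := h
  exact ⟨a, l, z, hw.trans hz⟩

theorem reaches_word (a : P.I × Bool) (l : List (P.I × Bool)) (z : (P.word a l).carrier) :
    P.Reaches (P.word a l) z := ⟨a, l, z, .refl _ _⟩

/-- Concatenation of words. Words are bracketed to the right and composition is associative only up
to a diffeomorphism, so each letter costs one use of `LocEq.assoc`. -/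
theorem reaches_word_comp (a : P.I × Bool) (l : List (P.I × Bool)) (b : P.I × Bool)
    (l' : List (P.I × Bool)) (z : ((P.word a l).comp (P.word b l')).carrier) :
    ∃ z', LocEq ((P.word a l).comp (P.word b l')) z (P.word a (l ++ b :: l')) z' := by
  induction l generalizing a with
  | nil => exact ⟨z, .refl _ _⟩
  | cons c l ih =>
    obtain ⟨z', hz'⟩ := ih c
      (FiberProduct.snd ((P.letter a).assoc (P.word c l) (P.word b l') z))
    have h1 := LocEq.assoc (P.letter a) (P.word c l) (P.word b l') z
    have h2 := (FiberProduct.w ((P.letter a).assoc (P.word c l) (P.word b l') z))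
    have h3 := (LocEq.refl (P.letter a)
      (FiberProduct.fst ((P.letter a).assoc (P.word c l) (P.word b l') z))).comp
      (P.isBiSubmersion_letter a) (P.isBiSubmersion_letter a)
      ((P.isBiSubmersion_word c l).comp (P.isBiSubmersion_word b l'))
      (P.isBiSubmersion_word c (l ++ b :: l')) hz' h2 (h2.trans hz'.p_eq)
    exact ⟨_, h1.trans h3⟩

theorem Reaches.comp {W W' : Span m M} {w : W.carrier} {w' : W'.carrier}
    (hW : W.IsBiSubmersion F) (hW' : W'.IsBiSubmersion F) (h : P.Reaches W w)
    (h' : P.Reaches W' w') (hq : W.q w = W'.p w') :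
    P.Reaches (W.comp W') (⟨w, w', hq⟩ : FiberProduct W.q W'.p) := by
  obtain ⟨a, l, z, hz⟩ := h
  obtain ⟨b, l', z', hz'⟩ := h'
  have h1 := hz.comp hW (P.isBiSubmersion_word a l) hW' (P.isBiSubmersion_word b l') hz' hq
    (hz.q_eq.symm.trans (hq.trans hz'.p_eq))
  obtain ⟨y, hy⟩ := reaches_word_comp a l b l' _
  exact ⟨_, _, y, h1.trans hy⟩

/-- The inverse of a word is the reversed word of inverse letters, and the inverse of a letter is
the letter of the other sign. -/
theorem reaches_word_inv (a : P.I × Bool) (l : List (P.I × Bool)) (z : (P.word a l).carrier) :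
    P.Reaches (P.word a l).inv z := by
  induction l generalizing a with
  | nil =>
    obtain ⟨i, b⟩ := a
    cases b
    · exact ⟨(i, true), [], z, .refl _ _⟩
    · exact ⟨(i, false), [], z, .refl _ _⟩
  | cons c l ih =>
    have h1 := LocEq.inv_comp (P.letter a) (P.word c l) z
    have h2 : P.Reaches (P.letter a).inv (FiberProduct.fst z) := by
      obtain ⟨i, b⟩ := a
      cases b
      · exact ⟨(i, true), [], FiberProduct.fst z, .refl _ _⟩
      · exact ⟨(i, false), [], FiberProduct.fst z, .refl _ _⟩
    exact (Reaches.comp (P.isBiSubmersion_word c l).inv (P.isBiSubmersion_letter a).inv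
      (ih c (FiberProduct.snd z)) h2 (FiberProduct.w z).symm).of_locEq h1

theorem Reaches.inv {W : Span m M} {w : W.carrier} (h : P.Reaches W w) : P.Reaches W.inv w := by
  obtain ⟨a, l, z, hz⟩ := h
  exact (reaches_word_inv a l z).of_locEq hz.inv

variable (P) in
/-- Path holonomy atlases contain the germs of the identity. -/
theorem exists_reaches_carries_id (x : M) : ∃ (W : Span m M) (w : W.carrier),
    W.IsBiSubmersion F ∧ (∀ w', P.Reaches W w') ∧ W.p w = x ∧ Carries W w id := by
  obtain ⟨i, z, hz, rfl⟩ := P.cover x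
  obtain ⟨φ, hφ⟩ := exists_carries (P.letter (i, true)) (⟨z, hz⟩ : (P.piece i).W)
  -- For any section of `Wᵢ`, the composite `Wᵢ * Wᵢ⁻¹` carries the identity, so the chosen point
  -- need not have zero time coordinate.
  exact ⟨(P.letter (i, true)).comp (P.letter (i, true)).inv, _,
    (P.isBiSubmersion_letter _).comp (P.isBiSubmersion_letter _).inv, fun w' =>
    Reaches.comp (P.isBiSubmersion_letter _) (P.isBiSubmersion_letter _).inv
      (reaches_word (i, true) [] (FiberProduct.fst w'))
      (reaches_word (i, true) [] (FiberProduct.snd w')).inv (FiberProduct.w w'),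
    rfl, hφ.comp_inv⟩

end PathHolonomyFamily

end

/-! ### Comparison of path holonomy atlases. -/

noncomputable section

open Set

section IntegralCurve

variable {m : ℕ} {M : Type u} [TopologicalSpace M] [ChartedSpace (Euc m) M]
  [IsManifold (𝓡 m) ∞ M]

theorem IsMIntegralCurveOn.hasDerivWithinAt_chart {y₀ : M} {Z : VField (Euc m) M} {γ : ℝ → M}
    {A : Set ℝ} {s : ℝ} (hγ : IsMIntegralCurveOn (I := 𝓡 m) γ Z A) (hs : s ∈ A)
    (hsrc : γ s ∈ (chartAt (Euc m) y₀).source) :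
    HasDerivWithinAt (fun s => chartAt (Euc m) y₀ (γ s))
      (localField y₀ Z (chartAt (Euc m) y₀ (γ s))) A s := by
  have h1 := ((contMDiffAt_chart_of_mem hsrc).mdifferentiableAt
    (by simp)).hasMFDerivAt.comp_hasMFDerivWithinAt s (hγ s hs)
  let T : Euc m →L[ℝ] Euc m := tanChart y₀ (γ s)
  let z : Euc m := Z (γ s)
  have h2 : HasFDerivWithinAt (fun s => chartAt (Euc m) y₀ (γ s))
      (T.comp ((1 : ℝ →L[ℝ] ℝ).smulRight z)) A s := hasMFDerivWithinAt_iff_hasFDerivWithinAt.1 h1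
  rw [localField_chart hsrc]
  change HasDerivWithinAt _ (T z) A s
  simpa using h2.hasDerivWithinAt

/-- An integral curve that starts as a solution of the equation in a chart remains one. -/
theorem IsMIntegralCurveOn.eq_chart_symm [T2Space M] {n : ℕ} {y₀ : M} {Z : VField (Euc m) M}
    {v : Euc m × Euc n → Euc m} {K : NNReal} {S : Set (Euc m × Euc n)} {t : Euc n} (hS : IsOpen S)
    (hK : LipschitzOnWith K v S) (hST : ∀ u ∈ S, u.1 ∈ (chartAt (Euc m) y₀).target)
    (hv : ∀ u, localField y₀ Z u = v (u, t)) {c : ℝ → Euc m}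
    (hc : ∀ s ∈ Icc (0 : ℝ) 1, (c s, t) ∈ S ∧ HasDerivWithinAt c (v (c s, t)) (Icc 0 1) s)
    {γ : ℝ → M} (hγ : IsMIntegralCurveOn (I := 𝓡 m) γ Z (Icc 0 1))
    (h0 : γ 0 = (chartAt (Euc m) y₀).symm (c 0)) :
    ∀ s ∈ Icc (0 : ℝ) 1, γ s = (chartAt (Euc m) y₀).symm (c s) := by
  set e := chartAt (Euc m) y₀
  have hcc : ContinuousOn c (Icc 0 1) := fun s hs => (hc s hs).2.continuousWithinAt
  have hec : ContinuousOn (fun s => e.symm (c s)) (Icc 0 1) :=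
    e.continuousOn_symm.comp hcc fun s hs => hST _ (hc s hs).1
  -- A priori `γ` may leave the chart. The times up to which the curves agree are handled by a
  -- continuity argument: the coincidence set is closed because `M` is Hausdorff, and open to the
  -- right by uniqueness in the chart.
  have hcl : IsClosed ({s | γ s = e.symm (c s)} ∩ Icc 0 1) := by
    rw [inter_comm]
    exact (hγ.continuousOn.prodMk hec).preimage_isClosed_of_isClosed isClosed_Icc
      isClosed_diagonal
  refine hcl.Icc_subset_of_forall_mem_nhdsWithin h0 ?_
  rintro s ⟨hs, hs1⟩
  have hsI : s ∈ Icc (0 : ℝ) 1 := ⟨hs1.1, hs1.2.le⟩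
  have hsrc : γ s ∈ e.source := by
    rw [show γ s = _ from hs]
    exact e.map_target (hST _ (hc s hsI).1)
  have hes : e (γ s) = c s := by
    rw [show γ s = _ from hs]
    exact e.right_inv (hST _ (hc s hsI).1)
  have h1 : ∀ᶠ s' in 𝓝[Icc 0 1] s, γ s' ∈ e.source :=
    (hγ.continuousOn s hsI).eventually (e.open_source.mem_nhds hsrc)
  have h2 : ∀ᶠ s' in 𝓝[Icc 0 1] s, (e (γ s'), t) ∈ S := by
    have h3 := (hγ.hasDerivWithinAt_chart (y₀ := y₀) hsI hsrc).continuousWithinAt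
    have h4 : ContinuousWithinAt (fun s' => (e (γ s'), t)) (Icc 0 1) s :=
      h3.prodMk continuousWithinAt_const
    refine h4.eventually (hS.mem_nhds ?_)
    change (e (γ s), t) ∈ S
    rw [hes]
    exact (hc s hsI).1
  have hle : 𝓝[≥] s ≤ 𝓝[Icc 0 1] s := nhdsWithin_le_of_mem (Icc_mem_nhdsGE_of_mem hs1)
  have h3 : ∀ᶠ s' in 𝓝[≥] s, s' ∈ Icc (0 : ℝ) 1 ∧ γ s' ∈ e.source ∧ (e (γ s'), t) ∈ S :=
    hle ((eventually_mem_nhdsWithin (s := Icc (0 : ℝ) 1)).and (h1.and h2))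
  obtain ⟨b, hb, hsb⟩ := mem_nhdsGE_iff_exists_Icc_subset.1 h3
  have hsub : Icc s b ⊆ Icc 0 1 := fun s' hs' => (hsb hs').1
  have h4 := eqOn_of_lipschitzOnWith hK (lam := t) (α := fun s => e (γ s)) (β := c)
    (a := s) (b := b) (fun s' hs' => ⟨(hsb hs').2.2, by
      rw [← hv]
      exact (hγ.hasDerivWithinAt_chart (hsub hs') (hsb hs').2.1).mono hsub⟩)
    (fun s' hs' => ⟨(hc s' (hsub hs')).1, (hc s' (hsub hs')).2.mono hsub⟩) hes
  filter_upwards [Icc_mem_nhdsGT hb] with s' hs'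
  rw [← h4 hs', e.left_inv (hsb hs').2.1]

theorem localField_sum {n : ℕ} (y₀ : M) (X : Fin n → VField (Euc m) M) (t : Euc n) (u : Euc m) :
    localField y₀ (fun x => ∑ i, t i • X i x) u =
      fieldComb (fun i => localField y₀ (X i)) (u, t) := by
  simp [localField, fieldComb, map_sum]

end IntegralCurve

section

attribute [local instance] chartedSpaceProd chartedSpaceOpens

variable {m : ℕ} {M : Type u} [TopologicalSpace M] [ChartedSpace (Euc m) M]
  [IsManifold (𝓡 m) ∞ M] [T2Space M] [SecondCountableTopology M] {F : SingularFoliation m M}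

/-- Near a point that carries the identity, a bi-submersion contains the exponentials of the
generators. -/
theorem Span.IsBiSubmersion.exists_exp_section {W : Span m M} (hW : W.IsBiSubmersion F)
    {w : W.carrier} (hw : Carries W w id) {O : Opens M} {n : ℕ} {X : Fin n → VField (Euc m) M}
    (hX : F.Generates O X) (hO : W.q w ∈ O) :
    ∃ δ : M × Euc n → W.carrier, ∀ᶠ z in 𝓝 (W.p w, (0 : Euc n)),
      ContMDiffAt 𝓘(ℝ, Euc m × Euc n) 𝓘(ℝ, W.model) ∞ δ z ∧ W.p (δ z) = z.1 ∧
      ∀ γ : ℝ → M, γ 0 = z.1 →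
        IsMIntegralCurveOn (I := 𝓡 m) γ (fun x => ∑ i, z.2 i • X i x) (Icc 0 1) →
        W.q (δ z) = γ 1 := by
  have hpq : W.p w = W.q w := hw.apply_eq
  obtain ⟨k, ξ, -, hξ, -, hξ', -, -⟩ :=
    (hW.chartKerImage hX hO).exists_spanning (W.submersion_p.smoothNear_localMap w)
      (surjective_fderiv_localMap W.submersion_p (mem_chart_source _ _) (mem_chart_source _ _))
  have hB : ∀ i, SmoothNear (localField (W.q w) (X i)) (chartAt (Euc m) (W.q w) (W.q w)) :=
    fun i => smoothNear_localField (F.smooth _ _ (hX.1 i)) hO (mem_chart_source _ _)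
  have hV := smoothNear_fieldComb hB 0
  obtain ⟨K, S₀, hS₀, hK⟩ := hV.exists_lipschitzOnWith
  -- The solutions must remain in the target of the chart to be compared with integral curves on
  -- `M`, and `S` must be open for `IsMIntegralCurveOn.eq_chart_symm`.
  let S := interior S₀ ∩ ((chartAt (Euc m) (W.q w)).target ×ˢ (univ : Set (Euc n)))
  have hSo : IsOpen S :=
    isOpen_interior.inter ((chartAt (Euc m) (W.q w)).open_target.prod isOpen_univ)
  have hS : S ∈ 𝓝 (chartAt (Euc m) (W.q w) (W.q w), (0 : Euc n)) :=
    hSo.mem_nhds ⟨mem_interior_iff_mem_nhds.2 hS₀, mem_chart_target _ _, mem_univ _⟩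
  have hKS : LipschitzOnWith K (fieldComb fun i => localField (W.q w) (X i)) S :=
    hK.mono (inter_subset_left.trans interior_subset)
  obtain ⟨Φ, hΦ, -⟩ := exists_flow hV (.of_forall fun y => fieldComb_zero y) hS
  have hΨ : ExpNear (fun i => localField (W.q w) (X i))
      (chartAt (Euc m) (W.q w) (W.q w)) (Φ 1) := by
    refine ⟨K, S, hS, hKS, ?_⟩
    filter_upwards [hΦ] with z hz
    exact ⟨fun s => Φ s z, hz.2.1, rfl, hz.2.2.2.1⟩
  obtain ⟨δ, -, hδ, -⟩ := W.exists_flow_lift hw hξ hξ' hΨ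
  refine ⟨δ, ?_⟩
  have h1 : Filter.Tendsto (fun z : M × Euc n => (chartAt (Euc m) (W.q w) z.1, z.2))
      (𝓝 (W.p w, 0)) (𝓝 (chartAt (Euc m) (W.q w) (W.q w), 0)) := by
    rw [hpq]
    have h2 := ((chartAt (Euc m) (W.q w)).continuousAt (mem_chart_source _ (W.q w)))
    rw [nhds_prod_eq, nhds_prod_eq]
    exact Filter.Tendsto.prodMap h2 Filter.tendsto_id
  have h2 : ∀ᶠ z in 𝓝 (W.p w, (0 : Euc n)), z.1 ∈ (chartAt (Euc m) (W.q w)).source := by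
    rw [hpq]
    exact continuousAt_fst.eventually
      ((chartAt (Euc m) (W.q w)).open_source.mem_nhds (mem_chart_source _ _))
  filter_upwards [hδ, h1.eventually hΦ, h2] with z hz hzΦ hzs
  refine ⟨hz.1, hz.2.1, fun γ h0 hγ => ?_⟩
  have h3 := hγ.eq_chart_symm hSo hKS (fun u hu => hu.2.1) (localField_sum _ X z.2)
    hzΦ.2.2.2.1 (by rw [h0, hzΦ.2.1, (chartAt (Euc m) (W.q w)).left_inv hzs]) 1
    (right_mem_Icc.2 zero_le_one)
  rw [h3, ← (chartAt (Euc m) (W.q w)).left_inv hz.2.2.2, hz.2.2.1]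
  rfl

/-- Every path holonomy bi-submersion is locally contained in every path holonomy atlas. -/
theorem PathHolonomyData.reaches (P : PathHolonomyFamily F) (D : PathHolonomyData F)
    (hD : D.toSpan.IsBiSubmersion F) (z : D.W) : P.Reaches D.toSpan z := by
  classical
  choose γ hγ0 hγ1 hγd hγ using D.flow
  obtain ⟨⟨x₁, t⟩, hz⟩ := z
  -- The flow of `∑ tᵢ Xᵢ` for the fixed parameter `t` up to time `s`; only its germ at `x₁`
  -- matters.
  let φ : ℝ → M → M := fun s x => if h : (x, t) ∈ D.W then γ ⟨(x, t), h⟩ s else x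
  have hφ : ∀ s x (h : (x, t) ∈ D.W), φ s x = γ ⟨(x, t), h⟩ s := fun s x h => dif_pos h
  have hnear : ∀ᶠ x in 𝓝 x₁, (x, t) ∈ D.W :=
    (Continuous.prodMk_left t).continuousAt.eventually (D.W.isOpen.mem_nhds hz)
  let Good : ℝ → Prop := fun s => ∃ (W : Span m M) (w : W.carrier), W.IsBiSubmersion F ∧
    P.Reaches W w ∧ W.p w = x₁ ∧ Carries W w (φ s)
  have hzero : Good 0 := by
    obtain ⟨W, w, hW, hr, hp, hc⟩ := P.exists_reaches_carries_id x₁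
    refine ⟨W, w, hW, hr w, hp, hc.congr ?_⟩
    rw [hp]
    filter_upwards [hnear] with x hx
    rw [hφ 0 x hx, hγ0]
    rfl
  -- `Good` is locally constant on the connected interval `[0, 1]`, so it propagates from time zero
  -- to time one. This replaces the subdivision of the curve into short pieces.
  have hgood : ∀ s ∈ Icc (0 : ℝ) 1, (Good 0 ↔ Good s) := by
    intro s₁ hs₁
    refine isPreconnected_Icc.induction₂ (fun a b => (Good a ↔ Good b)) (fun s₀ hs₀ => ?_)
      (fun _ _ _ _ _ _ h h' => h.trans h') (fun _ _ _ _ h => h.symm)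
      (left_mem_Icc.2 zero_le_one) hs₁
    obtain ⟨U, u, hU, hr, hp, hc⟩ := P.exists_reaches_carries_id (γ ⟨(x₁, t), hz⟩ s₀)
    have hq : U.q u = γ ⟨(x₁, t), hz⟩ s₀ := hc.apply_eq.symm.trans hp
    obtain ⟨δ, hδ⟩ := hU.exists_exp_section hc D.generates (by rw [hq]; exact hγd _ _ hs₀)
    rw [hp] at hδ
    -- The flow from time `a` to time `b` is the exponential with parameter `(b - a) • t`, which `U`
    -- carries near `γ s₀`. Composing with `U` leads from `φ a` to `φ b`. The sign of `b - a` does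
    -- not matter, so the step works in both directions.
    have hstep : ∀ a ∈ Icc (0 : ℝ) 1, ∀ b ∈ Icc (0 : ℝ) 1,
        (∀ᶠ y in 𝓝 (γ ⟨(x₁, t), hz⟩ a, (b - a) • t),
          ContMDiffAt 𝓘(ℝ, Euc m × Euc D.n) 𝓘(ℝ, U.model) ∞ δ y ∧ U.p (δ y) = y.1 ∧
          ∀ γ : ℝ → M, γ 0 = y.1 →
            IsMIntegralCurveOn (I := 𝓡 m) γ (fun x => ∑ i, y.2 i • D.X i x) (Icc 0 1) →
            U.q (δ y) = γ 1) → Good a → Good b := by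
      rintro a ha b hb hab ⟨W, w, hW, hrw, hpw, hcw⟩
      have hqw : W.q w = γ ⟨(x₁, t), hz⟩ a := by
        rw [← hcw.apply_eq, hpw, hφ a x₁ hz]
      have hpδ := hab.self_of_nhds.2.1
      have hcδ : Carries U (δ (γ ⟨(x₁, t), hz⟩ a, (b - a) • t))
          (fun y => U.q (δ (y, (b - a) • t))) := by
        refine ⟨fun y => δ (y, (b - a) • t), ?_, ?_⟩
        · rw [hpδ]
        · rw [hpδ]
          have h1 := (Continuous.prodMk_left ((b - a) • t)).continuousAt.eventually hab
          filter_upwards [h1] with y hy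
          exact ⟨hy.1.comp y (ContMDiffAt.prodMk_prod contMDiffAt_id contMDiffAt_const),
            hy.2.1, rfl⟩
      have hcomp := hcw.comp hcδ (hqw.trans hpδ.symm)
      refine ⟨W.comp U, _, hW.comp hU, hrw.comp hW hU (hr _) (hqw.trans hpδ.symm), hpw,
        hcomp.congr ?_⟩
      change ∀ᶠ x in 𝓝 (W.p w), _
      -- The path holonomy data only give a curve for each point. The continuity of `φ a` at `x₁`
      -- comes from the section of `W` that carries it.
      have hcont : Filter.Tendsto (fun x => (φ a x, (b - a) • t)) (𝓝 x₁)
          (𝓝 (γ ⟨(x₁, t), hz⟩ a, (b - a) • t)) := by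
        obtain ⟨σ, hσ, hσ'⟩ := hcw
        have h1 := W.submersion_q.1.continuous.continuousAt.comp
          (Carries.continuousAt_section hσ')
        rw [hpw] at h1 hσ'
        have h2 : W.q ∘ σ =ᶠ[𝓝 x₁] φ a := hσ'.mono fun x hx => hx.2.2
        have h3 := h1.congr h2
        rw [ContinuousAt, hφ a x₁ hz] at h3
        exact h3.prodMk_nhds tendsto_const_nhds
      rw [hpw]
      filter_upwards [hnear, hcont.eventually hab] with x hx hxab
      rw [hφ b x hx]
      -- The piece of the integral curve between `a` and `b`, rescaled to `[0, 1]`.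
      have h1 := hxab.2.2 (fun s => γ ⟨(x, t), hx⟩ (s * (b - a) + a))
        (by simp only [zero_mul, zero_add]; rw [hφ a x hx]) (by
          have h2 := ((hγ ⟨(x, t), hx⟩).comp_add a).comp_mul (b - a)
          have h3 : ((b - a) • fun x => ∑ i, t i • D.X i x) =
              (fun x => ∑ i, ((b - a) • t) i • D.X i x : VField (Euc m) M) := by
            funext x
            simp [Finset.smul_sum, smul_smul]
          rw [← h3]
          refine h2.mono fun s hs => ?_
          change s * (b - a) + a ∈ Icc (0 : ℝ) 1
          have h4 : s * (b - a) + a = (1 - s) * a + s * b := by ring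
          rw [h4]
          exact convex_Icc (0 : ℝ) 1 ha hb (sub_nonneg.2 hs.2) hs.1 (by ring))
      simp only [one_mul, sub_add_cancel] at h1
      exact h1.symm
    have hδ' := hδ.eventually_nhds
    have hcγ : ContinuousWithinAt (γ ⟨(x₁, t), hz⟩) (Icc 0 1) s₀ :=
      (hγ ⟨(x₁, t), hz⟩).continuousOn s₀ hs₀
    have h1 : Filter.Tendsto (fun s => (γ ⟨(x₁, t), hz⟩ s, (s₀ - s) • t)) (𝓝[Icc 0 1] s₀)
        (𝓝 (γ ⟨(x₁, t), hz⟩ s₀, 0)) := by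
      have h2 : Continuous fun s : ℝ => (s₀ - s) • t := by fun_prop
      have h3 := h2.tendsto s₀
      rw [sub_self, zero_smul] at h3
      exact hcγ.tendsto.prodMk_nhds (h3.mono_left nhdsWithin_le_nhds)
    have h2 : Filter.Tendsto (fun s => (γ ⟨(x₁, t), hz⟩ s₀, (s - s₀) • t)) (𝓝[Icc 0 1] s₀)
        (𝓝 (γ ⟨(x₁, t), hz⟩ s₀, 0)) := by
      have h2 : Continuous fun s : ℝ => (s - s₀) • t := by fun_prop
      have h3 := h2.tendsto s₀
      rw [sub_self, zero_smul] at h3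
      exact tendsto_const_nhds.prodMk_nhds (h3.mono_left nhdsWithin_le_nhds)
    filter_upwards [h1.eventually hδ', h2.eventually hδ', self_mem_nhdsWithin] with s h3 h4 hs
    exact ⟨hstep s₀ hs₀ s hs h4, hstep s hs s₀ hs₀ h3⟩
  obtain ⟨W, w, hW, hr, hp, hc⟩ := (hgood 1 (right_mem_Icc.2 zero_le_one)).1 hzero
  -- The section is `x ↦ (x, t)` with constant `t`. Since `W` carries the same germ,
  -- `LocEq.of_carries` finishes the proof.
  have hc' : Carries D.toSpan (⟨(x₁, t), hz⟩ : D.W) (φ 1) := by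
    obtain ⟨g, hg, hg'⟩ := exists_retraction (G := Euc m × Euc D.n) D.W ⟨(x₁, t), hz⟩
    refine ⟨fun x => g (x, t), hg ⟨(x₁, t), hz⟩, ?_⟩
    change ∀ᶠ x in 𝓝 x₁, _
    filter_upwards [hnear] with x hx
    have h1 : g (x, t) = ⟨(x, t), hx⟩ := hg ⟨(x, t), hx⟩
    refine ⟨?_, ?_, ?_⟩
    · have h2 : ContMDiffAt (𝓡 m) 𝓘(ℝ, Euc m × Euc D.n) ∞ (fun x => g (x, t)) x :=
        ContMDiffAt.comp (g := g) x (hg' ⟨(x, t), hx⟩).1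
          (ContMDiffAt.prodMk_prod contMDiffAt_id contMDiffAt_const)
      exact h2
    · change (g (x, t)).1.1 = x
      rw [h1]
    · change D.q (g (x, t)) = φ 1 x
      rw [h1, hφ 1 x hx, hγ1]
  exact hr.of_locEq (LocEq.of_carries hD hW hc' hc hp.symm)

/-- Path holonomy atlases are locally contained in each other. -/
theorem PathHolonomyFamily.reaches (P P' : PathHolonomyFamily F) (a : P'.I × Bool)
    (l : List (P'.I × Bool)) (z : (P'.word a l).carrier) : P.Reaches (P'.word a l) z := by
  have hletter : ∀ (a : P'.I × Bool) (z : (P'.letter a).carrier), P.Reaches (P'.letter a) z := by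
    rintro ⟨i, b⟩ z
    cases b
    · exact (PathHolonomyData.reaches P _ (P'.piece i).isBiSubmersion z).inv
    · exact PathHolonomyData.reaches P _ (P'.piece i).isBiSubmersion z
  induction l generalizing a with
  | nil => exact hletter a z
  | cons b l ih =>
    exact (hletter a (FiberProduct.fst z)).comp (P'.isBiSubmersion_letter a)
      (P'.isBiSubmersion_word b l) (ih b (FiberProduct.snd z)) (FiberProduct.w z)

end

end

/-! ### Existence of path holonomy bi-submersions. -/

noncomputable section

open Set

/-- Change of coordinates on the two targets. Injectivity of `Tα` preserves the kernel of `Tp`, and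
`β` carries the fields `X` to `X'`. -/
theorem KerImage.map {E F F' G G' : Type} [NormedAddCommGroup E] [NormedSpace ℝ E]
    [NormedAddCommGroup F] [NormedSpace ℝ F] [NormedAddCommGroup F'] [NormedSpace ℝ F']
    [NormedAddCommGroup G] [NormedSpace ℝ G] [NormedAddCommGroup G'] [NormedSpace ℝ G']
    {n : ℕ} {p : E → F} {q : E → F'} {X : Fin n → F' → F'} {e : E} (h : KerImage p q X e)
    (hp : SmoothNear p e) (hq : SmoothNear q e) {α : F → G} {β : F' → G'}
    (hα : SmoothNear α (p e)) (hαi : ∀ᶠ y in 𝓝 (p e), Function.Injective (fderiv ℝ α y))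
    (hβ : SmoothNear β (q e)) {X' : Fin n → G' → G'}
    (hX : ∀ᶠ y in 𝓝 (q e), ∀ i, fderiv ℝ β y (X i y) = X' i (β y)) :
    KerImage (fun z => α (p z)) (fun z => β (q z)) X' e := by
  have hpc := hp.contDiffAt.continuousAt
  have hqc := hq.contDiffAt.continuousAt
  have h1 : ∀ᶠ z in 𝓝 e, ∀ v, fderiv ℝ (fun z => α (p z)) z v =
      fderiv ℝ α (p z) (fderiv ℝ p z v) := by
    filter_upwards [hp, hpc.eventually hα] with z hz hz' v
    rw [fderiv_fun_comp z (hz'.differentiableAt (by simp)) (hz.differentiableAt (by simp))]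
    rfl
  have h2 : ∀ᶠ z in 𝓝 e, ∀ v, fderiv ℝ (fun z => β (q z)) z v =
      fderiv ℝ β (q z) (fderiv ℝ q z v) := by
    filter_upwards [hq, hqc.eventually hβ] with z hz hz' v
    rw [fderiv_fun_comp z (hz'.differentiableAt (by simp)) (hz.differentiableAt (by simp))]
    rfl
  refine ⟨fun i => ?_, fun ξ hξ hξ0 => ?_⟩
  · obtain ⟨ξ, hξ, hξ'⟩ := h.lift i
    refine ⟨ξ, hξ, ?_⟩
    filter_upwards [hξ', h1, h2, hqc.eventually hX] with z a1 a2 a3 a4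
    rw [a2, a3, a1.1, a1.2, map_zero, a4]
    exact ⟨rfl, rfl⟩
  · obtain ⟨g, hg, hg'⟩ := h.maps ξ hξ (by
      filter_upwards [hξ0, h1, hpc.eventually hαi] with z a1 a2 a3
      rw [a2] at a1
      exact a3 (a1.trans (map_zero _).symm))
    refine ⟨g, hg, ?_⟩
    filter_upwards [hg', h2, hqc.eventually hX] with z a1 a2 a3
    rw [a2, a1, map_sum]
    simp only [map_smul, a3]

section

variable {E : Type} [NormedAddCommGroup E] [NormedSpace ℝ E] {V : Type u} [TopologicalSpace V]
  [ChartedSpace E V] [IsManifold 𝓘(ℝ, E) ∞ V]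

theorem surjective_mfderiv_chart_symm {v₀ : V} {u : E} (hu : u ∈ (chartAt E v₀).target) :
    Function.Surjective (mfderiv 𝓘(ℝ, E) 𝓘(ℝ, E) (chartAt E v₀).symm u) := by
  have h : Function.Surjective (tanChartSymm (E := E) v₀ ((chartAt E v₀).symm u)) := fun e =>
    ⟨_, tanChartSymm_apply ((chartAt E v₀).map_target hu) e⟩
  rwa [tanChartSymm, (chartAt E v₀).right_inv hu] at h

theorem surjective_mfderiv_comp {E₁ E₂ E₃ T₁ T₂ T₃ : Type*} [NormedAddCommGroup E₁]
    [NormedSpace ℝ E₁] [NormedAddCommGroup E₂] [NormedSpace ℝ E₂] [NormedAddCommGroup E₃]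
    [NormedSpace ℝ E₃] [TopologicalSpace T₁] [ChartedSpace E₁ T₁] [TopologicalSpace T₂]
    [ChartedSpace E₂ T₂] [TopologicalSpace T₃] [ChartedSpace E₃ T₃] {f : T₁ → T₂} {g : T₂ → T₃}
    {x : T₁} (hg : ContMDiffAt 𝓘(ℝ, E₂) 𝓘(ℝ, E₃) ∞ g (f x))
    (hf : ContMDiffAt 𝓘(ℝ, E₁) 𝓘(ℝ, E₂) ∞ f x)
    (hgs : Function.Surjective (mfderiv 𝓘(ℝ, E₂) 𝓘(ℝ, E₃) g (f x)))
    (hfs : Function.Surjective (mfderiv 𝓘(ℝ, E₁) 𝓘(ℝ, E₂) f x)) :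
    Function.Surjective (mfderiv 𝓘(ℝ, E₁) 𝓘(ℝ, E₃) (fun x => g (f x)) x) := by
  have h := mfderiv_comp x (g := g) (hg.mdifferentiableAt (by simp)) (hf.mdifferentiableAt (by simp))
  intro v
  obtain ⟨u, hu⟩ := hgs v
  obtain ⟨w, hw⟩ := hfs u
  exact ⟨w, (DFunLike.congr_fun h w).trans (by rw [← hu, ← hw]; rfl)⟩

variable {m : ℕ} {M : Type u} [TopologicalSpace M] [ChartedSpace (Euc m) M]
  [IsManifold (𝓡 m) ∞ M]

theorem fderiv_localMap_id {x₀ y₁ : M} {y : M} (h₀ : y ∈ (chartAt (Euc m) x₀).source)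
    (h₁ : y ∈ (chartAt (Euc m) y₁).source) (ξ : TangentSpace (𝓡 m) y) :
    fderiv ℝ (localMap (Euc m) (Euc m) x₀ y₁ (id : M → M)) (chartAt (Euc m) x₀ y)
      (tanChart x₀ y ξ) = tanChart y₁ y ξ := by
  rw [fderiv_localMap (f := (id : M → M)) contMDiffAt_id h₀ h₁, mfderiv_id]
  rfl

/-- A pair of maps that is given in some coordinates by `p'` and `q'`. -/
theorem chartKerImage_of_kerImage [FiniteDimensional ℝ E] {G : Type} [NormedAddCommGroup G]
    [NormedSpace ℝ G] [FiniteDimensional ℝ G] {p q : V → M} {v : V} {g : V → G}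
    {p' q' : G → Euc m} {x₀ : M} {n : ℕ} {X : Fin n → VField (Euc m) M}
    (hg : ∀ᶠ y in 𝓝 v, ContMDiffAt 𝓘(ℝ, E) 𝓘(ℝ, G) ∞ g y)
    (hgs : Function.Surjective (mfderiv 𝓘(ℝ, E) 𝓘(ℝ, G) g v))
    (h : KerImage p' q' (fun i => localField x₀ (X i)) (g v)) (hp' : SmoothNear p' (g v))
    (hq' : SmoothNear q' (g v)) (hs : Function.Surjective (fderiv ℝ p' (g v)))
    (hpt : p' (g v) ∈ (chartAt (Euc m) x₀).target) (hqt : q' (g v) ∈ (chartAt (Euc m) x₀).target)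
    (hp : ∀ᶠ y in 𝓝 v, p y = (chartAt (Euc m) x₀).symm (p' (g y)))
    (hq : ∀ᶠ y in 𝓝 v, q y = (chartAt (Euc m) x₀).symm (q' (g y))) :
    ChartKerImage E p q X v := by
  set κ := chartAt (Euc m) x₀
  let δ : E → G := fun u => g ((chartAt E v).symm u)
  have hv := mem_chart_source E v
  have hδv : δ (chartAt E v v) = g v := by
    simp only [δ]
    rw [(chartAt E v).left_inv hv]
  have hδ : SmoothNear δ (chartAt E v v) := by
    filter_upwards [eventually_symm_chart hv hg] with u hu
    rw [← contMDiffAt_iff_contDiffAt]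
    exact ContMDiffAt.comp (g := g) u hu.2 (contMDiffAt_chart_symm_of_mem hu.1)
  have hδs : Function.Surjective (fderiv ℝ δ (chartAt E v v)) := by
    have hvt := (chartAt E v).map_source hv
    rw [← mfderiv_eq_fderiv]
    refine surjective_mfderiv_comp (g := g) ?_ (contMDiffAt_chart_symm_of_mem hvt) ?_
      (surjective_mfderiv_chart_symm hvt)
    · rw [(chartAt E v).left_inv hv]
      exact hg.self_of_nhds
    · rwa [(chartAt E v).left_inv hv]
  have hpv : p v = κ.symm (p' (g v)) := hp.self_of_nhds
  have hqv : q v = κ.symm (q' (g v)) := hq.self_of_nhds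
  have hpvs : p v ∈ κ.source := hpv ▸ κ.map_target hpt
  have hqvs : q v ∈ κ.source := hqv ▸ κ.map_target hqt
  have hκp : κ (p v) = p' (g v) := by rw [hpv, κ.right_inv hpt]
  have hκq : κ (q v) = q' (g v) := by rw [hqv, κ.right_inv hqt]
  have hδc : ContinuousAt δ (chartAt E v v) := hδ.contDiffAt.continuousAt
  have hp'δ : SmoothNear (fun u => p' (δ u)) (chartAt E v v) :=
    SmoothNear.comp (h := p') (hδv.symm ▸ hp') hδ
  have hq'δ : SmoothNear (fun u => q' (δ u)) (chartAt E v v) :=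
    SmoothNear.comp (h := q') (hδv.symm ▸ hq') hδ
  -- Passage from the coordinates `G` to the chart of `V`, by `KerImage.transfer` along `δ` and the
  -- identity. Both targets are still read in the chart around `x₀`; `h2` changes to the charts
  -- around `p v` and `q v`.
  have h1 : KerImage (fun u => p' (δ u)) (fun u => q' (δ u)) (fun i => localField x₀ (X i))
      (chartAt E v v) :=
    KerImage.transfer (G := E) (η := id) (g₀ := chartAt E v v) h hp' hq' hs hp'δ hq'δ hδ hδv hδs
      (.of_forall fun _ => contDiffAt_id) (by rw [fderiv_id]; exact Function.surjective_id)
      (.of_forall fun _ => rfl) (.of_forall fun _ => rfl)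
  have hpe : κ (p v) = p' (δ (chartAt E v v)) := by rw [hδv, hκp]
  have hqe : κ (q v) = q' (δ (chartAt E v v)) := by rw [hδv, hκq]
  have hid : ∀ y : M, y ∈ κ.source → ∀ᶠ u in 𝓝 (κ y),
      u ∈ κ.target ∧ κ.symm u ∈ (chartAt (Euc m) y).source := fun y hy =>
    eventually_symm_chart hy ((chartAt (Euc m) y).open_source.mem_nhds (mem_chart_source _ y))
  have h2 := h1.map hp'δ hq'δ
    (α := localMap (Euc m) (Euc m) x₀ (p v) (id : M → M))
    (β := localMap (Euc m) (Euc m) x₀ (q v) (id : M → M))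
    (X' := fun i => localField (q v) (X i))
    (by
      rw [← hpe]
      exact smoothNear_localMap (.of_forall fun _ => contMDiffAt_id) hpvs (mem_chart_source _ _))
    (by
      rw [← hpe]
      filter_upwards [hid _ hpvs] with u hu
      have hus := κ.map_target hu.1
      intro a b hab
      rw [← κ.right_inv hu.1, ← tanChart_symm hus a, ← tanChart_symm hus b,
        fderiv_localMap_id hus hu.2, fderiv_localMap_id hus hu.2] at hab
      rw [← tanChart_symm hus a, ← tanChart_symm hus b, tanChart_injective hu.2 hab])
    (by
      rw [← hqe]
      exact smoothNear_localMap (.of_forall fun _ => contMDiffAt_id) hqvs (mem_chart_source _ _))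
    (by
      rw [← hqe]
      filter_upwards [hid _ hqvs] with u hu i
      have hus := κ.map_target hu.1
      have h3 := fderiv_localMap_id hus hu.2 (X i (κ.symm u))
      rw [κ.right_inv hu.1] at h3
      refine h3.trans ?_
      exact (localField_chart hu.2 (X i)).symm)
  refine h2.congr ?_ ?_
  · filter_upwards [eventually_symm_chart hv hp] with u hu
    simp only [localMap, hu.2]
    rfl
  · filter_upwards [eventually_symm_chart hv hq] with u hu
    simp only [localMap, hu.2]
    rfl

end

section Existence

/-- The standard manifold structure of `ℝᵐ × ℝⁿ`. -/
@[reducible]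
def chartedSpaceEucProd (m n : ℕ) : ChartedSpace (Euc m × Euc n) (Euc m × Euc n) :=
  chartedSpaceSelf _

attribute [local instance] chartedSpaceProd chartedSpaceOpens chartedSpaceEucProd

variable {m : ℕ} {M : Type u} [TopologicalSpace M] [ChartedSpace (Euc m) M]
  [IsManifold (𝓡 m) ∞ M]

/-- The brackets belong to `F` and are therefore combinations of the generators, and charts respect
brackets. -/
theorem exists_lieBracket_eq_sum {F : SingularFoliation m M} {O : Opens M} {n : ℕ}
    {X : Fin n → VField (Euc m) M} (hX : F.Generates O X) {x₀ : M} (hO : x₀ ∈ O) :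
    ∃ c : Fin n → Fin n → Fin n → Euc m → ℝ,
      (∀ k i j, SmoothNear (c k i j) (chartAt (Euc m) x₀ x₀)) ∧
      ∀ᶠ u in 𝓝 (chartAt (Euc m) x₀ x₀), ∀ k i,
        VectorField.lieBracket ℝ (localField x₀ (X k)) (localField x₀ (X i)) u =
          ∑ j, c k i j u • localField x₀ (X j) u := by
  choose f hf hfX using fun k i => hX.2 O le_rfl _ (F.lie_mem O _ (hX.1 k) _ (hX.1 i))
  refine ⟨fun k i j u => f k i j ((chartAt (Euc m) x₀).symm u), fun k i j =>
    smoothNear_localFun (hf k i j) hO (mem_chart_source _ _), ?_⟩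
  filter_upwards [eventually_symm_chart (mem_chart_source (Euc m) x₀) (O.eventually_mem hO)]
    with u hu k i
  have hus := (chartAt (Euc m) x₀).map_target hu.1
  have h1 := localField_mlieBracket (F.smooth _ _ (hX.1 k)) (F.smooth _ _ (hX.1 i)) hu.2 hus
  rw [(chartAt (Euc m) x₀).right_inv hu.1] at h1
  rw [← h1]
  simp only [localField]
  rw [hfX k i _ hu.2, map_sum]
  simp only [map_smul]

variable {n : ℕ}

theorem contMDiffAt_chart_prod {x₀ : M} {z : M × Euc n}
    (hz : z.1 ∈ (chartAt (Euc m) x₀).source) :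
    ContMDiffAt 𝓘(ℝ, Euc m × Euc n) 𝓘(ℝ, Euc m × Euc n) ∞
      (fun z : M × Euc n => (chartAt (Euc m) x₀ z.1, z.2)) z :=
  ContMDiffAt.prodMk_space ((contMDiffAt_chart_of_mem hz).comp z (contMDiff_fst_prod z))
    (contMDiff_snd_prod z)

theorem surjective_mfderiv_chart_prod {x₀ : M} {z : M × Euc n}
    (hz : z.1 ∈ (chartAt (Euc m) x₀).source) :
    Function.Surjective (mfderiv 𝓘(ℝ, Euc m × Euc n) 𝓘(ℝ, Euc m × Euc n)
      (fun z : M × Euc n => (chartAt (Euc m) x₀ z.1, z.2)) z) := by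
  set κ := chartAt (Euc m) x₀
  have hzt := κ.map_source hz
  have h1 : ContMDiffAt 𝓘(ℝ, Euc m × Euc n) 𝓘(ℝ, Euc m × Euc n) ∞
      (fun y : Euc m × Euc n => (κ.symm y.1, y.2)) (κ z.1, z.2) :=
    ContMDiffAt.prodMk_prod
      ((contMDiffAt_chart_symm_of_mem (v₀ := x₀) hzt).comp (κ z.1, z.2)
        (contDiff_fst.contMDiff _)) (contDiff_snd.contMDiff _)
  have h2 : (κ.symm (κ z.1), z.2) = z := by rw [κ.left_inv hz]
  have h3 : ∀ᶠ y in 𝓝 (κ z.1, z.2), y.1 ∈ κ.target :=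
    continuousAt_fst.eventually (κ.open_target.mem_nhds hzt)
  have h4 := mfderiv_surjective_of_section (f := fun z : M × Euc n => (κ z.1, z.2))
    (σ := fun y : Euc m × Euc n => (κ.symm y.1, y.2)) (y := (κ z.1, z.2))
    (by
      change MDifferentiableAt _ _ _ (κ.symm (κ z.1), z.2)
      rw [h2]
      exact (contMDiffAt_chart_prod hz).mdifferentiableAt (by simp))
    (h1.mdifferentiableAt (by simp))
    (h3.mono fun y hy => by simp only; rw [κ.right_inv hy])
  change Function.Surjective (mfderiv _ _ _ (κ.symm (κ z.1), z.2)) at h4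
  rwa [h2] at h4

variable [T2Space M] [SecondCountableTopology M]

/-- Path holonomy bi-submersions exist near every point. -/
theorem SingularFoliation.exists_pathHolonomy (F : SingularFoliation m M) (x₀ : M) :
    ∃ D : PathHolonomy F, D.base = x₀ := by
  obtain ⟨O, n, X, hO, hX⟩ := F.exists_generates x₀
  obtain ⟨c, hc, hbr⟩ := exists_lieBracket_eq_sum hX hO
  set κ := chartAt (Euc m) x₀
  have hB : ∀ i, SmoothNear (localField x₀ (X i)) (κ x₀) :=
    fun i => smoothNear_localField (F.smooth _ _ (hX.1 i)) hO (mem_chart_source _ _)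
  obtain ⟨Φ, hΦ⟩ := exists_exp_kerImage hB hc hbr
    (eventually_symm_chart (mem_chart_source (Euc m) x₀) (O.eventually_mem hO))
  have hx₀ := mem_chart_source (Euc m) x₀
  -- The inner quantifier keeps the properties of the exponential on a neighbourhood of each point
  -- of `W`, as the germ conditions there require.
  have hev : ∀ᶠ z in 𝓝 (x₀, (0 : Euc n)), z.1 ∈ κ.source ∧ ∀ᶠ y in 𝓝 (κ z.1, z.2),
      Φ 0 y = y.1 ∧ (∀ s ∈ Icc (0 : ℝ) 1, (Φ s y ∈ κ.target ∧ κ.symm (Φ s y) ∈ O) ∧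
        HasDerivWithinAt (fun s => Φ s y)
          (fieldComb (fun i => localField x₀ (X i)) (Φ s y, y.2)) (Icc 0 1) s) ∧
      ContDiffAt ℝ ∞ (Φ 1) y ∧ Function.Surjective (fderiv ℝ (Φ 1) y) ∧
      KerImage Prod.fst (Φ 1) (fun i => localField x₀ (X i)) y ∧
      KerImage (Φ 1) Prod.fst (fun i => localField x₀ (X i)) y := by
    have h1 : ContinuousAt (fun z : M × Euc n => (κ z.1, z.2)) (x₀, 0) :=
      (ContinuousAt.comp (f := Prod.fst) (x := (x₀, (0 : Euc n))) (κ.continuousAt hx₀)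
        continuousAt_fst).prodMk continuousAt_snd
    exact (continuousAt_fst.eventually (κ.open_source.mem_nhds hx₀)).and
      (h1.eventually hΦ.eventually_nhds)
  obtain ⟨W, hW₀, hW⟩ := exists_opens_of_eventually hev
  let g : M × Euc n → Euc m × Euc n := fun z => (κ z.1, z.2)
  let q : M × Euc n → M := fun z => κ.symm (Φ 1 (g z))
  have h1I : (1 : ℝ) ∈ Icc (0 : ℝ) 1 := right_mem_Icc.2 zero_le_one
  have hqs : ∀ z ∈ W, ContMDiffAt 𝓘(ℝ, Euc m × Euc n) (𝓡 m) ∞ q z ∧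
      Function.Surjective (mfderiv 𝓘(ℝ, Euc m × Euc n) (𝓡 m) q z) := by
    intro z hz
    obtain ⟨hzs, hzΦ⟩ := hW z hz
    obtain ⟨-, hs, hd, hds, -⟩ := hzΦ.self_of_nhds
    have a1 := contMDiffAt_chart_symm_of_mem (v₀ := x₀) (hs 1 h1I).1.1
    have a2 : ContMDiffAt 𝓘(ℝ, Euc m × Euc n) 𝓘(ℝ, Euc m) ∞ (fun z => Φ 1 (g z)) z :=
      ContMDiffAt.comp (g := Φ 1) z hd.contMDiffAt (contMDiffAt_chart_prod hzs)
    refine ⟨ContMDiffAt.comp (g := κ.symm) z a1 a2, ?_⟩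
    refine surjective_mfderiv_comp (g := κ.symm) a1 a2
      (surjective_mfderiv_chart_symm (hs 1 h1I).1.1) ?_
    refine surjective_mfderiv_comp (g := Φ 1) hd.contMDiffAt (contMDiffAt_chart_prod hzs) ?_
      (surjective_mfderiv_chart_prod hzs)
    rw [mfderiv_eq_fderiv]
    exact hds
  let D : PathHolonomyData F :=
    { base := x₀
      dom := O
      base_mem_dom := hO
      n := n
      X := X
      generates := hX
      W := W
      base_mem := hW₀
      q := fun z => q z.1
      flow := by
        rintro ⟨z, hz⟩
        obtain ⟨hzs, hzΦ⟩ := hW z hz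
        obtain ⟨h0, hs, -⟩ := hzΦ.self_of_nhds
        refine ⟨fun s => κ.symm (Φ s (g z)), ?_, rfl, fun s hsI => (hs s hsI).1.2,
          fun s hsI => ?_⟩
        · simp only [g]
          rw [h0, κ.left_inv hzs]
        · have ht := (hs s hsI).1.1
          let v : Euc m := fieldComb (fun i => localField x₀ (X i)) (Φ s (g z), z.2)
          have a0 : HasFDerivWithinAt (fun s => Φ s (g z))
            (ContinuousLinearMap.toSpanSingleton ℝ v) (Icc 0 1) s :=
            (hs s hsI).2.hasFDerivWithinAt
          have a1 := ((contMDiffAt_chart_symm_of_mem (v₀ := x₀) ht).mdifferentiableAt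
            (by simp)).hasMFDerivAt.comp_hasMFDerivWithinAt s a0.hasMFDerivWithinAt
          -- The inverse chart takes the velocity in coordinates back to the value of `∑ tᵢ Xᵢ` on
          -- `M`.
          have a2 : mfderiv 𝓘(ℝ, Euc m) 𝓘(ℝ, Euc m) κ.symm (Φ s (g z)) v =
              ∑ i, z.2 i • X i (κ.symm (Φ s (g z))) := by
            simp only [v]
            rw [← localField_sum]
            have a3 := tanChartSymm_apply (κ.map_target ht)
              (∑ i, z.2 i • X i (κ.symm (Φ s (g z))))
            rw [tanChartSymm, κ.right_inv ht] at a3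
            exact a3
          refine a1.congr_mfderiv ?_
          refine ContinuousLinearMap.ext fun r => ?_
          exact (ContinuousLinearMap.map_smul
            (mfderiv 𝓘(ℝ, Euc m) 𝓘(ℝ, Euc m) κ.symm (Φ s (g z))) r v).trans
            (congrArg (fun v : Euc m => (show ℝ from r) • v) a2)
      submersion_q := isSmoothSubmersion_restrict W hqs }
  have hgW : ∀ w : W, ContMDiffAt 𝓘(ℝ, Euc m × Euc n) 𝓘(ℝ, Euc m × Euc n) ∞
      (fun w : W => g w.1) w := fun w =>
    ContMDiffAt.comp (g := g) w (contMDiffAt_chart_prod (hW w.1 w.2).1)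
      ((isSmoothSubmersion_subtype_val (G := Euc m × Euc n) W).1 w)
  have hgWs : ∀ w : W, Function.Surjective (mfderiv 𝓘(ℝ, Euc m × Euc n) 𝓘(ℝ, Euc m × Euc n)
      (fun w : W => g w.1) w) := fun w =>
    surjective_mfderiv_comp (g := g) (contMDiffAt_chart_prod (hW w.1 w.2).1)
      ((isSmoothSubmersion_subtype_val (G := Euc m × Euc n) W).1 w)
      (surjective_mfderiv_chart_prod (hW w.1 w.2).1)
      ((isSmoothSubmersion_subtype_val (G := Euc m × Euc n) W).2 w)
  have hmW := isManifold_opens (m := m) W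
  have hD : D.toSpan.IsBiSubmersion F := by
    refine Span.isBiSubmersion_of_chartKerImage (fun w => ?_) fun w => ?_
    · obtain ⟨w, hw⟩ : W := w
      obtain ⟨hws, hwΦ⟩ := hW w hw
      obtain ⟨h0, hs, hd, hds, hk, -⟩ := hwΦ.self_of_nhds
      refine ⟨O, n, X, (hs 1 h1I).1.2, hX, ?_⟩
      exact chartKerImage_of_kerImage (E := Euc m × Euc n) (V := W) (v := ⟨w, hw⟩)
        (p := fun z : W => z.1.1) (q := fun z : W => q z.1) (g := fun w : W => g w.1)
        (p' := Prod.fst) (q' := Φ 1) (x₀ := x₀) (.of_forall hgW) (hgWs _) hk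
        (.of_forall fun _ => contDiffAt_fst) (hwΦ.mono fun y hy => hy.2.2.1)
        (by rw [fderiv_fst]; exact Prod.fst_surjective) (κ.map_source hws) (hs 1 h1I).1.1
        (.of_forall fun y => (κ.left_inv (hW y.1 y.2).1).symm) (.of_forall fun y => rfl)
    · obtain ⟨w, hw⟩ : W := w
      obtain ⟨hws, hwΦ⟩ := hW w hw
      obtain ⟨h0, hs, hd, hds, -, hk⟩ := hwΦ.self_of_nhds
      have hwO : w.1 ∈ O := by
        have := (hs 0 (left_mem_Icc.2 zero_le_one)).1.2
        rwa [h0, κ.left_inv hws] at this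
      refine ⟨O, n, X, hwO, hX, ?_⟩
      exact chartKerImage_of_kerImage (E := Euc m × Euc n) (V := W) (v := ⟨w, hw⟩)
        (q := fun z : W => z.1.1) (p := fun z : W => q z.1) (g := fun w : W => g w.1)
        (q' := Prod.fst) (p' := Φ 1) (x₀ := x₀) (.of_forall hgW) (hgWs _) hk
        (hwΦ.mono fun y hy => hy.2.2.1) (.of_forall fun _ => contDiffAt_fst)
        hds (hs 1 h1I).1.1 (κ.map_source hws)
        (.of_forall fun y => rfl) (.of_forall fun y => (κ.left_inv (hW y.1 y.2).1).symm)
  exact ⟨⟨D, hD⟩, rfl⟩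

/-- The first projection of a path holonomy bi-submersion covers a neighbourhood of its base point,
so countably many cover `M`. For empty `M` the empty family does. -/
theorem SingularFoliation.nonempty_pathHolonomyFamily (F : SingularFoliation m M) :
    Nonempty (PathHolonomyFamily F) := by
  rcases isEmpty_or_nonempty M with hM | hM
  · exact ⟨⟨Empty, fun i => i.elim, fun x => hM.elim x⟩⟩
  choose D hD using F.exists_pathHolonomy
  have hnhds : ∀ x, {y | ∃ z ∈ (D x).W, z.1 = y} ∈ 𝓝 x := by
    intro x
    have h1 := (D x).base_mem
    rw [hD] at h1
    filter_upwards [(Continuous.prodMk_left (0 : Euc (D x).n)).continuousAt.eventually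
      ((D x).W.isOpen.mem_nhds h1)] with y hy using ⟨(y, 0), hy, rfl⟩
  obtain ⟨s, hs⟩ := exists_seq_cover_nhds hnhds
  exact ⟨⟨ℕ, fun k => D (s k), hs⟩⟩

end Existence

end

/-! ### Atlas properties and the conclusion. -/

noncomputable section

section

variable {m : ℕ} {M : Type u} [TopologicalSpace M] [ChartedSpace (Euc m) M]
  [IsManifold (𝓡 m) ∞ M] [T2Space M] [SecondCountableTopology M] {F : SingularFoliation m M}

namespace SpanFamily

variable {P : PathHolonomyFamily F} {A B : SpanFamily m M}

theorem LocLE.reaches (h : A.LocLE P.atlas) (a : A.ι) (w : (A.piece a).carrier) :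
    P.Reaches (A.piece a) w := by
  obtain ⟨b, z, hz⟩ := h a w
  exact ⟨b.1, b.2, z, hz⟩

theorem locLE_atlas_iff :
    A.LocLE P.atlas ↔ ∀ a (w : (A.piece a).carrier), P.Reaches (A.piece a) w :=
  ⟨LocLE.reaches, fun h a w =>
    let ⟨b, l, z, hz⟩ := h a w
    ⟨(b, l), z, hz⟩⟩

theorem atlas_locLE_iff : P.atlas.LocLE A ↔
    ∀ (W : Span m M) (w : W.carrier), P.Reaches W w →
      ∃ (a : A.ι) (t : (A.piece a).carrier), LocEq W w (A.piece a) t := by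
  refine ⟨fun h W w => ?_, fun h b z => h _ z (PathHolonomyFamily.reaches_word b.1 b.2 z)⟩
  rintro ⟨b, l, z, hz⟩
  obtain ⟨a, t, ht⟩ := h (b, l) z
  exact ⟨a, t, hz.trans ht⟩

theorem LocLE.comp (hA : A.IsBiSubmersion F) (h : A.LocLE P.atlas) : (A.comp A).LocLE P.atlas := by
  rw [locLE_atlas_iff]
  intro a w
  exact (h.reaches a.1 (FiberProduct.fst w)).comp (hA a.1) (hA a.2)
    (h.reaches a.2 (FiberProduct.snd w)) (FiberProduct.w w)

/-- A germ equals its composite with the identity at its target, and `A` carries the identity germs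
because it contains the path holonomy atlas locally. -/
theorem locLE_comp_self (hA : A.IsBiSubmersion F) (h : P.atlas.LocLE A) : A.LocLE (A.comp A) := by
  intro a w
  obtain ⟨φ, hφ⟩ := exists_carries (A.piece a) w
  obtain ⟨U, u, hU, hr, hp, hu⟩ := P.exists_reaches_carries_id ((A.piece a).q w)
  obtain ⟨b, t, ht⟩ := atlas_locLE_iff.1 h U u (hr u)
  have hq : (A.piece a).q w = (A.piece b).p t := hp.symm.trans ht.p_eq
  exact ⟨(a, b), _, LocEq.of_carries (hA a) ((hA a).comp (hA b)) hφ
    (hφ.comp (ht.carries hu) hq) rfl⟩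

theorem inv_locLE (h : A.LocLE P.atlas) (h' : P.atlas.LocLE A) : A.inv.LocLE A := fun a w =>
  atlas_locLE_iff.1 h' _ _ (h.reaches a w).inv

theorem locLE_inv (h : A.LocLE P.atlas) (h' : P.atlas.LocLE A) : A.LocLE A.inv := by
  intro a w
  obtain ⟨b, t, ht⟩ := atlas_locLE_iff.1 h' _ _ (h.reaches a w).inv
  exact ⟨b, t, ht.inv⟩

/-- Everything that is locally the same as the path holonomy atlas inherits its closure under
composition and inversion. -/
theorem isAtlas_of_locLE (hA : A.IsBiSubmersion F) (h : A.LocLE P.atlas)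
    (h' : P.atlas.LocLE A) : A.IsAtlas F :=
  ⟨hA, equivalent_of_locEq ((LocLE.comp hA h).trans h') (locLE_comp_self hA h'),
    equivalent_of_locEq (locLE_inv h h') (inv_locLE h h')⟩

end SpanFamily

theorem PathHolonomyFamily.atlas_locLE (P P' : PathHolonomyFamily F) :
    P.atlas.LocLE P'.atlas :=
  SpanFamily.locLE_atlas_iff.2 fun a w => P'.reaches P a.1 a.2 w

end

theorem mainTheorem9 (m : ℕ) (M : Type u) [TopologicalSpace M] [T2Space M]
    [SecondCountableTopology M] [ChartedSpace (EuclideanSpace ℝ (Fin m)) M]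
    [IsManifold (𝓡 m) ∞ M] (F : SingularFoliation m M) (hF : F.IsCoherent)
    (r : ℕ) (hr : F.rank = r) :
    ∃ A : SpanFamily m M, A.IsHolonomyAtlas F (r + m) ∧
      ∀ P : PathHolonomyFamily F, A.Equivalent P.atlas := by
  obtain ⟨P₀⟩ := F.nonempty_pathHolonomyFamily
  have hrank : ∀ x, F.rankAt x ≤ r := fun x => by
    have h : (F.rankAt x : ℕ∞) ≤ F.rank := le_iSup (fun x => (F.rankAt x : ℕ∞)) x
    rw [hr] at h
    exact_mod_cast h
  -- The pieces of one path holonomy atlas are replaced by pieces of the single dimension `r + m`.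
  -- Any other path holonomy atlas is reached through this one by `PathHolonomyFamily.atlas_locLE`.
  obtain ⟨A, hA, hdim, h, h'⟩ := SpanFamily.IsBiSubmersion.exists_family_dim_eq (F := F)
    (B := P₀.atlas) (fun a => P₀.isBiSubmersion_word a.1 a.2) hrank
  have hP : ∀ P : PathHolonomyFamily F, A.Equivalent P.atlas := fun P =>
    SpanFamily.equivalent_of_locEq (h.trans (P₀.atlas_locLE P)) ((P.atlas_locLE P₀).trans h')
  exact ⟨A, ⟨SpanFamily.isAtlas_of_locLE hA h h', ⟨P₀, hP P₀⟩, hdim⟩, hP⟩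

end
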